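/- Let $M$ be a smooth $n$-dimensional manifold (Hausdorff, second countable, without boundary) with a twisted Poisson structure $(\pi,\psi)$: $\pi$ is a smooth bivector field and $\psi$ a smooth closed $3$-form on $M$ such that $\frac12[\pi,\pi]=(\wedge^3\pi^\sharp)\psi$, where $[\cdot,\cdot]$ is the Schouten (Gerstenhaber) bracket, determined on decomposable bivectors by $[a_1\wedge a_2,b_1\wedge b_2]=\sum_{k,l}(-1)^{k+l}[a_k,b_l]\wedge a_{k'}\wedge b_{l'}$ with $\{k,k'\}=\{l,l'\}=\{1,2\}$, and $\pi^\sharp:T^*M\to TM$ is given by $\langle\beta,\pi^\sharp\alpha\rangle=\pi(\alpha,\beta)$. Put $\psi^{(2)}(\alpha,\beta)=\psi(\pi^\sharp\alpha,\pi^\sharp\beta,\cdot)$. The cotangent Lie algebroid of $(M,\pi,\psi)$ is $T^*M$ with anchor $\pi^\sharp$ and bracket $$[\alpha,\beta]_{\pi,\psi}=\mathcal L_{\pi^\sharp\alpha}\beta-\mathcal L_{\pi^\sharp\beta}\alpha-d(\pi(\alpha,\beta))+\psi^{(2)}(\alpha,\beta).$$ Its $1$-cochains are the vector fields on $M$; a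 vector field $Z$ is a cocycle if $(\pi^\sharp\alpha)\cdot\langle\beta,Z\rangle-(\pi^\sharp\beta)\cdot\langle\alpha,Z\rangle-\langle[\alpha,\beta]_{\pi,\psi},Z\rangle=0$ for all $1$-forms $\alpha,\beta$, and a coboundary if there is a smooth function $f$ with $\langle\alpha,Z\rangle=(\pi^\sharp\alpha)\cdot f$ for all $\alpha$. Let $H^1_{\pi,\psi}$ be the space of cocycles modulo coboundaries. For a volume form, or in general a smooth positive density, $\lambda$ on $M$, let $X_{\pi,\lambda}$ be the vector field with $\langle\alpha,X_{\pi,\lambda}\rangle\lambda=\mathcal L_{\pi^\sharp\alpha}\lambda-(i_\pi d\alpha)\lambda$ for all $1$-forms $\alpha$, where $i_{u\wedge v}=i_u\circ i_v$, and let $Y_{\pi,\psi}$ be the vector field such that $\langle\alpha,Y_{\pi,\psi}\rangle$ is one half of the trace of the endomorphism $\beta\mapsto\psi^{(2)}(\alpha,\beta)$ of $T^*M$. The modular class of $(M,\pi,\psi)$ is the class in $H^1_{\pi,\psi}$ of $X_{\pi,\lambda}+Y_{\pi,\psi}$, for any $\lambda$. The Evens–Lu–Weinstein modular class of the cotangent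 Lie algebroid $E=T^*M$ is the class in $H^1_{\pi,\psi}$ of the vector field $U$ with $D_\alpha s=\langle\alpha,U\rangle s$ for all $1$-forms $\alpha$, where $s$ is any nowhere vanishing section of the line bundle $\wedge^nE\otimes\wedge^nT^*M=\wedge^nT^*M\otimes\wedge^nT^*M$ (such sections always exist) and $D$ is the representation $D_\alpha(\omega\otimes\mu)=[\alpha,\omega]_{\pi,\psi}\otimes\mu+\omega\otimes\mathcal L_{\pi^\sharp\alpha}\mu$ of $E$ on it, with $[\alpha,\beta_1\wedge\dots\wedge\beta_n]_{\pi,\psi}=\sum_i\beta_1\wedge\dots\wedge[\alpha,\beta_i]_{\pi,\psi}\wedge\dots\wedge\beta_n$. Then both classes are well defined (the vector fields $X_{\pi,\lambda}+Y_{\pi,\psi}$ and $U$ are cocycles, and their classes do not depend on $\lambda$ and $s$), and the modular class of $(M,\pi,\psi)$ is equal to one half of the Evens–Lu–Weinstein modular class of its cotangent Lie algebroid. -/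

import Mathlib

open Filter
open scoped Manifold ContDiff TensorProduct Topology

noncomputable section

namespace TwistedPoissonGeometry

/-! ### Tangent spaces, covectors, smooth vector fields, 1-forms and differential forms

`M` is a smooth manifold of dimension `n` without boundary, with model `𝓡 n`. -/

/-- The tangent space at `x`. -/
abbrev Tan (n : ℕ) {M : Type*} [TopologicalSpace M] [ChartedSpace (EuclideanSpace ℝ (Fin n)) M]
    (x : M) : Type :=
  TangentSpace (𝓡 n) x

/-- The cotangent space at `x`. -/
abbrev Cotan (n : ℕ) {M : Type*} [TopologicalSpace M] [ChartedSpace (EuclideanSpace ℝ (Fin n)) M]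
    (x : M) : Type :=
  Tan n x →L[ℝ] ℝ

/-- The fibre at `x` of the `k`-th exterior power of the cotangent bundle. -/
abbrev FormAt (n k : ℕ) {M : Type*} [TopologicalSpace M]
    [ChartedSpace (EuclideanSpace ℝ (Fin n)) M] (x : M) : Type :=
  Tan n x [⋀^Fin k]→L[ℝ] ℝ

section Basic

variable {n : ℕ} {M : Type*} [TopologicalSpace M] [ChartedSpace (EuclideanSpace ℝ (Fin n)) M]

instance instFiniteDimensionalTan (x : M) : FiniteDimensional ℝ (TangentSpace (𝓡 n) x) :=
  inferInstanceAs (FiniteDimensional ℝ (EuclideanSpace ℝ (Fin n)))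

instance instT2SpaceTan (x : M) : T2Space (TangentSpace (𝓡 n) x) :=
  inferInstanceAs (T2Space (EuclideanSpace ℝ (Fin n)))

/-- The smooth vector fields on `M`. -/
abbrev VectorFields (n : ℕ) (M : Type*) [TopologicalSpace M]
    [ChartedSpace (EuclideanSpace ℝ (Fin n)) M] [IsManifold (𝓡 n) ∞ M] : Type _ :=
  Cₛ^∞⟮𝓡 n; EuclideanSpace ℝ (Fin n), (TangentSpace (𝓡 n) : M → Type)⟯

/-- The smooth 1-forms on `M`: smooth sections of the cotangent bundle. -/
abbrev OneForms (n : ℕ) (M : Type*) [TopologicalSpace M]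
    [ChartedSpace (EuclideanSpace ℝ (Fin n)) M] [IsManifold (𝓡 n) ∞ M] : Type _ :=
  Cₛ^∞⟮𝓡 n; EuclideanSpace ℝ (Fin n) →L[ℝ] ℝ,
    fun x : M => TangentSpace (𝓡 n) x →L[ℝ] Bundle.Trivial M ℝ x⟯

/-- The 1-form `β` is smooth on a neighbourhood of `x`. -/
def SmoothOneFormNear [IsManifold (𝓡 n) ∞ M] (β : ∀ y : M, Cotan n y) (x : M) : Prop :=
  ∀ᶠ y in 𝓝 x, ContMDiffAt (𝓡 n) ((𝓡 n).prod 𝓘(ℝ, EuclideanSpace ℝ (Fin n) →L[ℝ] ℝ)) ∞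
    (fun z => Bundle.TotalSpace.mk' (EuclideanSpace ℝ (Fin n) →L[ℝ] ℝ)
      (E := fun z : M => TangentSpace (𝓡 n) z →L[ℝ] Bundle.Trivial M ℝ z) z (β z)) y

/-- The vector of which a linear functional on the cotangent space is the evaluation. -/
def vectorOf {x : M} (F : Cotan n x →ₗ[ℝ] ℝ) : Tan n x :=
  (Module.evalEquiv ℝ (Tan n x)).symm
    (F ∘ₗ (LinearMap.toContinuousLinearMap : (Tan n x →ₗ[ℝ] ℝ) ≃ₗ[ℝ] Cotan n x).toLinearMap)

theorem apply_vectorOf {x : M} (F : Cotan n x →ₗ[ℝ] ℝ) (α : Cotan n x) :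
    α (vectorOf F) = F α := by
  have h := Module.apply_evalEquiv_symm_apply (R := ℝ) (M := Tan n x) (α : Tan n x →ₗ[ℝ] ℝ)
    (F ∘ₗ (LinearMap.toContinuousLinearMap : (Tan n x →ₗ[ℝ] ℝ) ≃ₗ[ℝ] Cotan n x).toLinearMap)
  exact h

/-- The `k`-th coordinate vector field of the preferred chart at `x₀`. -/
def coordVec (x₀ : M) (k : Fin n) : ∀ y : M, Tan n y :=
  VectorField.mpullback (𝓡 n) 𝓘(ℝ, EuclideanSpace ℝ (Fin n)) (extChartAt (𝓡 n) x₀)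
    (fun _ => EuclideanSpace.single k (1 : ℝ))

/-- The differential of the `k`-th coordinate function of the preferred chart at `x₀`. -/
def coordCovec (x₀ : M) (k : Fin n) (y : M) : Cotan n y :=
  (EuclideanSpace.proj k : EuclideanSpace ℝ (Fin n) →L[ℝ] ℝ).comp
    (mfderiv (𝓡 n) 𝓘(ℝ, EuclideanSpace ℝ (Fin n)) (extChartAt (𝓡 n) x₀) y)

/-- A form of degree one at `x` is a covector at `x`. -/
def toCovector {x : M} (θ : FormAt n 1 x) : Cotan n x :=
  (ContinuousAlternatingMap.ofSubsingleton ℝ (Tan n x) ℝ (0 : Fin 1)).symm θ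

/-- A covector at `x` is a form of degree one at `x`. -/
def ofCovector {x : M} (α : Cotan n x) : FormAt n 1 x :=
  ContinuousAlternatingMap.ofSubsingleton ℝ (Tan n x) ℝ (0 : Fin 1) α

/-- The interior product `i_v θ = θ(v, ·, …, ·)`. -/
def interior {k : ℕ} {x : M} (v : Tan n x) (θ : FormAt n (k + 1) x) : FormAt n k x :=
  ContinuousAlternatingMap.curryLeft (𝕜 := ℝ) (E := EuclideanSpace ℝ (Fin n)) (F := ℝ) θ v

theorem interior_apply {k : ℕ} {x : M} (v : Tan n x) (θ : FormAt n (k + 1) x)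
    (w : Fin k → Tan n x) : interior v θ w = θ (Matrix.vecCons v w) := rfl

/-- The exterior product `β₁ ∧ … ∧ βₖ` of covectors. -/
def wedge {k : ℕ} {x : M} (β : Fin k → Cotan n x) : FormAt n k x :=
  ContinuousMultilinearMap.alternatization
    ((ContinuousMultilinearMap.mkPiAlgebra ℝ (Fin k) ℝ).compContinuousLinearMap β)

theorem wedge_apply {k : ℕ} {x : M} (β : Fin k → Cotan n x) (v : Fin k → Tan n x) :
    wedge β v = (Matrix.of fun i j => β i (v j)).det := by
  rw [← Matrix.det_transpose, Matrix.det_apply]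
  simp [wedge, ContinuousMultilinearMap.alternatization_apply_apply]

/-- The expression of a differential form in the preferred chart at `x₀`. -/
def chartRep {k : ℕ} (θ : ∀ x : M, FormAt n k x) (x₀ : M) (y : EuclideanSpace ℝ (Fin n)) :
    EuclideanSpace ℝ (Fin n) [⋀^Fin k]→L[ℝ] ℝ :=
  (θ ((extChartAt (𝓡 n) x₀).symm y)).compContinuousLinearMap
    (mfderiv 𝓘(ℝ, EuclideanSpace ℝ (Fin n)) (𝓡 n) (extChartAt (𝓡 n) x₀).symm y)

/-- The differential form `θ` is smooth on a neighbourhood of `x`. -/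
def SmoothFormNear {k : ℕ} (θ : ∀ x : M, FormAt n k x) (x : M) : Prop :=
  ∀ᶠ y in 𝓝 (extChartAt (𝓡 n) x x), ContDiffAt ℝ ∞ (chartRep θ x) y

/-- The exterior derivative of a differential form, computed in the preferred chart at `x`. -/
def extD {k : ℕ} (θ : ∀ x : M, FormAt n k x) (x : M) : FormAt n (k + 1) x :=
  (extDeriv (chartRep θ x) (extChartAt (𝓡 n) x x)).compContinuousLinearMap
    (mfderiv (𝓡 n) 𝓘(ℝ, EuclideanSpace ℝ (Fin n)) (extChartAt (𝓡 n) x) x)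

/-- The differential of a function. -/
def dFun (f : M → ℝ) (x : M) : Cotan n x :=
  mfderiv (𝓡 n) 𝓘(ℝ, ℝ) f x

/-- The Lie derivative of forms, `𝓛_V = i_V d + d i_V`. -/
def lieDeriv (V : ∀ x : M, Tan n x) : ∀ {k : ℕ}, (∀ x : M, FormAt n k x) → ∀ x : M, FormAt n k x
  | 0, θ, x => interior (V x) (extD θ x)
  | _ + 1, θ, x => interior (V x) (extD θ x) + extD (fun y => interior (V y) (θ y)) x

/-- The Lie derivative of 1-forms. -/
def lieDerivOne (V : ∀ x : M, Tan n x) (β : ∀ x : M, Cotan n x) (x : M) : Cotan n x :=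
  toCovector (lieDeriv V (fun y => ofCovector (β y)) x)

/-! ### Bivector fields -/

/-- The vector `π♯ α`, characterized by `⟨β, π♯ α⟩ = π(α, β)`. -/
def sharp {x : M} (π : Cotan n x →ₗ[ℝ] Cotan n x →ₗ[ℝ] ℝ) (α : Cotan n x) : Tan n x :=
  vectorOf (π α)

/-- The pairing `⟨α ∧ β ∧ γ, u ∧ v ∧ w⟩`. -/
def pair3 {x : M} (u v w : Tan n x) (α β γ : Cotan n x) : ℝ :=
  Matrix.det !![α u, α v, α w; β u, β v, β w; γ u, γ v, γ w]

/-- For `P = ∑ i, X i ∧ Y i`, the Gerstenhaber (Schouten) bracket `[P, P]` at `x`, evaluated on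
`α ∧ β ∧ γ`. It is computed by bilinearity from
`[a₁ ∧ a₂, b₁ ∧ b₂] = ∑ k l, (-1) ^ (k + l) [a_k, b_l] ∧ a_{k'} ∧ b_{l'}`, where `{k, k'}` and
`{l, l'}` are both `{1, 2}`. -/
def schoutenSqOf {ι : Type*} [Fintype ι] (X Y : ι → ∀ y : M, Tan n y) (x : M)
    (α β γ : Cotan n x) : ℝ :=
  ∑ i, ∑ j,
    (pair3 (VectorField.mlieBracket (𝓡 n) (X i) (X j) x) (Y i x) (Y j x) α β γ
      - pair3 (VectorField.mlieBracket (𝓡 n) (X i) (Y j) x) (Y i x) (X j x) α β γ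
      - pair3 (VectorField.mlieBracket (𝓡 n) (Y i) (X j) x) (X i x) (Y j x) α β γ
      + pair3 (VectorField.mlieBracket (𝓡 n) (Y i) (Y j) x) (X i x) (X j x) α β γ)

/-- The Schouten bracket `[π, π]` of a bivector field with itself at `x`, evaluated on
`α ∧ β ∧ γ`. Near `x`, `π = ½ ∑ k, e_k ∧ π♯(ε^k)` where `e_k` and `ε^k` are the dual local
frames of a chart. -/
def schoutenSq (π : ∀ y : M, Cotan n y →ₗ[ℝ] Cotan n y →ₗ[ℝ] ℝ) (x : M)
    (α β γ : Cotan n x) : ℝ :=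
  schoutenSqOf (fun (k : Fin n) y => (1 / 2 : ℝ) • coordVec x k y)
    (fun (k : Fin n) y => sharp (π y) (coordCovec x k y)) x α β γ

/-- The trivector `(∧³ π♯) ψ` at `x`, evaluated on `α ∧ β ∧ γ`: with
`ψ = (1/6) ∑ ψ(e_k, e_l, e_m) ε^k ∧ ε^l ∧ ε^m`, it is
`(1/6) ∑ ψ(e_k, e_l, e_m) π♯ε^k ∧ π♯ε^l ∧ π♯ε^m`. -/
def sharp3 {x : M} (π : Cotan n x →ₗ[ℝ] Cotan n x →ₗ[ℝ] ℝ) (ψ : FormAt n 3 x)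
    (α β γ : Cotan n x) : ℝ :=
  (1 / 6 : ℝ) * ∑ k : Fin n, ∑ l : Fin n, ∑ m : Fin n,
    ψ ![coordVec x k x, coordVec x l x, coordVec x m x] *
      pair3 (sharp π (coordCovec x k x)) (sharp π (coordCovec x l x))
        (sharp π (coordCovec x m x)) α β γ

/-- The interior product `i_π τ` of a 2-form by a bivector `π = ½ ∑ π^{kl} e_k ∧ e_l`, with the
convention `i_{u ∧ v} = i_u ∘ i_v`, so that `i_{u ∧ v} τ = τ(v, u)`. -/
def interiorBivector {x : M} (π : Cotan n x →ₗ[ℝ] Cotan n x →ₗ[ℝ] ℝ) (τ : FormAt n 2 x) : ℝ :=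
  (1 / 2 : ℝ) * ∑ k : Fin n, ∑ l : Fin n,
    π (coordCovec x k x) (coordCovec x l x) * τ ![coordVec x l x, coordVec x k x]

theorem sharp_add {x : M} (π : Cotan n x →ₗ[ℝ] Cotan n x →ₗ[ℝ] ℝ) (α β : Cotan n x) :
    sharp π (α + β) = sharp π α + sharp π β := by
  simp [sharp, vectorOf, LinearMap.add_comp]

theorem sharp_smul {x : M} (π : Cotan n x →ₗ[ℝ] Cotan n x →ₗ[ℝ] ℝ) (c : ℝ) (α : Cotan n x) :
    sharp π (c • α) = c • sharp π α := by
  simp [sharp, vectorOf, LinearMap.smul_comp]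

theorem interior_add_left {k : ℕ} {x : M} (v w : Tan n x) (θ : FormAt n (k + 1) x) :
    interior (v + w) θ = interior v θ + interior w θ :=
  (ContinuousAlternatingMap.curryLeft (𝕜 := ℝ) (E := EuclideanSpace ℝ (Fin n)) (F := ℝ) θ).map_add
    v w

theorem interior_smul_left {k : ℕ} {x : M} (c : ℝ) (v : Tan n x) (θ : FormAt n (k + 1) x) :
    interior (c • v) θ = c • interior v θ :=
  (ContinuousAlternatingMap.curryLeft (𝕜 := ℝ) (E := EuclideanSpace ℝ (Fin n)) (F := ℝ) θ).map_smul
    c v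

/-- The covector `ψ^{(2)}(ξ, η) = ψ(π♯ ξ, π♯ η, ·)`, bilinear in `ξ` and `η`. -/
def psi2 {x : M} (π : Cotan n x →ₗ[ℝ] Cotan n x →ₗ[ℝ] ℝ) (ψ : FormAt n 3 x) :
    Cotan n x →ₗ[ℝ] Cotan n x →ₗ[ℝ] Cotan n x :=
  LinearMap.mk₂ ℝ (fun ξ η => toCovector (interior (sharp π η) (interior (sharp π ξ) ψ)))
    (fun ξ ξ' η => by rw [sharp_add, interior_add_left]; rfl)
    (fun c ξ η => by rw [sharp_smul, interior_smul_left]; rfl)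
    (fun ξ η η' => by rw [sharp_add, interior_add_left]; rfl)
    (fun c ξ η => by rw [sharp_smul, interior_smul_left]; rfl)

theorem psi2_apply {x : M} (π : Cotan n x →ₗ[ℝ] Cotan n x →ₗ[ℝ] ℝ) (ψ : FormAt n 3 x)
    (ξ η : Cotan n x) (v : Tan n x) :
    psi2 π ψ ξ η v = ψ ![sharp π ξ, sharp π η, v] := by
  have h : psi2 π ψ ξ η v = ψ (Matrix.vecCons (sharp π ξ) (Matrix.vecCons (sharp π η)
      (fun _ : Fin 1 => v))) := rfl
  rw [h]
  congr 1
  ext i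
  fin_cases i <;> rfl

/-! ### Volume forms and densities -/

/-- A volume form: a smooth nowhere vanishing form of top degree. -/
structure VolumeForm (n : ℕ) (M : Type*) [TopologicalSpace M]
    [ChartedSpace (EuclideanSpace ℝ (Fin n)) M] where
  toFun : ∀ x : M, FormAt n n x
  smooth : ∀ x, SmoothFormNear toFun x
  ne_zero : ∀ x, toFun x ≠ 0

/-- A smooth positive density: it is locally the absolute value of a smooth nowhere vanishing
form of top degree. -/
structure VolumeDensity (n : ℕ) (M : Type*) [TopologicalSpace M]
    [ChartedSpace (EuclideanSpace ℝ (Fin n)) M] where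
  toFun : ∀ x : M, (Fin n → Tan n x) → ℝ
  local_form : ∀ x : M, ∃ θ : ∀ y : M, FormAt n n y, SmoothFormNear θ x ∧ θ x ≠ 0 ∧
    ∀ᶠ y in 𝓝 x, ∀ v : Fin n → Tan n y, toFun y v = |θ y v|

end Basic

/-! ### Twisted Poisson manifolds -/

/-- A twisted Poisson structure `(π, ψ)` on the manifold `M`: a smooth bivector field `π` and a
smooth closed 3-form `ψ` with `½ [π, π] = (∧³ π♯) ψ`. The bivector `π x` is given as an
alternating bilinear form on the cotangent space. -/
structure TwistedPoisson (n : ℕ) (M : Type*) [TopologicalSpace M]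
    [ChartedSpace (EuclideanSpace ℝ (Fin n)) M] where
  π : ∀ x : M, Cotan n x →ₗ[ℝ] Cotan n x →ₗ[ℝ] ℝ
  ψ : ∀ x : M, FormAt n 3 x
  π_alt : ∀ x (α : Cotan n x), π x α α = 0
  /-- The components of `π` in every preferred chart are smooth. -/
  π_smooth : ∀ (x : M) (i j : Fin n), ∀ᶠ y in 𝓝 x, ContMDiffAt (𝓡 n) 𝓘(ℝ, ℝ) ∞
    (fun z => π z (coordCovec x i z) (coordCovec x j z)) y
  ψ_smooth : ∀ x, SmoothFormNear ψ x
  ψ_closed : ∀ x, extD ψ x = 0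
  schouten : ∀ x (α β γ : Cotan n x),
    (1 / 2 : ℝ) * schoutenSq π x α β γ = sharp3 (π x) (ψ x) α β γ

namespace TwistedPoisson

variable {n : ℕ} {M : Type*} [TopologicalSpace M] [ChartedSpace (EuclideanSpace ℝ (Fin n)) M]
  (P : TwistedPoisson n M)

/-- The vector field `π♯ α`. -/
def ham (α : ∀ x : M, Cotan n x) (x : M) : Tan n x :=
  sharp (P.π x) (α x)

/-! ### The cotangent Lie algebroid and its cohomology in degree one -/

/-- The bracket of the cotangent Lie algebroid, whose anchor is `π♯`:
`[α, β]_{π,ψ} = 𝓛_{π♯α} β - 𝓛_{π♯β} α - d(π(α, β)) + ψ^{(2)}(α, β)`. -/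
def bracket (α β : ∀ x : M, Cotan n x) (x : M) : Cotan n x :=
  lieDerivOne (P.ham α) β x - lieDerivOne (P.ham β) α x - dFun (fun y => P.π y (α y) (β y)) x
    + psi2 (P.π x) (P.ψ x) (α x) (β x)

/-- The Lie algebroid differential `(d_{π,ψ} Z)(α, β) =
(π♯α)·⟨β, Z⟩ - (π♯β)·⟨α, Z⟩ - ⟨[α, β]_{π,ψ}, Z⟩` of a vector field `Z`, i.e. of a 1-cochain of
the cotangent Lie algebroid. -/
def dOne (Z : ∀ x : M, Tan n x) (α β : ∀ x : M, Cotan n x) (x : M) : ℝ :=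
  dFun (fun y => β y (Z y)) x (P.ham α x) - dFun (fun y => α y (Z y)) x (P.ham β x)
    - P.bracket α β x (Z x)

section Cohomology

variable [IsManifold (𝓡 n) ∞ M]

theorem pairing_mdifferentiableAt (α : OneForms n M) (Z : VectorFields n M) (x : M) :
    MDifferentiableAt (𝓡 n) 𝓘(ℝ, ℝ) (fun y => (α y : Cotan n y) (Z y)) x := by
  have hα := α.contMDiff.contMDiffAt (x := x)
  have hZ := Z.contMDiff.contMDiffAt (x := x)
  have h := ContMDiffAt.clm_bundle_apply (F₁ := EuclideanSpace ℝ (Fin n)) (F₂ := ℝ)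
    (E₁ := (TangentSpace (𝓡 n) : M → Type)) (E₂ := Bundle.Trivial M ℝ) (b := fun y : M => y)
    hα hZ
  rw [Bundle.contMDiffAt_section] at h
  exact ContMDiffAt.mdifferentiableAt h (by simp)

/-- The 1-cocycles of the cotangent Lie algebroid: the `d_{π,ψ}`-closed vector fields. -/
def cocycles : Submodule ℝ (VectorFields n M) where
  carrier := {Z | ∀ (α β : OneForms n M) (x : M), P.dOne Z α β x = 0}
  zero_mem' := by
    intro α β x
    have h : ∀ γ : OneForms n M, dFun (n := n) (fun y => (γ y : Cotan n y) ((0 : VectorFields n M) y)) x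
        = 0 := by
      intro γ
      have : (fun y => (γ y : Cotan n y) ((0 : VectorFields n M) y)) = fun _ => (0 : ℝ) := by
        funext y
        exact map_zero (γ y : Cotan n y)
      rw [this]
      exact mfderiv_const
    simp only [dOne]
    rw [h, h, ContMDiffSection.coe_zero, Pi.zero_apply, map_zero, zero_apply, zero_apply, sub_zero,
      sub_zero]
  add_mem' := by
    intro Z W hZ hW α β x
    have h : ∀ γ : OneForms n M, dFun (n := n) (fun y => (γ y : Cotan n y) ((Z + W) y)) x
        = dFun (n := n) (fun y => (γ y : Cotan n y) (Z y)) x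
          + dFun (n := n) (fun y => (γ y : Cotan n y) (W y)) x := by
      intro γ
      have : (fun y => (γ y : Cotan n y) ((Z + W) y)) =
          (fun y => (γ y : Cotan n y) (Z y)) + fun y => (γ y : Cotan n y) (W y) := by
        funext y
        exact map_add (γ y : Cotan n y) _ _
      rw [this]
      exact mfderiv_add (pairing_mdifferentiableAt γ Z x) (pairing_mdifferentiableAt γ W x)
    have h1 := hZ α β x
    have h2 := hW α β x
    simp only [dOne] at h1 h2 ⊢
    rw [h, h, ContMDiffSection.coe_add, Pi.add_apply, map_add, add_apply,
      add_apply]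
    linarith
  smul_mem' := by
    intro c Z hZ α β x
    have h : ∀ γ : OneForms n M, dFun (n := n) (fun y => (γ y : Cotan n y) ((c • Z) y)) x
        = c • dFun (n := n) (fun y => (γ y : Cotan n y) (Z y)) x := by
      intro γ
      have : (fun y => (γ y : Cotan n y) ((c • Z) y)) =
          c • (fun y => (γ y : Cotan n y) (Z y)) := by
        funext y
        exact map_smul (γ y : Cotan n y) _ _
      rw [this]
      exact const_smul_mfderiv (pairing_mdifferentiableAt γ Z x) c
    have h1 := hZ α β x
    simp only [dOne] at h1 ⊢
    rw [h, h, ContMDiffSection.coe_smul, Pi.smul_apply, map_smul, smul_apply,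
      smul_apply, ← smul_sub, ← smul_sub, h1, smul_zero]

/-- The 1-coboundaries of the cotangent Lie algebroid: the vector fields `d_{π,ψ} f`, where
`⟨α, d_{π,ψ} f⟩ = (π♯α)·f` and `f` is a smooth function. -/
def coboundaries : Submodule ℝ (VectorFields n M) where
  carrier := {Z | ∃ f : C^∞⟮𝓡 n, M; 𝓘(ℝ, ℝ), ℝ⟯, ∀ (x : M) (α : Cotan n x),
    α (Z x) = dFun f x (sharp (P.π x) α)}
  zero_mem' := by
    refine ⟨0, fun x α => ?_⟩
    have : dFun (n := n) (0 : C^∞⟮𝓡 n, M; 𝓘(ℝ, ℝ), ℝ⟯) x = 0 :=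
      mfderiv_const (c := (0 : ℝ))
    rw [this]
    exact map_zero α
  add_mem' := by
    rintro Z W ⟨f, hf⟩ ⟨g, hg⟩
    refine ⟨f + g, fun x α => ?_⟩
    have : dFun (n := n) (f + g : C^∞⟮𝓡 n, M; 𝓘(ℝ, ℝ), ℝ⟯) x = dFun f x + dFun g x :=
      mfderiv_add (f.contMDiff.mdifferentiableAt (by simp))
        (g.contMDiff.mdifferentiableAt (by simp))
    rw [this, ContMDiffSection.coe_add, Pi.add_apply, map_add, add_apply,
      hf, hg]
  smul_mem' := by
    rintro c Z ⟨f, hf⟩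
    refine ⟨c • f, fun x α => ?_⟩
    have : dFun (n := n) (c • f : C^∞⟮𝓡 n, M; 𝓘(ℝ, ℝ), ℝ⟯) x = c • dFun f x :=
      const_smul_mfderiv (f.contMDiff.mdifferentiableAt (by simp)) c
    rw [this, ContMDiffSection.coe_smul, Pi.smul_apply, map_smul, smul_apply,
      hf]

/-- The first cohomology space of the cotangent Lie algebroid. -/
abbrev H1 : Type _ :=
  P.cocycles ⧸ P.coboundaries.submoduleOf P.cocycles

/-- The cohomology class of a 1-cocycle. -/
def cls (Z : P.cocycles) : P.H1 :=
  Submodule.Quotient.mk Z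

end Cohomology

/-! ### The modular class -/

/-- The vector field `Y_{π,ψ}`: `⟨α, Y_{π,ψ}⟩` is half the trace of the endomorphism
`β ↦ ψ^{(2)}(α, β)` of the cotangent space. -/
def Y (x : M) : Tan n x :=
  vectorOf ((1 / 2 : ℝ) • (LinearMap.trace ℝ (Cotan n x) ∘ₗ psi2 (P.π x) (P.ψ x)))

section Modular

variable [IsManifold (𝓡 n) ∞ M]

/-- The equation `⟨α, X⟩ λ = 𝓛_{π♯α} λ - (i_π dα) λ` at `x`, for all 1-forms `α`, where `λ` is a
form of top degree that is smooth near `x`. -/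
def IsXAt (lam : ∀ x : M, FormAt n n x) (X : VectorFields n M) (x : M) : Prop :=
  ∀ α : OneForms n M, ((α x : Cotan n x) (X x)) • lam x =
    lieDeriv (P.ham α) lam x
      - interiorBivector (P.π x) (extD (fun y => ofCovector (α y : Cotan n y)) x) • lam x

/-- `X = X_{π,λ}` for the volume form `λ`. -/
def IsXOfForm (lam : VolumeForm n M) (X : VectorFields n M) : Prop :=
  ∀ x, P.IsXAt lam.toFun X x

/-- `X = X_{π,λ}` for the density `λ`: the defining equation, which does not change when `λ` is
replaced by `-λ`, holds for the forms of top degree whose absolute value is `λ` locally. -/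
def IsXOfDensity (lam : VolumeDensity n M) (X : VectorFields n M) : Prop :=
  ∀ (x : M) (θ : ∀ y : M, FormAt n n y), SmoothFormNear θ x →
    (∀ᶠ y in 𝓝 x, ∀ v : Fin n → Tan n y, lam.toFun y v = |θ y v|) → P.IsXAt θ X x

/-- `c` is the modular class of the twisted Poisson manifold `(M, π, ψ)`: for every density and
for every volume form `λ`, the vector field `X_{π,λ} + Y_{π,ψ}` is a cocycle of class `c`. -/
def IsModularClass (c : P.H1) : Prop :=
  Nonempty (VolumeDensity n M) ∧
  (∀ lam : VolumeDensity n M, ∃ (X : VectorFields n M) (Z : P.cocycles),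
    P.IsXOfDensity lam X ∧ (∀ x, (Z : VectorFields n M) x = X x + P.Y x) ∧ P.cls Z = c) ∧
  (∀ lam : VolumeForm n M, ∃ (X : VectorFields n M) (Z : P.cocycles),
    P.IsXOfForm lam X ∧ (∀ x, (Z : VectorFields n M) x = X x + P.Y x) ∧ P.cls Z = c)

end Modular

/-! ### The Evens–Lu–Weinstein modular class of the cotangent Lie algebroid

For the Lie algebroid `E = T*M` the line bundle `∧ⁿ E ⊗ ∧ⁿ T*M` is `∧ⁿ T*M ⊗ ∧ⁿ T*M`. -/

end TwistedPoisson

/-- A smooth nowhere vanishing section of the line bundle `∧ⁿ T*M ⊗ ∧ⁿ T*M`: locally it is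
`θ ⊗ μ` for smooth forms `θ` and `μ` of top degree. -/
structure VolumeSection (n : ℕ) (M : Type*) [TopologicalSpace M]
    [ChartedSpace (EuclideanSpace ℝ (Fin n)) M] where
  toFun : ∀ x : M, FormAt n n x ⊗[ℝ] FormAt n n x
  smooth : ∀ x : M, ∃ θ μ : ∀ y : M, FormAt n n y, SmoothFormNear θ x ∧ SmoothFormNear μ x ∧
    ∀ᶠ y in 𝓝 x, toFun y = θ y ⊗ₜ[ℝ] μ y
  ne_zero : ∀ x, toFun x ≠ 0

namespace TwistedPoisson

variable {n : ℕ} {M : Type*} [TopologicalSpace M] [ChartedSpace (EuclideanSpace ℝ (Fin n)) M]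
  (P : TwistedPoisson n M)

/-- The bracket `[α, β₁ ∧ … ∧ βₖ]_{π,ψ} = ∑ i, β₁ ∧ … ∧ [α, βᵢ]_{π,ψ} ∧ … ∧ βₖ`. -/
def bracketWedge {k : ℕ} (α : ∀ x : M, Cotan n x) (β : Fin k → ∀ x : M, Cotan n x) (x : M) :
    FormAt n k x :=
  ∑ i, wedge (Function.update (fun j => β j x) i (P.bracket α (β i) x))

/-- The representation `D` of `E = T*M` on `∧ⁿ E ⊗ ∧ⁿ T*M`:
`D_α (θ ⊗ μ) = [α, θ]_{π,ψ} ⊗ μ + θ ⊗ 𝓛_{π♯α} μ`, for `θ = β₁ ∧ … ∧ βₙ`. -/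
def repD (α : ∀ x : M, Cotan n x) (β : Fin n → ∀ x : M, Cotan n x) (μ : ∀ x : M, FormAt n n x)
    (x : M) : FormAt n n x ⊗[ℝ] FormAt n n x :=
  P.bracketWedge α β x ⊗ₜ[ℝ] μ x + wedge (fun j => β j x) ⊗ₜ[ℝ] lieDeriv (P.ham α) μ x

variable [IsManifold (𝓡 n) ∞ M]

/-- `U` is the section `θ_s` of `E* = TM` with `D_α s = ⟨α, U⟩ s` for all 1-forms `α`. The
operator `D_α` is local, and near every point `s` can be written `(β₁ ∧ … ∧ βₙ) ⊗ μ`. -/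
def IsCharacteristicSection (s : VolumeSection n M) (U : VectorFields n M) : Prop :=
  ∀ (α : OneForms n M) (x : M) (β : Fin n → ∀ y : M, Cotan n y) (μ : ∀ y : M, FormAt n n y),
    (∀ i, SmoothOneFormNear (β i) x) → SmoothFormNear μ x →
    (∀ᶠ y in 𝓝 x, s.toFun y = wedge (fun j => β j y) ⊗ₜ[ℝ] μ y) →
    P.repD α β μ x = ((α x : Cotan n x) (U x)) • s.toFun x

/-- `e` is the Evens–Lu–Weinstein modular class of the cotangent Lie algebroid
`(T*M, π♯, [·,·]_{π,ψ})`: for every smooth nowhere vanishing section `s` of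
`∧ⁿ T*M ⊗ ∧ⁿ T*M`, the section `θ_s` is a cocycle of class `e`. This line bundle always has such
sections. -/
def IsELWModularClass (e : P.H1) : Prop :=
  Nonempty (VolumeSection n M) ∧
  ∀ s : VolumeSection n M, ∃ U : P.cocycles,
    P.IsCharacteristicSection s (U : VectorFields n M) ∧ P.cls U = e

end TwistedPoisson

end TwistedPoissonGeometry

end

noncomputable section

namespace TwistedPoissonGeometry

/-! ### Calculus on the model space -/

/-! The comparison of the two classes already holds for vector fields: if a section `s` of `∧ⁿT*M ⊗
∧ⁿT*M` and a density `λ` satisfy `λ² = |s|`, then `U_s = 2 (X_λ + Y)`. Cohomology enters only to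
make the classes independent of the choices.

In a chart write `π^{ij}`, `ψ_{abc}` for the components, `L = log λ`, `V = π♯α`. The Leibniz rule
for the divergence of `V` turns the equation defining `X` into `X^k = ∂_c π^{kc} + π^{kb} ∂_b L`
(`sum_mul_modX`), and `Y^k = ½ π^{kb} π^{dc} ψ_{bcd}` (`vecRep_Y`). For `s = θ ⊗ μ`, bracketing with
`α` sends the component `t` of `θ` to `V·t + (tr C) t`, where `tr C = div V - 2 i_π dα + 2⟨α, Y⟩`
(`topRep_bracketWedge_eq`), while `𝓛_V` sends the component `m` of `μ` to `V·m + (div V) m`. Adding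
the two logarithmic rates gives `V·log|tm| + 2 div V - 2 i_π dα + 2⟨α, Y⟩`, which is twice `⟨α, X_λ
+ Y⟩` for `λ = √|θμ|` (`repD_eq_smul`).

That `X + Y` is a cocycle is an identity between components (`dOneComp_modular`). The differential
is tensorial in the 1-forms (`dOne_eq_sum`), so only coordinate 1-forms matter. Differentiating the
twisted Jacobi identity and contracting treats the divergence part of `X`; the remaining part of `X
+ Y` comes from a 1-form through the anchor, and its differential is computed from that of the
1-form. The terms left over cancel by `dψ = 0` and by one more contraction of the Jacobi identity
with `ψ`.

Changing `λ` changes `X` by the coboundary of the logarithm of the ratio of the densities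
(`cls_modularCocycle_eq`). Densities come from a partition of unity and sections from squares of
densities, so both classes exist. Uniqueness follows because the equations defining `X` and `U`
determine these fields pointwise.

Several objects (`extD`, `schoutenSq`, `interiorBivector`, `xField`) are computed at each point in
the chart preferred at that point. To differentiate them, their formulas are first proved on a whole
chart: by naturality of the exterior derivative, by invariance of traces, by the Jacobi identity for
closed 1-forms (`schouten_chart`), or by uniqueness of the solution of the defining equation
(`vecRep_xField`). -/

/-- The model space. -/
abbrev Euc (n : ℕ) : Type := EuclideanSpace ℝ (Fin n)

/-- The standard basis vectors of the model space. -/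
abbrev stdVec {n : ℕ} (k : Fin n) : Euc n := EuclideanSpace.single k (1 : ℝ)

/-- The `k`-th partial derivative. -/
def pd {n : ℕ} (k : Fin n) (f : Euc n → ℝ) (u : Euc n) : ℝ := fderiv ℝ f u (stdVec k)

theorem sum_smul_stdVec {n : ℕ} (v : Euc n) : ∑ k, v k • stdVec k = v := by
  ext i
  simp [stdVec, Finset.sum_apply, Pi.single_apply]

theorem fderiv_eq_sum_pd {n : ℕ} (f : Euc n → ℝ) (u v : Euc n) :
    fderiv ℝ f u v = ∑ k, v k * pd k f u := by
  conv_lhs => rw [← sum_smul_stdVec v]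
  simp [map_sum, pd]

theorem form_apply_eq_sum {n k : ℕ} (θ : Euc n [⋀^Fin k]→L[ℝ] ℝ) (v : Fin k → Euc n) :
    θ v = ∑ r : Fin k → Fin n, (∏ i, v i (r i)) * θ (fun i => stdVec (r i)) := by
  have h := θ.toMultilinearMap.map_sum (fun i j => v i j • stdVec j)
  have h' : (fun i => ∑ j, v i j • stdVec j) = v := funext fun i => sum_smul_stdVec (v i)
  rw [h'] at h
  refine h.trans (Finset.sum_congr rfl fun r _ => ?_)
  exact θ.toMultilinearMap.map_smul_univ (fun i => v i (r i)) (fun i => stdVec (r i))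

/-- The components of a form on the model space. -/
def formComponents (n k : ℕ) : (Euc n [⋀^Fin k]→L[ℝ] ℝ) →ₗ[ℝ] ((Fin k → Fin n) → ℝ) where
  toFun θ r := θ fun i => stdVec (r i)
  map_add' _ _ := rfl
  map_smul' _ _ := rfl

theorem formComponents_injective (n k : ℕ) : Function.Injective (formComponents n k) := by
  intro θ θ' h
  ext v
  rw [form_apply_eq_sum θ, form_apply_eq_sum θ']
  exact Finset.sum_congr rfl fun r _ => by rw [show θ (fun i => stdVec (r i)) =
    θ' (fun i => stdVec (r i)) from congrFun h r]

/-- The component map is linear and injective, so it has a linear left inverse. That inverse is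
continuous because the space of components is finite-dimensional, and smoothness can therefore be
tested on components. -/
theorem contDiffAt_form {n k : ℕ} {G : Type*} [NormedAddCommGroup G] [NormedSpace ℝ G]
    {θ : G → Euc n [⋀^Fin k]→L[ℝ] ℝ} {u : G} {m : WithTop ℕ∞}
    (h : ∀ r : Fin k → Fin n, ContDiffAt ℝ m (fun v => θ v fun i => stdVec (r i)) u) :
    ContDiffAt ℝ m θ u := by
  obtain ⟨g, hg⟩ := (formComponents n k).exists_leftInverse_of_injective
    (LinearMap.ker_eq_bot.2 (formComponents_injective n k))
  have h1 : ContDiffAt ℝ m (fun v => formComponents n k (θ v)) u := contDiffAt_pi.2 h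
  have h2 : θ = fun v => (LinearMap.toContinuousLinearMap g) (formComponents n k (θ v)) := by
    funext v
    exact (LinearMap.congr_fun hg (θ v)).symm
  rw [h2]
  exact (LinearMap.toContinuousLinearMap g).contDiff.contDiffAt.comp u h1

theorem _root_.ContDiffAt.form_apply_const {n k : ℕ} {G : Type*} [NormedAddCommGroup G] [NormedSpace ℝ G]
    {θ : G → Euc n [⋀^Fin k]→L[ℝ] ℝ} {u : G} {m : WithTop ℕ∞} (hθ : ContDiffAt ℝ m θ u)
    (v : Fin k → Euc n) : ContDiffAt ℝ m (fun w => θ w v) u :=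
  (ContinuousAlternatingMap.apply ℝ (Euc n) ℝ v).contDiff.contDiffAt.comp u hθ

theorem _root_.ContDiffAt.euc_coord {n : ℕ} {G : Type*} [NormedAddCommGroup G] [NormedSpace ℝ G]
    {v : G → Euc n} {u : G} {m : WithTop ℕ∞} (hv : ContDiffAt ℝ m v u) (k : Fin n) :
    ContDiffAt ℝ m (fun w => v w k) u :=
  (EuclideanSpace.proj k : Euc n →L[ℝ] ℝ).contDiff.contDiffAt.comp u hv

theorem _root_.ContDiffAt.form_apply {n k : ℕ} {G : Type*} [NormedAddCommGroup G] [NormedSpace ℝ G]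
    {θ : G → Euc n [⋀^Fin k]→L[ℝ] ℝ} {v : Fin k → G → Euc n} {u : G} {m : WithTop ℕ∞}
    (hθ : ContDiffAt ℝ m θ u) (hv : ∀ i, ContDiffAt ℝ m (v i) u) :
    ContDiffAt ℝ m (fun w => θ w fun i => v i w) u := by
  have h : (fun w => θ w fun i => v i w) = fun w => ∑ r : Fin k → Fin n,
      (∏ i, v i w (r i)) * θ w (fun i => stdVec (r i)) :=
    funext fun w => form_apply_eq_sum _ _
  rw [h]
  refine ContDiffAt.sum fun r _ => ContDiffAt.mul ?_ (hθ.form_apply_const _)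
  exact contDiffAt_prod fun i _ => (hv i).euc_coord _

theorem contDiffAt_pd {n : ℕ} {f : Euc n → ℝ} {u : Euc n} (hf : ContDiffAt ℝ ∞ f u) (k : Fin n) :
    ContDiffAt ℝ ∞ (pd k f) u :=
  (hf.fderiv_right (m := ∞) (by simp)).clm_apply contDiffAt_const

theorem _root_.ContDiffAt.differentiableAt_infty {G F : Type*} [NormedAddCommGroup G] [NormedSpace ℝ G]
    [NormedAddCommGroup F] [NormedSpace ℝ F] {f : G → F} {u : G} (hf : ContDiffAt ℝ ∞ f u) :
    DifferentiableAt ℝ f u :=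
  hf.differentiableAt (by simp)

theorem pd_congr {n : ℕ} {f g : Euc n → ℝ} {u : Euc n} (h : f =ᶠ[𝓝 u] g) (k : Fin n) :
    pd k f u = pd k g u := by
  rw [pd, h.fderiv_eq, pd]

theorem pd_add {n : ℕ} {f g : Euc n → ℝ} {u : Euc n} (hf : DifferentiableAt ℝ f u)
    (hg : DifferentiableAt ℝ g u) (k : Fin n) :
    pd k (fun v => f v + g v) u = pd k f u + pd k g u := by
  simp only [pd]
  rw [fderiv_fun_add hf hg]
  rfl

theorem pd_mul {n : ℕ} {f g : Euc n → ℝ} {u : Euc n} (hf : DifferentiableAt ℝ f u)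
    (hg : DifferentiableAt ℝ g u) (k : Fin n) :
    pd k (fun v => f v * g v) u = f u * pd k g u + pd k f u * g u := by
  simp only [pd]
  rw [fderiv_fun_mul hf hg]
  simp [mul_comm]

theorem pd_const_mul {n : ℕ} {f : Euc n → ℝ} {u : Euc n} (c : ℝ) (hf : DifferentiableAt ℝ f u)
    (k : Fin n) : pd k (fun v => c * f v) u = c * pd k f u := by
  simp only [pd]
  rw [fderiv_const_mul hf]
  rfl

theorem pd_neg {n : ℕ} {f : Euc n → ℝ} {u : Euc n} (k : Fin n) :
    pd k (fun v => - f v) u = - pd k f u := by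
  simp only [pd]
  rw [fderiv_fun_neg]
  rfl

theorem pd_const {n : ℕ} (c : ℝ) (u : Euc n) (k : Fin n) : pd k (fun _ => c) u = 0 := by
  simp [pd]

theorem pd_sum {n : ℕ} {ι : Type*} [Fintype ι] {f : ι → Euc n → ℝ} {u : Euc n}
    (hf : ∀ i, DifferentiableAt ℝ (f i) u) (k : Fin n) :
    pd k (fun v => ∑ i, f i v) u = ∑ i, pd k (f i) u := by
  simp only [pd]
  rw [fderiv_fun_sum fun i _ => hf i]
  simp

theorem minSmoothness_two_le_infty : minSmoothness ℝ 2 ≤ (∞ : WithTop ℕ∞) := by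
  rw [minSmoothness_of_isRCLikeNormedField]
  exact WithTop.coe_le_coe.2 (le_top : (2 : ℕ∞) ≤ ⊤)

theorem pd_comm {n : ℕ} {f : Euc n → ℝ} {u : Euc n} (hf : ContDiffAt ℝ ∞ f u) (k l : Fin n) :
    pd k (pd l f) u = pd l (pd k f) u := by
  have hd : DifferentiableAt ℝ (fderiv ℝ f) u :=
    (hf.fderiv_right (m := ∞) (by simp)).differentiableAt_infty
  have h : ∀ a b : Fin n, pd a (pd b f) u = fderiv ℝ (fderiv ℝ f) u (stdVec a) (stdVec b) := by
    intro a b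
    have : pd b f = fun v => fderiv ℝ f v (stdVec b) := rfl
    rw [this, pd, fderiv_clm_apply hd (differentiableAt_const _)]
    simp
  rw [h, h]
  exact (hf.isSymmSndFDerivAt minSmoothness_two_le_infty) _ _

/-! ### Calculus in a chart -/

variable {n : ℕ} {M : Type*} [TopologicalSpace M] [ChartedSpace (EuclideanSpace ℝ (Fin n)) M]

/-- The derivative at `y` of the preferred chart at `x₀`. -/
def dchart (x₀ y : M) : Tan n y →L[ℝ] Euc n :=
  mfderiv (𝓡 n) 𝓘(ℝ, EuclideanSpace ℝ (Fin n)) (extChartAt (𝓡 n) x₀) y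

/-- The derivative at `u` of the inverse of the preferred chart at `x₀`. -/
def dsymm (x₀ : M) (u : Euc n) : Euc n →L[ℝ] Tan n ((extChartAt (𝓡 n) x₀).symm u) :=
  mfderiv 𝓘(ℝ, EuclideanSpace ℝ (Fin n)) (𝓡 n) (extChartAt (𝓡 n) x₀).symm u

/-- The expression of a function in the preferred chart at `x₀`. -/
def funRep (n : ℕ) {M : Type*} [TopologicalSpace M]
    [ChartedSpace (EuclideanSpace ℝ (Fin n)) M] (f : M → ℝ) (x₀ : M) (u : Euc n) : ℝ :=
  f ((extChartAt (𝓡 n) x₀).symm u)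

/-- The expression of a vector field in the preferred chart at `x₀`. -/
def vecRep (V : ∀ y : M, Tan n y) (x₀ : M) (u : Euc n) : Euc n :=
  dchart x₀ ((extChartAt (𝓡 n) x₀).symm u) (V ((extChartAt (𝓡 n) x₀).symm u))

/-- The components of a 1-form in the preferred chart at `x₀`. -/
def covRep (β : ∀ y : M, Cotan n y) (x₀ : M) (k : Fin n) (u : Euc n) : ℝ :=
  β ((extChartAt (𝓡 n) x₀).symm u) (dsymm x₀ u (stdVec k))

variable [IsManifold (𝓡 n) ∞ M]

theorem isManifold_one : IsManifold (𝓡 n) 1 M :=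
  IsManifold.of_le (n := ∞) (by simp)

theorem dchart_dsymm {x₀ : M} {u : Euc n} (hu : u ∈ (extChartAt (𝓡 n) x₀).target) (v : Euc n) :
    dchart x₀ ((extChartAt (𝓡 n) x₀).symm u) (dsymm x₀ u v) = v := by
  have := isManifold_one (n := n) (M := M)
  have h := mfderiv_extChartAt_comp_mfderivWithin_extChartAt_symm (I := 𝓡 n) hu
  rw [ModelWithCorners.range_eq_univ, mfderivWithin_univ] at h
  exact congrArg (fun L => L v) h

theorem dsymm_dchart {x₀ : M} {u : Euc n} (hu : u ∈ (extChartAt (𝓡 n) x₀).target)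
    (w : Tan n ((extChartAt (𝓡 n) x₀).symm u)) :
    dsymm x₀ u (dchart x₀ ((extChartAt (𝓡 n) x₀).symm u) w) = w := by
  have := isManifold_one (n := n) (M := M)
  have h := mfderivWithin_extChartAt_symm_comp_mfderiv_extChartAt (I := 𝓡 n) hu
  rw [ModelWithCorners.range_eq_univ, mfderivWithin_univ] at h
  exact congrArg (fun L => L w) h

theorem dchart_self (x : M) (w : Tan n x) : dchart x x w = w := by
  have := isManifold_one (n := n) (M := M)
  exact congrArg (fun L => L w) (mfderiv_extChartAt_self (I := 𝓡 n) (x := x))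

/-- `mpullback` uses `ContinuousLinearMap.inverse`, which has the default value zero at
non-invertible maps. On the chart target the derivatives of the chart and of its inverse are
mutually inverse, so the default does not occur. -/
theorem coordVec_symm {x₀ : M} {u : Euc n} (hu : u ∈ (extChartAt (𝓡 n) x₀).target) (k : Fin n) :
    coordVec x₀ k ((extChartAt (𝓡 n) x₀).symm u) = dsymm x₀ u (stdVec k) := by
  have h : (dchart x₀ ((extChartAt (𝓡 n) x₀).symm u)).inverse = dsymm x₀ u :=
    ContinuousLinearMap.inverse_eq (ContinuousLinearMap.ext (dchart_dsymm hu))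
      (ContinuousLinearMap.ext (dsymm_dchart hu))
  exact congrArg (fun L => L (stdVec k)) h

omit [IsManifold (𝓡 n) ∞ M] in
theorem coordCovec_apply (x₀ : M) (k : Fin n) (y : M) (w : Tan n y) :
    coordCovec x₀ k y w = dchart x₀ y w k := rfl

theorem dchart_coordVec {x₀ y : M} (hy : y ∈ (extChartAt (𝓡 n) x₀).source) (k : Fin n) :
    dchart x₀ y (coordVec x₀ k y) = stdVec k := by
  obtain ⟨u, hu, rfl⟩ : ∃ u ∈ (extChartAt (𝓡 n) x₀).target, (extChartAt (𝓡 n) x₀).symm u = y :=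
    ⟨_, (extChartAt (𝓡 n) x₀).map_source hy, (extChartAt (𝓡 n) x₀).left_inv hy⟩
  rw [coordVec_symm hu, dchart_dsymm hu]

theorem sum_coordVec {x₀ y : M} (hy : y ∈ (extChartAt (𝓡 n) x₀).source) (w : Tan n y) :
    ∑ k, dchart x₀ y w k • coordVec x₀ k y = w := by
  obtain ⟨u, hu, rfl⟩ : ∃ u ∈ (extChartAt (𝓡 n) x₀).target, (extChartAt (𝓡 n) x₀).symm u = y :=
    ⟨_, (extChartAt (𝓡 n) x₀).map_source hy, (extChartAt (𝓡 n) x₀).left_inv hy⟩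
  conv_rhs => rw [← dsymm_dchart hu w, ← sum_smul_stdVec (dchart x₀ _ w), map_sum]
  exact Finset.sum_congr rfl fun k _ => by rw [coordVec_symm hu, map_smul]

theorem sum_coordCovec {x₀ y : M} (hy : y ∈ (extChartAt (𝓡 n) x₀).source) (α : Cotan n y) :
    ∑ k, α (coordVec x₀ k y) • coordCovec x₀ k y = α := by
  refine ContinuousLinearMap.ext fun w => ?_
  conv_rhs => rw [← sum_coordVec hy w, map_sum]
  rw [sum_apply]
  exact Finset.sum_congr rfl fun k _ => by
    rw [map_smul, smul_apply, coordCovec_apply, smul_eq_mul, smul_eq_mul,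
      mul_comm]

omit [IsManifold (𝓡 n) ∞ M] in
theorem symm_mem_nhds_of_eventually {x₀ y : M} (hy : y ∈ (extChartAt (𝓡 n) x₀).source)
    {p : M → Prop} (h : ∀ᶠ z in 𝓝 y, p z) :
    ∀ᶠ u in 𝓝 (extChartAt (𝓡 n) x₀ y), p ((extChartAt (𝓡 n) x₀).symm u) := by
  have hc := continuousAt_extChartAt_symm' (I := 𝓡 n) hy
  rw [ContinuousAt, (extChartAt (𝓡 n) x₀).left_inv hy] at hc
  exact hc.eventually h

omit [IsManifold (𝓡 n) ∞ M] in
theorem eventually_of_chart {x₀ y : M} (hy : y ∈ (extChartAt (𝓡 n) x₀).source)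
    {p : Euc n → Prop} (h : ∀ᶠ u in 𝓝 (extChartAt (𝓡 n) x₀ y), p u) :
    ∀ᶠ z in 𝓝 y, p (extChartAt (𝓡 n) x₀ z) :=
  (continuousAt_extChartAt' (I := 𝓡 n) hy).eventually h

omit [IsManifold (𝓡 n) ∞ M] in
theorem eventually_mem_target {x₀ y : M} (hy : y ∈ (extChartAt (𝓡 n) x₀).source) :
    ∀ᶠ u in 𝓝 (extChartAt (𝓡 n) x₀ y), u ∈ (extChartAt (𝓡 n) x₀).target :=
  extChartAt_target_mem_nhds' ((extChartAt (𝓡 n) x₀).map_source hy)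

theorem contMDiffAt_iff_funRep {f : M → ℝ} {x₀ y : M}
    (hy : y ∈ (extChartAt (𝓡 n) x₀).source) :
    ContMDiffAt (𝓡 n) 𝓘(ℝ, ℝ) ∞ f y ↔
      ContDiffAt ℝ ∞ (funRep n f x₀) (extChartAt (𝓡 n) x₀ y) := by
  have hy' : y ∈ (chartAt (EuclideanSpace ℝ (Fin n)) x₀).source := by
    rwa [extChartAt_source] at hy
  rw [contMDiffAt_iff_source_of_mem_source hy', ModelWithCorners.range_eq_univ,
    contMDiffWithinAt_univ, contMDiffAt_iff_contDiffAt]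
  rfl

theorem mdifferentiableAt_symm {x₀ : M} {u : Euc n} (hu : u ∈ (extChartAt (𝓡 n) x₀).target) :
    MDifferentiableAt 𝓘(ℝ, Euc n) (𝓡 n) (extChartAt (𝓡 n) x₀).symm u := by
  have := isManifold_one (n := n) (M := M)
  have h := mdifferentiableWithinAt_extChartAt_symm (I := 𝓡 n) hu
  rwa [ModelWithCorners.range_eq_univ, mdifferentiableWithinAt_univ] at h

theorem dFun_dsymm {f : M → ℝ} {x₀ : M} {u : Euc n} (hu : u ∈ (extChartAt (𝓡 n) x₀).target)
    (hf : MDifferentiableAt (𝓡 n) 𝓘(ℝ, ℝ) f ((extChartAt (𝓡 n) x₀).symm u)) (v : Euc n) :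
    dFun f ((extChartAt (𝓡 n) x₀).symm u) (dsymm x₀ u v) = fderiv ℝ (funRep n f x₀) u v := by
  have h := mfderiv_comp u hf (mdifferentiableAt_symm hu)
  rw [mfderiv_eq_fderiv] at h
  exact (congrArg (fun L => L v) h).symm

theorem dFun_eq_sum {f : M → ℝ} {x₀ y : M} (hy : y ∈ (extChartAt (𝓡 n) x₀).source)
    (hf : MDifferentiableAt (𝓡 n) 𝓘(ℝ, ℝ) f y) (w : Tan n y) :
    dFun f y w = ∑ k, dchart x₀ y w k * pd k (funRep n f x₀) (extChartAt (𝓡 n) x₀ y) := by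
  obtain ⟨u, hu, rfl⟩ : ∃ u ∈ (extChartAt (𝓡 n) x₀).target, (extChartAt (𝓡 n) x₀).symm u = y :=
    ⟨_, (extChartAt (𝓡 n) x₀).map_source hy, (extChartAt (𝓡 n) x₀).left_inv hy⟩
  rw [(extChartAt (𝓡 n) x₀).right_inv hu, ← fderiv_eq_sum_pd, ← dFun_dsymm hu hf,
    dsymm_dchart hu]

end TwistedPoissonGeometry

end

noncomputable section

namespace TwistedPoissonGeometry

variable {n : ℕ} {M : Type*} [TopologicalSpace M] [ChartedSpace (EuclideanSpace ℝ (Fin n)) M]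

/-! ### Differential forms in different charts -/

theorem chartRep_apply {k : ℕ} (θ : ∀ x : M, FormAt n k x) (x₀ : M) (u : Euc n)
    (v : Fin k → Euc n) :
    chartRep θ x₀ u v = θ ((extChartAt (𝓡 n) x₀).symm u) (fun i => dsymm x₀ u (v i)) := rfl

variable [IsManifold (𝓡 n) ∞ M]

theorem chartRep_dchart {k : ℕ} (θ : ∀ x : M, FormAt n k x) {x₀ y : M}
    (hy : y ∈ (extChartAt (𝓡 n) x₀).source) (w : Fin k → Tan n y) :
    chartRep θ x₀ (extChartAt (𝓡 n) x₀ y) (fun i => dchart x₀ y (w i)) = θ y w := by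
  obtain ⟨u, hu, rfl⟩ : ∃ u ∈ (extChartAt (𝓡 n) x₀).target, (extChartAt (𝓡 n) x₀).symm u = y :=
    ⟨_, (extChartAt (𝓡 n) x₀).map_source hy, (extChartAt (𝓡 n) x₀).left_inv hy⟩
  rw [(extChartAt (𝓡 n) x₀).right_inv hu, chartRep_apply]
  exact congrArg _ (funext fun i => dsymm_dchart hu (w i))

/-- The coordinate change between preferred charts. -/
def coordChange (x₀ x₁ : M) (u : Euc n) : Euc n :=
  extChartAt (𝓡 n) x₁ ((extChartAt (𝓡 n) x₀).symm u)

theorem contDiffAt_coordChange {x₀ x₁ z : M} (h₀ : z ∈ (extChartAt (𝓡 n) x₀).source)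
    (h₁ : z ∈ (extChartAt (𝓡 n) x₁).source) :
    ContDiffAt ℝ ∞ (coordChange x₀ x₁) (extChartAt (𝓡 n) x₀ z) := by
  have h := contDiffWithinAt_ext_coord_change (I := 𝓡 n) (n := ∞) x₁ x₀
    (y := extChartAt (𝓡 n) x₀ z) (by
      rw [PartialEquiv.trans_source, PartialEquiv.symm_source]
      refine ⟨(extChartAt (𝓡 n) x₀).map_source h₀, ?_⟩
      rwa [Set.mem_preimage, (extChartAt (𝓡 n) x₀).left_inv h₀])
  rwa [ModelWithCorners.range_eq_univ, contDiffWithinAt_univ] at h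

theorem fderiv_coordChange {x₀ x₁ : M} {u : Euc n} (hu : u ∈ (extChartAt (𝓡 n) x₀).target)
    (h₁ : (extChartAt (𝓡 n) x₀).symm u ∈ (extChartAt (𝓡 n) x₁).source) (v : Euc n) :
    fderiv ℝ (coordChange x₀ x₁) u v =
      dchart x₁ ((extChartAt (𝓡 n) x₀).symm u) (dsymm x₀ u v) := by
  have := isManifold_one (n := n) (M := M)
  rw [extChartAt_source] at h₁
  have h := mfderiv_comp u (mdifferentiableAt_extChartAt (I := 𝓡 n) h₁)
    (mdifferentiableAt_symm hu)
  rw [mfderiv_eq_fderiv] at h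
  exact congrArg (fun L => L v) h

omit [IsManifold (𝓡 n) ∞ M] in
theorem eventually_symm_mem_source {x₀ x₁ z : M} (h₀ : z ∈ (extChartAt (𝓡 n) x₀).source)
    (h₁ : z ∈ (extChartAt (𝓡 n) x₁).source) : ∀ᶠ u in 𝓝 (extChartAt (𝓡 n) x₀ z),
      (extChartAt (𝓡 n) x₀).symm u ∈ (extChartAt (𝓡 n) x₁).source :=
  symm_mem_nhds_of_eventually h₀
    (extChartAt_source_mem_nhds' (I := 𝓡 n) h₁)

theorem chartRep_coordChange {k : ℕ} (θ : ∀ x : M, FormAt n k x) {x₀ x₁ z : M}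
    (h₀ : z ∈ (extChartAt (𝓡 n) x₀).source) (h₁ : z ∈ (extChartAt (𝓡 n) x₁).source) :
    chartRep θ x₀ =ᶠ[𝓝 (extChartAt (𝓡 n) x₀ z)] fun u =>
      (chartRep θ x₁ (coordChange x₀ x₁ u)).compContinuousLinearMap
        (fderiv ℝ (coordChange x₀ x₁) u) := by
  filter_upwards [eventually_mem_target h₀, eventually_symm_mem_source h₀ h₁] with u hu hu'
  ext v
  rw [ContinuousAlternatingMap.compContinuousLinearMap_apply, chartRep_apply,
    ← chartRep_dchart θ hu']
  congr 1
  funext i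
  exact (fderiv_coordChange hu hu' (v i)).symm

theorem ContDiffAt_chartRep_coordChange {k : ℕ} {θ : ∀ x : M, FormAt n k x} {x₀ x₁ z : M}
    (h₀ : z ∈ (extChartAt (𝓡 n) x₀).source) (h₁ : z ∈ (extChartAt (𝓡 n) x₁).source)
    (h : ContDiffAt ℝ ∞ (chartRep θ x₁) (extChartAt (𝓡 n) x₁ z)) :
    ContDiffAt ℝ ∞ (chartRep θ x₀) (extChartAt (𝓡 n) x₀ z) := by
  refine ContDiffAt.congr_of_eventuallyEq ?_ (chartRep_coordChange θ h₀ h₁)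
  have hc := contDiffAt_coordChange h₀ h₁
  refine contDiffAt_form fun r => ?_
  have h' : coordChange x₀ x₁ (extChartAt (𝓡 n) x₀ z) = extChartAt (𝓡 n) x₁ z := by
    rw [coordChange, (extChartAt (𝓡 n) x₀).left_inv h₀]
  have h2 : ContDiffAt ℝ ∞ (fun u => chartRep θ x₁ (coordChange x₀ x₁ u))
      (extChartAt (𝓡 n) x₀ z) := by
    rw [← h'] at h
    exact h.comp _ hc
  exact h2.form_apply fun i => (hc.fderiv_right (m := ∞) (by simp)).clm_apply contDiffAt_const

/-- Naturality of `extDeriv` under the coordinate change: the chart centred at `y`, in which `extD`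
is computed, can be replaced by any chart containing `y`. -/
theorem extD_apply {k : ℕ} {θ : ∀ x : M, FormAt n k x} {x₀ y : M}
    (hy : y ∈ (extChartAt (𝓡 n) x₀).source)
    (hθ : ContDiffAt ℝ ∞ (chartRep θ x₀) (extChartAt (𝓡 n) x₀ y)) (w : Fin (k + 1) → Tan n y) :
    extD θ y w = extDeriv (chartRep θ x₀) (extChartAt (𝓡 n) x₀ y)
      (fun i => dchart x₀ y (w i)) := by
  have hs := mem_extChartAt_source (I := 𝓡 n) y
  have hc := contDiffAt_coordChange hs hy
  have h' : coordChange y x₀ (extChartAt (𝓡 n) y y) = extChartAt (𝓡 n) x₀ y := by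
    rw [coordChange, (extChartAt (𝓡 n) y).left_inv hs]
  have h1 := (chartRep_coordChange θ hs hy).extDeriv_eq
  have hd : DifferentiableAt ℝ (chartRep θ x₀) (coordChange y x₀ (extChartAt (𝓡 n) y y)) := by
    rw [h']
    exact hθ.differentiableAt_infty
  rw [extDeriv_pullback hd hc minSmoothness_two_le_infty] at h1
  have h2 : extD θ y w = extDeriv (chartRep θ y) (extChartAt (𝓡 n) y y)
    (fun i => dchart y y (w i)) := rfl
  rw [h2, h1, ContinuousAlternatingMap.compContinuousLinearMap_apply, h']
  congr 1
  funext i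
  have h3 := fderiv_coordChange (x₁ := x₀) ((extChartAt (𝓡 n) y).map_source hs)
    (by rwa [(extChartAt (𝓡 n) y).left_inv hs]) (dchart y y (w i))
  rw [Function.comp_apply, h3]
  have h4 : ∀ z (hz : z ∈ (extChartAt (𝓡 n) y).source) (v : Tan n z),
      dchart x₀ ((extChartAt (𝓡 n) y).symm (extChartAt (𝓡 n) y z))
        (dsymm y (extChartAt (𝓡 n) y z) (dchart y z v)) = dchart x₀ z v := by
    intro z hz v
    obtain ⟨u, hu, rfl⟩ : ∃ u ∈ (extChartAt (𝓡 n) y).target, (extChartAt (𝓡 n) y).symm u = z :=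
      ⟨_, (extChartAt (𝓡 n) y).map_source hz, (extChartAt (𝓡 n) y).left_inv hz⟩
    rw [(extChartAt (𝓡 n) y).right_inv hu, dsymm_dchart hu]
  exact h4 y hs (w i)

theorem chartRep_extD {k : ℕ} {θ : ∀ x : M, FormAt n k x} {x₀ : M} {u : Euc n}
    (hu : u ∈ (extChartAt (𝓡 n) x₀).target) (hθ : ContDiffAt ℝ ∞ (chartRep θ x₀) u) :
    chartRep (extD θ) x₀ u = extDeriv (chartRep θ x₀) u := by
  ext v
  have h := extD_apply ((extChartAt (𝓡 n) x₀).map_target hu) (θ := θ)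
    (by rwa [(extChartAt (𝓡 n) x₀).right_inv hu]) (fun i => dsymm x₀ u (v i))
  rw [chartRep_apply, h, (extChartAt (𝓡 n) x₀).right_inv hu]
  congr 1
  funext i
  exact dchart_dsymm hu (v i)

/-- `SmoothFormNear` only refers to the chart centred at `x`. This carries smoothness on a
neighbourhood over to every chart containing `x`. -/
theorem SmoothFormNear.eventually_chartRep {k : ℕ} {θ : ∀ x : M, FormAt n k x} {x₀ x : M}
    (h : SmoothFormNear θ x) (hx : x ∈ (extChartAt (𝓡 n) x₀).source) :
    ∀ᶠ u in 𝓝 (extChartAt (𝓡 n) x₀ x), ContDiffAt ℝ ∞ (chartRep θ x₀) u := by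
  have hs := mem_extChartAt_source (I := 𝓡 n) x
  have h1 : ∀ᶠ z in 𝓝 x, ContDiffAt ℝ ∞ (chartRep θ x) (extChartAt (𝓡 n) x z) :=
    eventually_of_chart hs h
  have h2 : ∀ᶠ z in 𝓝 x, ContDiffAt ℝ ∞ (chartRep θ x₀) (extChartAt (𝓡 n) x₀ z) := by
    filter_upwards [h1, extChartAt_source_mem_nhds (I := 𝓡 n) x,
      extChartAt_source_mem_nhds' (I := 𝓡 n) hx] with z hz hz1 hz2
    exact ContDiffAt_chartRep_coordChange hz2 hz1 hz
  filter_upwards [symm_mem_nhds_of_eventually hx h2, eventually_mem_target hx] with u hu hu'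
  rwa [(extChartAt (𝓡 n) x₀).right_inv hu'] at hu

/-! ### Smooth sections in a chart -/

/-- In the trivialization of the tangent bundle attached to the same chart, the coordinate frame is
constant. The same idea gives smoothness of the dual frame in `contMDiffAt_coordCovec`. -/
theorem contMDiffAt_coordVec {x₀ y : M} (hy : y ∈ (extChartAt (𝓡 n) x₀).source) (k : Fin n) :
    ContMDiffAt (𝓡 n) ((𝓡 n).prod 𝓘(ℝ, EuclideanSpace ℝ (Fin n))) ∞
      (fun z => Bundle.TotalSpace.mk' (EuclideanSpace ℝ (Fin n))
        (E := (TangentSpace (𝓡 n) : M → Type)) z (coordVec x₀ k z)) y := by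
  have := isManifold_one (n := n) (M := M)
  have hy' : y ∈ (chartAt (EuclideanSpace ℝ (Fin n)) x₀).source := by
    rwa [extChartAt_source] at hy
  refine ((trivializationAt (EuclideanSpace ℝ (Fin n)) (TangentSpace (𝓡 n) : M → Type)
    x₀).contMDiffAt_section_iff (by simpa using hy')).2 ?_
  refine (contMDiffAt_const (c := (stdVec k : Euc n))).congr_of_eventuallyEq ?_
  filter_upwards [(chartAt (EuclideanSpace ℝ (Fin n)) x₀).open_source.mem_nhds hy'] with z hz
  have h := TangentBundle.continuousLinearMapAt_trivializationAt (I := 𝓡 n) hz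
  have h1 := congrArg (fun L => L (coordVec x₀ k z)) h
  have h2 := dchart_coordVec (x₀ := x₀) (y := z) (by rwa [extChartAt_source]) k
  refine Eq.trans ?_ (h1.trans h2)
  rw [Bundle.Trivialization.continuousLinearMapAt_apply,
    Bundle.Trivialization.coe_linearMapAt_of_mem _ (by simpa using hz)]

theorem contMDiffAt_coordCovec {x₀ y : M} (hy : y ∈ (extChartAt (𝓡 n) x₀).source) (k : Fin n) :
    ContMDiffAt (𝓡 n) ((𝓡 n).prod 𝓘(ℝ, EuclideanSpace ℝ (Fin n) →L[ℝ] ℝ)) ∞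
      (fun z => Bundle.TotalSpace.mk' (EuclideanSpace ℝ (Fin n) →L[ℝ] ℝ)
        (E := fun z : M => TangentSpace (𝓡 n) z →L[ℝ] Bundle.Trivial M ℝ z) z
        (coordCovec x₀ k z)) y := by
  have := isManifold_one (n := n) (M := M)
  have hy' : y ∈ (chartAt (EuclideanSpace ℝ (Fin n)) x₀).source := by
    rwa [extChartAt_source] at hy
  refine ((trivializationAt (EuclideanSpace ℝ (Fin n) →L[ℝ] ℝ)
    (fun z : M => TangentSpace (𝓡 n) z →L[ℝ] Bundle.Trivial M ℝ z)
    x₀).contMDiffAt_section_iff (by simpa using hy')).2 ?_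
  refine (contMDiffAt_const (c := (EuclideanSpace.proj k : Euc n →L[ℝ] ℝ))).congr_of_eventuallyEq ?_
  filter_upwards [(chartAt (EuclideanSpace ℝ (Fin n)) x₀).open_source.mem_nhds hy'] with z hz
  have hz' : z ∈ (extChartAt (𝓡 n) x₀).source := by rwa [extChartAt_source]
  have hb : z ∈ (trivializationAt (EuclideanSpace ℝ (Fin n)) (TangentSpace (𝓡 n) : M → Type)
    x₀).baseSet := by simpa using hz
  have h := TangentBundle.continuousLinearMapAt_trivializationAt (I := 𝓡 n) hz
  refine ContinuousLinearMap.ext fun v => ?_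
  have h1 := congrArg (fun L => L ((trivializationAt (EuclideanSpace ℝ (Fin n))
    (TangentSpace (𝓡 n) : M → Type) x₀).symmL ℝ z v)) h
  have h2 : ((trivializationAt (EuclideanSpace ℝ (Fin n)) (TangentSpace (𝓡 n) : M → Type)
    x₀).continuousLinearMapAt ℝ z ((trivializationAt (EuclideanSpace ℝ (Fin n))
    (TangentSpace (𝓡 n) : M → Type) x₀).symmL ℝ z v)) = v :=
    Bundle.Trivialization.continuousLinearMapAt_symmL _ hb v
  have h3 : dchart x₀ z ((trivializationAt (EuclideanSpace ℝ (Fin n))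
    (TangentSpace (𝓡 n) : M → Type) x₀).symmL ℝ z v) = v := h1.symm.trans h2
  have h4 : coordCovec x₀ k z ((trivializationAt (EuclideanSpace ℝ (Fin n))
    (TangentSpace (𝓡 n) : M → Type) x₀).symmL ℝ z v) = v k := by
    rw [coordCovec_apply, h3]
  rw [hom_trivializationAt_apply]
  simp only [ContinuousLinearMap.inCoordinates, ContinuousLinearMap.comp_apply]
  rw [h4]
  simp

/-- The section `β` of the cotangent bundle is smooth at `y`. -/
abbrev SmoothCovecAt (β : ∀ y : M, Cotan n y) (y : M) : Prop :=
  ContMDiffAt (𝓡 n) ((𝓡 n).prod 𝓘(ℝ, EuclideanSpace ℝ (Fin n) →L[ℝ] ℝ)) ∞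
    (fun z => Bundle.TotalSpace.mk' (EuclideanSpace ℝ (Fin n) →L[ℝ] ℝ)
      (E := fun z : M => TangentSpace (𝓡 n) z →L[ℝ] Bundle.Trivial M ℝ z) z (β z)) y

/-- The vector field `V` is smooth at `y`. -/
abbrev SmoothVecAt (V : ∀ y : M, Tan n y) (y : M) : Prop :=
  ContMDiffAt (𝓡 n) ((𝓡 n).prod 𝓘(ℝ, EuclideanSpace ℝ (Fin n))) ∞
    (fun z => Bundle.TotalSpace.mk' (EuclideanSpace ℝ (Fin n))
      (E := (TangentSpace (𝓡 n) : M → Type)) z (V z)) y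

theorem SmoothCovecAt.pairing {β : ∀ y : M, Cotan n y} {V : ∀ y : M, Tan n y} {y : M}
    (hβ : SmoothCovecAt β y) (hV : SmoothVecAt V y) :
    ContMDiffAt (𝓡 n) 𝓘(ℝ, ℝ) ∞ (fun z => β z (V z)) y := by
  have h := ContMDiffAt.clm_bundle_apply (F₁ := EuclideanSpace ℝ (Fin n)) (F₂ := ℝ)
    (E₁ := (TangentSpace (𝓡 n) : M → Type)) (E₂ := Bundle.Trivial M ℝ) (b := fun y : M => y)
    hβ hV
  rw [Bundle.contMDiffAt_section] at h
  exact h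

theorem covRep_eq_funRep (β : ∀ y : M, Cotan n y) {x₀ : M} (k : Fin n) {u : Euc n}
    (hu : u ∈ (extChartAt (𝓡 n) x₀).target) :
    covRep β x₀ k u = funRep n (fun z => β z (coordVec x₀ k z)) x₀ u := by
  rw [funRep, coordVec_symm hu, covRep]

omit [IsManifold (𝓡 n) ∞ M] in
theorem vecRep_apply (V : ∀ y : M, Tan n y) (x₀ : M) (u : Euc n) (k : Fin n) :
    vecRep V x₀ u k = funRep n (fun z => coordCovec x₀ k z (V z)) x₀ u := rfl

theorem SmoothCovecAt.contDiffAt_covRep {β : ∀ y : M, Cotan n y} {x₀ y : M}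
    (hβ : SmoothCovecAt β y) (hy : y ∈ (extChartAt (𝓡 n) x₀).source) (k : Fin n) :
    ContDiffAt ℝ ∞ (covRep β x₀ k) (extChartAt (𝓡 n) x₀ y) := by
  have h := (contMDiffAt_iff_funRep hy).1 (hβ.pairing (contMDiffAt_coordVec hy k))
  refine h.congr_of_eventuallyEq ?_
  filter_upwards [eventually_mem_target hy] with u hu
  exact covRep_eq_funRep β k hu

theorem SmoothVecAt.contDiffAt_vecRep {V : ∀ y : M, Tan n y} {x₀ y : M}
    (hV : SmoothVecAt V y) (hy : y ∈ (extChartAt (𝓡 n) x₀).source) :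
    ContDiffAt ℝ ∞ (vecRep V x₀) (extChartAt (𝓡 n) x₀ y) := by
  rw [contDiffAt_euclidean]
  exact fun k => (contMDiffAt_iff_funRep hy).1 (SmoothCovecAt.pairing (contMDiffAt_coordCovec hy k) hV)

theorem smoothVecAt_of_components {V : ∀ y : M, Tan n y} {x₀ y : M}
    (hy : y ∈ (extChartAt (𝓡 n) x₀).source)
    (h : ∀ k, ContDiffAt ℝ ∞ (fun u => vecRep V x₀ u k) (extChartAt (𝓡 n) x₀ y)) :
    SmoothVecAt V y := by
  have h1 : SmoothVecAt (fun z => ∑ k, (coordCovec x₀ k z (V z)) • coordVec x₀ k z) y :=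
    ContMDiffAt.sum_section fun k _ => ContMDiffAt.smul_section
      ((contMDiffAt_iff_funRep hy).2 (h k)) (contMDiffAt_coordVec hy k)
  refine h1.congr_of_eventuallyEq ?_
  filter_upwards [extChartAt_source_mem_nhds' (I := 𝓡 n) hy] with z hz
  exact congrArg _ (sum_coordVec hz (V z)).symm

/-- The equations for `X` and `U` are tested only against global 1-forms. They determine a vector at
`x` because global 1-forms take every value there; this is where a partition of unity, hence second
countability and the Hausdorff property, is needed. -/
theorem exists_oneForm_eq [T2Space M] [SecondCountableTopology M] (x : M) (a : Cotan n x) :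
    ∃ α : OneForms n M, (α x : Cotan n x) = a := by
  have : LocallyCompactSpace M := ChartedSpace.locallyCompactSpace (EuclideanSpace ℝ (Fin n)) M
  obtain ⟨s, hs⟩ := exists_contMDiffSection_forall_mem_convex_of_local (𝓡 n) (n := (⊤ : ℕ∞))
    (F_fiber := EuclideanSpace ℝ (Fin n) →L[ℝ] ℝ)
    (fun x : M => TangentSpace (𝓡 n) x →L[ℝ] Bundle.Trivial M ℝ x)
    -- The constraint is empty away from `x` and affine at `x`, hence convex in each fibre.
    -- Comparing values on the coordinate frame avoids transporting `a` along `y = x`.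
    (fun y => {v : Cotan n y | y = x → ∀ k, v (coordVec x k y) = a (coordVec x k x)})
    (by
      rintro y v hv w hw s t hs ht hst h k
      have h1 := hv h k
      have h2 := hw h k
      have : (s • v + t • w : Cotan n y) (coordVec x k y) =
        s * v (coordVec x k y) + t * w (coordVec x k y) := rfl
      refine this.trans ?_
      rw [h1, h2, ← add_mul, hst, one_mul])
    (by
      intro x₀
      by_cases hx : x₀ = x
      · subst hx
        refine ⟨(extChartAt (𝓡 n) x₀).source, extChartAt_source_mem_nhds (I := 𝓡 n) x₀,
          fun y => ∑ k, a (coordVec x₀ k x₀) • coordCovec x₀ k y, ?_, ?_⟩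
        · intro y hy
          exact (ContMDiffAt.sum_section fun k _ => ContMDiffAt.const_smul_section
            (contMDiffAt_coordCovec hy k)).contMDiffWithinAt
        · intro y hy h k
          subst h
          exact congrArg (fun L : Cotan n y => L (coordVec y k y)) (sum_coordCovec hy a)
      · refine ⟨{x}ᶜ, isOpen_compl_singleton.mem_nhds hx, fun y => (0 : Cotan n y), ?_, ?_⟩
        · exact (Bundle.contMDiff_zeroSection ℝ
            (fun x : M => TangentSpace (𝓡 n) x →L[ℝ] Bundle.Trivial M ℝ x)).contMDiffOn
        · intro y hy h
          exact absurd h hy)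
  refine ⟨s, ?_⟩
  have hx := mem_extChartAt_source (I := 𝓡 n) x
  rw [← sum_coordCovec hx a, ← sum_coordCovec hx (s x)]
  exact Finset.sum_congr rfl fun k _ => by rw [hs x rfl k]

end TwistedPoissonGeometry

end

noncomputable section

namespace TwistedPoissonGeometry

/-! ### Exterior derivatives and Lie derivatives in components -/

theorem extDeriv_stdVec {n k : ℕ} {θ : Euc n → Euc n [⋀^Fin k]→L[ℝ] ℝ} {u : Euc n}
    (hθ : DifferentiableAt ℝ θ u) (r : Fin (k + 1) → Fin n) :
    extDeriv θ u (fun i => stdVec (r i)) =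
      ∑ i : Fin (k + 1), (-1) ^ (i : ℕ) *
        pd (r i) (fun u' => θ u' fun j => stdVec (r (i.succAbove j))) u := by
  rw [extDeriv_apply hθ]
  refine Finset.sum_congr rfl fun i _ => ?_
  rw [zsmul_eq_mul]
  push_cast
  rfl

theorem form_update_stdVec {n : ℕ} (θ : Euc n [⋀^Fin n]→L[ℝ] ℝ) (k : Fin n) (v : Euc n) :
    θ (Function.update (fun i => stdVec i) k v) = v k * θ (fun i => stdVec i) := by
  conv_lhs => rw [← sum_smul_stdVec v]
  have h := θ.toMultilinearMap.map_update_sum Finset.univ k (fun j => v j • stdVec j)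
    (fun i => stdVec i)
  refine h.trans ?_
  rw [Finset.sum_eq_single k]
  · have h1 := θ.toMultilinearMap.map_update_smul (fun i => stdVec i) k (v k) (stdVec k)
    rw [Function.update_eq_self] at h1
    exact h1
  · intro j _ hj
    have h1 := θ.toMultilinearMap.map_update_smul (fun i => stdVec i) k (v j) (stdVec j)
    have h2 := θ.toAlternatingMap.map_update_self (fun i => stdVec i) (i := k) (j := j) hj.symm
    refine h1.trans ?_
    have h3 : θ.toMultilinearMap (Function.update (fun i => stdVec i) k (stdVec j)) = 0 := h2
    rw [h3, smul_zero]
  · exact fun h => absurd (Finset.mem_univ k) h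

/-- Moving `v` to the missing slot `k` passes `k` basis vectors, hence the sign; there only the
`k`-th component of `v` survives alternation. The same sign occurs in `extDeriv`, and the two cancel
in the divergence formula. -/
theorem form_vecCons_removeNth {m : ℕ} (θ : Euc (m + 1) [⋀^Fin (m + 1)]→L[ℝ] ℝ) (k : Fin (m + 1))
    (v : Euc (m + 1)) : θ (Matrix.vecCons v fun j => stdVec (k.succAbove j)) =
      (-1) ^ (k : ℕ) * (v k * θ fun i => stdVec i) := by
  have h := θ.toAlternatingMap.neg_one_pow_smul_map_insertNth k v fun j => stdVec (k.succAbove j)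
  have h1 : Fin.insertNth (α := fun _ => Euc (m + 1)) k v (fun j => stdVec (k.succAbove j)) =
      Function.update (fun i => stdVec i) k v :=
    Fin.insertNth_removeNth k v (fun i : Fin (m + 1) => (stdVec i : Euc (m + 1)))
  rw [h1] at h
  refine h.symm.trans ?_
  have h2 := form_update_stdVec θ k v
  rw [← h2, zsmul_eq_mul]
  push_cast
  rfl

theorem form_eq_zero_of_lt {n k : ℕ} (h : n < k) (θ : Euc n [⋀^Fin k]→L[ℝ] ℝ) : θ = 0 := by
  ext v
  rw [form_apply_eq_sum]
  refine Finset.sum_eq_zero fun r _ => ?_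
  rw [θ.map_eq_zero_of_not_injective, mul_zero]
  intro hr
  have hr' : Function.Injective r := fun a b hab => hr (congrArg stdVec hab)
  have := Fintype.card_le_of_injective r hr'
  simp at this
  omega

variable {n : ℕ} {M : Type*} [TopologicalSpace M] [ChartedSpace (EuclideanSpace ℝ (Fin n)) M]

/-- The component of a form of top degree in the preferred chart at `x₀`. -/
def topRep (θ : ∀ x : M, FormAt n n x) (x₀ : M) (u : Euc n) : ℝ :=
  chartRep θ x₀ u fun i => stdVec i

variable [IsManifold (𝓡 n) ∞ M]

theorem chartRep_interior {k : ℕ} (V : ∀ y : M, Tan n y) (θ : ∀ x : M, FormAt n (k + 1) x)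
    {x₀ : M} {u : Euc n} (hu : u ∈ (extChartAt (𝓡 n) x₀).target) (w : Fin k → Euc n) :
    chartRep (fun y => interior (V y) (θ y)) x₀ u w =
      chartRep θ x₀ u (Matrix.vecCons (vecRep V x₀ u) w) := by
  rw [chartRep_apply, chartRep_apply, interior_apply]
  congr 1
  funext i
  refine Fin.cases ?_ (fun j => ?_) i
  · exact (dsymm_dchart hu _).symm
  · rfl

theorem contDiffAt_chartRep_interior {k : ℕ} {V : ∀ y : M, Tan n y}
    {θ : ∀ x : M, FormAt n (k + 1) x} {x₀ : M} {u : Euc n}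
    (hu : u ∈ (extChartAt (𝓡 n) x₀).target) (hθ : ContDiffAt ℝ ∞ (chartRep θ x₀) u)
    (hV : ContDiffAt ℝ ∞ (vecRep V x₀) u) :
    ContDiffAt ℝ ∞ (chartRep (fun y => interior (V y) (θ y)) x₀) u := by
  refine contDiffAt_form fun r => ?_
  have h : ContDiffAt ℝ ∞ (fun w => chartRep θ x₀ w
      (fun i => (Matrix.vecCons (vecRep V x₀) (fun i _ => stdVec (r i)) :
        Fin (k + 1) → Euc n → Euc n) i w)) u :=
    hθ.form_apply fun i => by
      refine Fin.cases ?_ (fun j => ?_) i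
      · exact hV
      · exact contDiffAt_const
  refine h.congr_of_eventuallyEq ?_
  filter_upwards [(isOpen_extChartAt_target x₀).mem_nhds hu] with w hw
  rw [chartRep_interior V θ hw]
  congr 1
  funext i
  refine Fin.cases ?_ (fun j => ?_) i <;> rfl

/-- In top degree `i_V dθ` vanishes, so Cartan's formula reduces to `d (i_V θ)`, which is the
divergence of `V` times the component of `θ`. -/
theorem topRep_lieDeriv {V : ∀ y : M, Tan n y} {θ : ∀ x : M, FormAt n n x} {x₀ : M} {u : Euc n}
    (hu : u ∈ (extChartAt (𝓡 n) x₀).target) (hθ : ContDiffAt ℝ ∞ (chartRep θ x₀) u)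
    (hV : ContDiffAt ℝ ∞ (vecRep V x₀) u) :
    topRep (lieDeriv V θ) x₀ u = ∑ k, (vecRep V x₀ u k * pd k (topRep θ x₀) u +
      pd k (fun w => vecRep V x₀ w k) u * topRep θ x₀ u) := by
  rcases n with _ | m
  -- In dimension zero `lieDeriv` consists of `i_V d` alone, and both sides are zero.
  · rw [Finset.univ_eq_empty, Finset.sum_empty]
    have h1 : topRep (lieDeriv V θ) x₀ u = chartRep (fun y => interior (V y) (extD θ y)) x₀ u
      fun i => stdVec i := rfl
    rw [h1, chartRep_interior V (extD θ) hu, chartRep_extD hu hθ,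
      form_eq_zero_of_lt (by omega) (extDeriv _ _)]
    rfl
  · have h1 : topRep (lieDeriv V θ) x₀ u =
        chartRep (fun y => interior (V y) (extD θ y)) x₀ u (fun i => stdVec i) +
        chartRep (extD fun y => interior (V y) (θ y)) x₀ u (fun i => stdVec i) := rfl
    rw [h1, chartRep_interior V (extD θ) hu, chartRep_extD hu hθ,
      form_eq_zero_of_lt (by omega) (extDeriv _ _), ContinuousAlternatingMap.coe_zero,
      Pi.zero_apply, zero_add]
    have hi := contDiffAt_chartRep_interior hu hθ hV
    have h2 := extDeriv_stdVec hi.differentiableAt_infty fun i => i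
    rw [chartRep_extD hu hi, h2]
    refine Finset.sum_congr rfl fun k _ => ?_
    have h3 : (fun w => chartRep (fun y => interior (V y) (θ y)) x₀ w
        fun j => stdVec (k.succAbove j)) =ᶠ[𝓝 u]
        fun w => (-1) ^ (k : ℕ) * (vecRep V x₀ w k * topRep θ x₀ w) := by
      filter_upwards [(isOpen_extChartAt_target x₀).mem_nhds hu] with w hw
      rw [chartRep_interior V θ hw, form_vecCons_removeNth]
      rfl
    have hVk := (hV.euc_coord k).differentiableAt_infty
    have hr : DifferentiableAt ℝ (topRep θ x₀) u := (hθ.form_apply_const _).differentiableAt_infty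
    rw [pd_congr h3, pd_const_mul _ (hVk.fun_mul hr), pd_mul hVk hr, ← mul_assoc, ← mul_pow]
    simp

theorem extD_ofCovector {β : ∀ y : M, Cotan n y} {x₀ : M} {u : Euc n}
    (hu : u ∈ (extChartAt (𝓡 n) x₀).target) (hβ : ∀ k, ContDiffAt ℝ ∞ (covRep β x₀ k) u)
    (w : Fin 2 → Euc n) :
    chartRep (extD fun y => ofCovector (β y)) x₀ u w =
      ∑ a, ∑ b, w 0 a * w 1 b * (pd a (covRep β x₀ b) u - pd b (covRep β x₀ a) u) := by
  have hθ : ContDiffAt ℝ ∞ (chartRep (fun y => ofCovector (β y)) x₀) u :=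
    contDiffAt_form fun r => hβ (r 0)
  rw [chartRep_extD hu hθ, form_apply_eq_sum]
  have h : ∀ r : Fin 2 → Fin n, extDeriv (chartRep (fun y => ofCovector (β y)) x₀) u
      (fun i => stdVec (r i)) =
        pd (r 0) (covRep β x₀ (r 1)) u - pd (r 1) (covRep β x₀ (r 0)) u := by
    intro r
    rw [extDeriv_stdVec hθ.differentiableAt_infty, Fin.sum_univ_two]
    simp only [Fin.val_zero, pow_zero, one_mul, Fin.val_one, pow_one, neg_one_mul,
      ← sub_eq_add_neg]
    rfl
  simp only [h]
  rw [← Fintype.sum_prod_type' (f := fun a b => w 0 a * w 1 b *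
    (pd a (covRep β x₀ b) u - pd b (covRep β x₀ a) u))]
  exact Fintype.sum_equiv (finTwoArrowEquiv (Fin n)) _ _ fun r => by
    rw [Fin.prod_univ_two]
    rfl

theorem pairing_eq_sum (β : ∀ y : M, Cotan n y) (V : ∀ y : M, Tan n y) {x₀ : M} {u : Euc n}
    (hu : u ∈ (extChartAt (𝓡 n) x₀).target) :
    funRep n (fun y => β y (V y)) x₀ u = ∑ a, covRep β x₀ a u * vecRep V x₀ u a := by
  have h := sum_coordVec ((extChartAt (𝓡 n) x₀).map_target hu)
    (V ((extChartAt (𝓡 n) x₀).symm u))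
  rw [funRep]
  conv_lhs => rw [← h, map_sum]
  refine Finset.sum_congr rfl fun a _ => ?_
  rw [map_smul, coordVec_symm hu, smul_eq_mul, mul_comm]
  rfl

theorem covRep_lieDerivOne {V : ∀ y : M, Tan n y} {β : ∀ y : M, Cotan n y} {x₀ : M} {u : Euc n}
    (hu : u ∈ (extChartAt (𝓡 n) x₀).target) (hβ : ∀ k, ContDiffAt ℝ ∞ (covRep β x₀ k) u)
    (hV : ContDiffAt ℝ ∞ (vecRep V x₀) u) (k : Fin n) :
    covRep (lieDerivOne V β) x₀ k u = ∑ a, (vecRep V x₀ u a * pd a (covRep β x₀ k) u +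
      covRep β x₀ a u * pd k (fun w => vecRep V x₀ w a) u) := by
  have hθ : ContDiffAt ℝ ∞ (chartRep (fun y => ofCovector (β y)) x₀) u :=
    contDiffAt_form fun r => hβ (r 0)
  have h1 : covRep (lieDerivOne V β) x₀ k u =
      chartRep (fun y => interior (V y) (extD (fun z => ofCovector (β z)) y)) x₀ u
        (fun _ => stdVec k) +
      chartRep (extD fun y => interior (V y) (ofCovector (β y))) x₀ u (fun _ => stdVec k) := rfl
  have hi := contDiffAt_chartRep_interior hu hθ hV
  have h2 := extDeriv_stdVec hi.differentiableAt_infty fun _ => k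
  rw [Fin.sum_univ_one] at h2
  rw [h1, chartRep_interior V _ hu, extD_ofCovector hu hβ, chartRep_extD hu hi, h2]
  have h3 : (fun w => chartRep (fun y => interior (V y) (ofCovector (β y))) x₀ w
      fun _ : Fin 0 => stdVec k) =ᶠ[𝓝 u] fun w => ∑ a, covRep β x₀ a w * vecRep V x₀ w a := by
    filter_upwards [(isOpen_extChartAt_target x₀).mem_nhds hu] with w hw
    rw [← pairing_eq_sum β V hw]
    rfl
  have hVa := fun a => (hV.euc_coord a).differentiableAt_infty
  have hβa := fun a => (hβ a).differentiableAt_infty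
  have h6 : pd k (fun w => ∑ a, covRep β x₀ a w * vecRep V x₀ w a) u =
      ∑ a, pd k (fun w => covRep β x₀ a w * vecRep V x₀ w a) u :=
    pd_sum (fun a => (hβa a).fun_mul (hVa a)) k
  rw [pd_congr h3, h6]
  simp only [fun a => pd_mul (hβa a) (hVa a) k]
  have h4 : ∀ a, ∑ b, (vecRep V x₀ u a * (stdVec k : Euc n) b) *
      (pd a (covRep β x₀ b) u - pd b (covRep β x₀ a) u) =
      vecRep V x₀ u a * (pd a (covRep β x₀ k) u - pd k (covRep β x₀ a) u) := by
    intro a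
    rw [Finset.sum_eq_single k]
    · simp [stdVec]
    · intro b _ hb
      simp [stdVec, hb]
    · exact fun h => absurd (Finset.mem_univ k) h
  have h5 : ∀ a b : Fin n, (Matrix.vecCons (vecRep V x₀ u) (fun _ : Fin 1 => stdVec k) :
      Fin 2 → Euc n) 0 a * (Matrix.vecCons (vecRep V x₀ u) (fun _ : Fin 1 => stdVec k) :
      Fin 2 → Euc n) 1 b = vecRep V x₀ u a * (stdVec k : Euc n) b := fun a b => rfl
  simp only [h5, h4]
  simp only [Fin.val_zero, pow_zero, one_mul]
  rw [← Finset.sum_add_distrib]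
  exact Finset.sum_congr rfl fun a _ => by ring

end TwistedPoissonGeometry

end

noncomputable section

namespace TwistedPoissonGeometry

variable {n : ℕ} {M : Type*} [TopologicalSpace M] [ChartedSpace (EuclideanSpace ℝ (Fin n)) M]

/-! ### The Schouten bracket in components -/

theorem form_update_eq_sum {n k : ℕ} (θ : Euc n [⋀^Fin k]→L[ℝ] ℝ) (m : Fin k → Euc n) (i : Fin k)
    (v : Euc n) :
    θ (Function.update m i v) = ∑ a, v a * θ (Function.update m i (stdVec a)) := by
  conv_lhs => rw [← sum_smul_stdVec v]
  refine (θ.toMultilinearMap.map_update_sum Finset.univ i (fun j => v j • stdVec j) m).trans ?_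
  exact Finset.sum_congr rfl fun a _ => θ.toMultilinearMap.map_update_smul m i (v a) (stdVec a)

theorem form_three_eq_sum {n : ℕ} (θ : Euc n [⋀^Fin 3]→L[ℝ] ℝ) (v w z : Euc n) :
    θ ![v, w, z] = ∑ a, ∑ b, ∑ c, v a * w b * z c * θ ![stdVec a, stdVec b, stdVec c] := by
  have e0 : ∀ x y z : Euc n, Function.update ![0, y, z] 0 x = ![x, y, z] := fun x y z => by
    ext i : 1
    fin_cases i <;> rfl
  have e1 : ∀ x y z : Euc n, Function.update ![x, 0, z] 1 y = ![x, y, z] := fun x y z => by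
    ext i : 1
    fin_cases i <;> rfl
  have e2 : ∀ x y z : Euc n, Function.update ![x, y, 0] 2 z = ![x, y, z] := fun x y z => by
    ext i : 1
    fin_cases i <;> rfl
  rw [← e0, form_update_eq_sum]
  refine Finset.sum_congr rfl fun a _ => ?_
  rw [e0, ← e1, form_update_eq_sum, Finset.mul_sum]
  refine Finset.sum_congr rfl fun b _ => ?_
  rw [e1, ← e2, form_update_eq_sum, Finset.mul_sum, Finset.mul_sum]
  refine Finset.sum_congr rfl fun c _ => ?_
  rw [e2]
  ring

variable [IsManifold (𝓡 n) ∞ M]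

theorem dchart_mlieBracket {V W : ∀ y : M, Tan n y} {x : M}
    (k : Fin n)
    (hV : DifferentiableAt ℝ (vecRep V x) (extChartAt (𝓡 n) x x))
    (hW : DifferentiableAt ℝ (vecRep W x) (extChartAt (𝓡 n) x x)) :
    dchart x x (VectorField.mlieBracket (𝓡 n) V W x) k =
      ∑ c, (vecRep V x (extChartAt (𝓡 n) x x) c *
          pd c (fun u => vecRep W x u k) (extChartAt (𝓡 n) x x) -
        vecRep W x (extChartAt (𝓡 n) x x) c *
          pd c (fun u => vecRep V x u k) (extChartAt (𝓡 n) x x)) := by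
  have := isManifold_one (n := n) (M := M)
  have hx := mem_extChartAt_source (I := 𝓡 n) x
  have h1 : ∀ V : ∀ y : M, Tan n y, VectorField.mpullback 𝓘(ℝ, Euc n) (𝓡 n)
      (extChartAt (𝓡 n) x).symm V =ᶠ[𝓝 (extChartAt (𝓡 n) x x)] vecRep V x := by
    intro V
    filter_upwards [eventually_mem_target hx] with u hu
    have h : (dsymm x u).inverse = dchart x ((extChartAt (𝓡 n) x).symm u) :=
      ContinuousLinearMap.inverse_eq (ContinuousLinearMap.ext (dsymm_dchart hu))
        (ContinuousLinearMap.ext (dchart_dsymm hu))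
    exact congrArg (fun L => L (V ((extChartAt (𝓡 n) x).symm u))) h
  have h2 : VectorField.mlieBracket (𝓡 n) V W x =
      VectorField.lieBracket ℝ (vecRep V x) (vecRep W x) (extChartAt (𝓡 n) x x) := by
    have e1 : ∀ L : Euc n →L[ℝ] Euc n, (∀ v, L v = v) → ∀ v, L.inverse v = v := by
      intro L hL v
      rw [show L = ContinuousLinearMap.id ℝ (Euc n) from ContinuousLinearMap.ext hL,
        ContinuousLinearMap.inverse_id]
      rfl
    rw [← VectorField.mlieBracketWithin_univ, VectorField.mlieBracketWithin_apply]
    refine (e1 (dchart x x) (dchart_self x) _).trans ?_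
    simp only [Set.preimage_univ, Set.univ_inter, ModelWithCorners.range_eq_univ,
      VectorField.mpullbackWithin_univ]
    exact (congrFun (VectorField.lieBracketWithin_univ (𝕜 := ℝ)) _).trans <|
      (h1 V).lieBracket_vectorField_eq (h1 W)
  rw [dchart_self, h2, VectorField.lieBracket]
  have h3 : ∀ {W : Euc n → Euc n} {u v : Euc n}, DifferentiableAt ℝ W u →
      (fderiv ℝ W u v) k = fderiv ℝ (fun w => W w k) u v := by
    intro W u v hW
    have h := ((EuclideanSpace.proj k : Euc n →L[ℝ] ℝ).hasFDerivAt.comp u hW.hasFDerivAt).fderiv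
    exact (congrArg (fun L => L v) h).symm
  rw [PiLp.sub_apply, h3 hV, h3 hW, fderiv_eq_sum_pd, fderiv_eq_sum_pd, Finset.sum_sub_distrib]

end TwistedPoissonGeometry

end

/-! ### Trivector algebra and the Schouten square at the centre of a chart -/

noncomputable section

namespace TwistedPoissonGeometry

/-- The component of index `(i, j, k)` of the trivector `u ∧ v ∧ w`. -/
def trivec {n : ℕ} (u v w : Fin n → ℝ) (i j k : Fin n) : ℝ :=
  u i * v j * w k - u i * w j * v k - v i * u j * w k + v i * w j * u k + w i * u j * v k -
    w i * v j * u k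

theorem sum_trivec_single {n : ℕ} (u : Fin n → Fin n → ℝ) (w : Fin n → ℝ) (i j k : Fin n) :
    ∑ b, trivec (u b) w (fun l => (1 / 2 : ℝ) * if l = b then 1 else 0) i j k =
      (1 / 2 : ℝ) * (u k i * w j - u j i * w k - w i * u k j + w i * u j k + u i j * w k -
        w j * u i k) := by
  simp only [trivec, mul_ite, mul_one, mul_zero, ite_mul, zero_mul, Finset.sum_add_distrib,
    Finset.sum_sub_distrib, Finset.sum_ite_eq, Finset.mem_univ, if_true]
  ring

theorem sum_sum_trivec_single {n : ℕ} (u : Fin n → Fin n → Fin n → ℝ) (i j k : Fin n)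
    (hu : ∀ a b l, u b a l = - u a b l) :
    ∑ a, ∑ b, trivec (u a b) (fun l => (1 / 2 : ℝ) * if l = a then 1 else 0)
      (fun l => (1 / 2 : ℝ) * if l = b then 1 else 0) i j k =
      (1 / 2 : ℝ) * (u j k i + u k i j + u i j k) := by
  have h := fun a => sum_trivec_single (fun b => u a b)
    (fun l => (1 / 2 : ℝ) * if l = a then 1 else 0) i j k
  simp only [h]
  simp only [mul_ite, mul_one, mul_zero, ite_mul, zero_mul, mul_add, mul_sub,
    Finset.sum_add_distrib, Finset.sum_sub_distrib, Finset.sum_ite_eq, Finset.mem_univ, if_true]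
  linear_combination (-1 / 4 : ℝ) * hu j k i + (-1 / 4 : ℝ) * hu k i j + (-1 / 4 : ℝ) * hu i j k

/-- This is the sum defining `[π, π]` for the fields `½∂_a` and `π♯dx^a`, with `D c i j` standing
for `∂_c π^{ij}`. The brackets of the constant fields vanish, so three of the four kinds of terms
remain. Each Kronecker delta removes a summation, and antisymmetry of `π` collects the result into a
cyclic sum. -/
theorem schouten_contraction {n : ℕ} (p : Fin n → Fin n → ℝ) (D : Fin n → Fin n → Fin n → ℝ)
    (hp : ∀ i j, p j i = - p i j) (hD : ∀ c i j, D c j i = - D c i j) (i j k : Fin n) :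
    (1 / 2 : ℝ) * ∑ a, ∑ b,
      (- trivec (fun l => (1 / 2 : ℝ) * D a b l) (p a)
          (fun l => (1 / 2 : ℝ) * if l = b then 1 else 0) i j k
        - trivec (fun l => - ((1 / 2 : ℝ) * D b a l))
          (fun l => (1 / 2 : ℝ) * if l = a then 1 else 0) (p b) i j k
        + trivec (fun l => ∑ c, (p a c * D c b l - p b c * D c a l))
          (fun l => (1 / 2 : ℝ) * if l = a then 1 else 0)
          (fun l => (1 / 2 : ℝ) * if l = b then 1 else 0) i j k) =
      ∑ c, (p i c * D c j k + p j c * D c k i + p k c * D c i j) := by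
  rw [show ∀ F G H : Fin n → Fin n → ℝ, ∑ a, ∑ b, (- F a b - G a b + H a b) =
    - ∑ a, ∑ b, F a b - ∑ a, ∑ b, G b a + ∑ a, ∑ b, H a b from fun F G H => by
      rw [Finset.sum_comm (f := fun a b => G b a)]
      simp [Finset.sum_add_distrib, Finset.sum_sub_distrib]]
  -- After the dummy indices of the second sum are exchanged, this makes the two mixed terms `[½∂,
  -- π♯dx]` and `[π♯dx, ½∂]` equal.
  have hswap : ∀ (u v w : Fin n → ℝ), trivec (fun l => - u l) w v i j k = trivec u v w i j k := by
    intro u v w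
    simp only [trivec]
    ring
  simp only [hswap]
  rw [sum_sum_trivec_single (fun a b l => ∑ c, (p a c * D c b l - p b c * D c a l)) i j k
    (fun a b l => by rw [← Finset.sum_neg_distrib]; exact Finset.sum_congr rfl fun c _ => by ring)]
  have h := fun a => sum_trivec_single (fun b l => (1 / 2 : ℝ) * D a b l) (p a) i j k
  simp only [h]
  rw [← Finset.sum_add_distrib, ← Finset.sum_add_distrib, Finset.mul_sum, ← sub_eq_zero]
  rw [← Finset.sum_neg_distrib, ← Finset.sum_sub_distrib, ← Finset.sum_add_distrib, Finset.mul_sum,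
    ← Finset.sum_sub_distrib]
  refine Finset.sum_eq_zero fun c _ => ?_
  rw [hp i c, hp j c, hp k c, hD c i j, hD c j k, hD c k i]
  ring

variable {n : ℕ} {M : Type*} [TopologicalSpace M] [ChartedSpace (EuclideanSpace ℝ (Fin n)) M]

theorem funRep_extChartAt {x₀ y : M} (hy : y ∈ (extChartAt (𝓡 n) x₀).source) (f : M → ℝ) :
    funRep n f x₀ (extChartAt (𝓡 n) x₀ y) = f y :=
  congrArg f ((extChartAt (𝓡 n) x₀).left_inv hy)

theorem pair3_eq_trivec {x₀ x : M} (u v w : Tan n x) (i j k : Fin n) :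
    pair3 u v w (coordCovec x₀ i x) (coordCovec x₀ j x) (coordCovec x₀ k x) =
      trivec (dchart x₀ x u) (dchart x₀ x v) (dchart x₀ x w) i j k := by
  rw [pair3, Matrix.det_fin_three]
  rfl

namespace TwistedPoisson

variable (P : TwistedPoisson n M)

theorem π_swap {x : M} (α β : Cotan n x) : P.π x β α = - P.π x α β := by
  have h := P.π_alt x (α + β)
  simp only [map_add, LinearMap.add_apply, P.π_alt, zero_add, add_zero] at h
  linarith

/-- The components of the bivector field in the preferred chart at `x₀`. -/
def piRep (x₀ : M) (i j : Fin n) (u : Euc n) : ℝ :=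
  funRep n (fun z => P.π z (coordCovec x₀ i z) (coordCovec x₀ j z)) x₀ u

theorem piRep_swap (x₀ : M) (i j : Fin n) (u : Euc n) :
    P.piRep x₀ j i u = - P.piRep x₀ i j u :=
  P.π_swap _ _

theorem dchart_sharp (x₀ : M) {y : M} (α : Cotan n y) (k : Fin n) :
    dchart x₀ y (sharp (P.π y) α) k = P.π y α (coordCovec x₀ k y) :=
  apply_vectorOf (P.π y α) (coordCovec x₀ k y)

theorem apply_sharp {y : M} (α β : Cotan n y) : β (sharp (P.π y) α) = P.π y α β :=
  apply_vectorOf (P.π y α) β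

variable [IsManifold (𝓡 n) ∞ M]

theorem π_eq_sum {x₀ y : M} (hy : y ∈ (extChartAt (𝓡 n) x₀).source) (α β : Cotan n y) :
    P.π y α β = ∑ i, ∑ j, α (coordVec x₀ i y) * β (coordVec x₀ j y) *
      P.π y (coordCovec x₀ i y) (coordCovec x₀ j y) := by
  conv_lhs => rw [← sum_coordCovec hy α, ← sum_coordCovec hy β]
  simp only [map_sum, LinearMap.sum_apply, map_smul, LinearMap.smul_apply, smul_eq_mul]
  rw [Finset.sum_comm]
  refine Finset.sum_congr rfl fun i _ => ?_
  rw [Finset.mul_sum]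
  exact Finset.sum_congr rfl fun j _ => by ring

theorem contMDiffAt_π {α β : ∀ y : M, Cotan n y} {y : M} (hα : SmoothCovecAt α y)
    (hβ : SmoothCovecAt β y) :
    ContMDiffAt (𝓡 n) 𝓘(ℝ, ℝ) ∞ (fun z => P.π z (α z) (β z)) y := by
  have hy := mem_extChartAt_source (I := 𝓡 n) y
  have h : ContMDiffAt (𝓡 n) 𝓘(ℝ, ℝ) ∞ (fun z => ∑ i, ∑ j, α z (coordVec y i z) *
      β z (coordVec y j z) * P.π z (coordCovec y i z) (coordCovec y j z)) y :=
    ContMDiffAt.sum fun i _ => ContMDiffAt.sum fun j _ =>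
      ((hα.pairing (contMDiffAt_coordVec hy i)).mul
        (hβ.pairing (contMDiffAt_coordVec hy j))).mul (P.π_smooth y i j).self_of_nhds
  refine h.congr_of_eventuallyEq ?_
  filter_upwards [extChartAt_source_mem_nhds (I := 𝓡 n) y] with z hz
  exact P.π_eq_sum hz (α z) (β z)

theorem contDiffAt_piRep {x₀ : M} {u : Euc n} (hu : u ∈ (extChartAt (𝓡 n) x₀).target)
    (i j : Fin n) : ContDiffAt ℝ ∞ (P.piRep x₀ i j) u := by
  have hy := (extChartAt (𝓡 n) x₀).map_target hu
  have h := (contMDiffAt_iff_funRep hy).1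
    (P.contMDiffAt_π (contMDiffAt_coordCovec hy i) (contMDiffAt_coordCovec hy j))
  rwa [(extChartAt (𝓡 n) x₀).right_inv hu] at h

theorem vecRep_sharp {x₀ : M} {u : Euc n} (hu : u ∈ (extChartAt (𝓡 n) x₀).target)
    (α : ∀ y : M, Cotan n y) (k : Fin n) :
    vecRep (P.ham α) x₀ u k = ∑ i, covRep α x₀ i u * P.piRep x₀ i k u := by
  have hy := (extChartAt (𝓡 n) x₀).map_target hu
  have h : vecRep (P.ham α) x₀ u k = P.π ((extChartAt (𝓡 n) x₀).symm u)
    (α ((extChartAt (𝓡 n) x₀).symm u)) (coordCovec x₀ k ((extChartAt (𝓡 n) x₀).symm u)) :=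
    P.dchart_sharp x₀ _ k
  rw [h]
  conv_lhs => rw [← sum_coordCovec hy (α ((extChartAt (𝓡 n) x₀).symm u))]
  simp only [map_sum, LinearMap.sum_apply, map_smul, LinearMap.smul_apply, smul_eq_mul,
    coordVec_symm hu]
  rfl

omit [IsManifold (𝓡 n) ∞ M] in
theorem vecRep_ham_coordCovec {x₀ : M} (i k : Fin n) (u : Euc n) :
    vecRep (P.ham (coordCovec x₀ i)) x₀ u k = P.piRep x₀ i k u :=
  P.dchart_sharp x₀ _ k

theorem contDiffAt_vecRep_ham {α : ∀ y : M, Cotan n y} {x₀ : M} {u : Euc n}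
    (hu : u ∈ (extChartAt (𝓡 n) x₀).target) (hα : ∀ k, ContDiffAt ℝ ∞ (covRep α x₀ k) u) :
    ContDiffAt ℝ ∞ (vecRep (P.ham α) x₀) u := by
  rw [contDiffAt_euclidean]
  intro k
  have h : ContDiffAt ℝ ∞ (fun u => ∑ i, covRep α x₀ i u * P.piRep x₀ i k u) u :=
    ContDiffAt.sum fun i _ => (hα i).mul (P.contDiffAt_piRep hu i k)
  refine h.congr_of_eventuallyEq ?_
  filter_upwards [(isOpen_extChartAt_target x₀).mem_nhds hu] with w hw
  exact P.vecRep_sharp hw α k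

/-- Only the centre of the chart is covered, because `schoutenSq` at `x` is built from the frame of
the chart at `x`. Other points of a chart are reached in `schouten_chart`. -/
theorem schoutenSq_coordCovec (x : M) (i j k : Fin n) :
    (1 / 2 : ℝ) * schoutenSq P.π x (coordCovec x i x) (coordCovec x j x) (coordCovec x k x) =
      ∑ c, (P.piRep x i c (extChartAt (𝓡 n) x x) *
          pd c (P.piRep x j k) (extChartAt (𝓡 n) x x) +
        P.piRep x j c (extChartAt (𝓡 n) x x) * pd c (P.piRep x k i) (extChartAt (𝓡 n) x x) +
        P.piRep x k c (extChartAt (𝓡 n) x x) * pd c (P.piRep x i j) (extChartAt (𝓡 n) x x)) := by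
  have hx := mem_extChartAt_source (I := 𝓡 n) x
  have hu := mem_extChartAt_target (I := 𝓡 n) x
  set u := extChartAt (𝓡 n) x x
  rw [← schouten_contraction (fun a b => P.piRep x a b u) (fun c a b => pd c (P.piRep x a b) u)
    (fun a b => P.piRep_swap x a b u)
    (fun c a b => by
      rw [← pd_neg]
      exact pd_congr (Eventually.of_forall fun w => P.piRep_swap x a b w) c), schoutenSq,
    schoutenSqOf]
  simp only [pair3_eq_trivec]
  have hX : ∀ a, vecRep (fun y => (1 / 2 : ℝ) • coordVec x a y) x =ᶠ[𝓝 u]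
      fun _ => (1 / 2 : ℝ) • stdVec a := by
    intro a
    filter_upwards [eventually_mem_target hx] with w hw
    have h := dchart_coordVec (n := n) (x₀ := x) (y := (extChartAt (𝓡 n) x).symm w)
      ((extChartAt (𝓡 n) x).map_target hw) a
    rw [vecRep, map_smul, h]
  have hX1 : ∀ a, ContDiffAt ℝ ∞ (vecRep (fun y => (1 / 2 : ℝ) • coordVec x a y) x) u :=
    fun a => contDiffAt_const.congr_of_eventuallyEq (hX a)
  have hXv : ∀ a l, dchart x x ((1 / 2 : ℝ) • coordVec (n := n) x a x) l =
      (1 / 2 : ℝ) * if l = a then 1 else 0 := by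
    intro a l
    rw [map_smul, dchart_coordVec hx]
    simp [stdVec]
  have hXc : ∀ a l, vecRep (fun y => (1 / 2 : ℝ) • coordVec x a y) x u l =
      (1 / 2 : ℝ) * if l = a then 1 else 0 := by
    intro a l
    rw [(hX a).self_of_nhds]
    simp [stdVec]
  have hXd : ∀ a l c, pd c (fun w => vecRep (fun y => (1 / 2 : ℝ) • coordVec x a y) x w l) u
      = 0 := by
    intro a l c
    have h : (fun w => vecRep (fun y => (1 / 2 : ℝ) • coordVec x a y) x w l) =ᶠ[𝓝 u]
        fun _ => ((1 / 2 : ℝ) • stdVec a : Euc n) l := by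
      filter_upwards [hX a] with w hw
      rw [hw]
    rw [pd_congr h, pd_const]
  have hY : ∀ a w l, vecRep (fun y => sharp (P.π y) (coordCovec x a y)) x w l =
      P.piRep x a l w := fun a w l => P.vecRep_ham_coordCovec a l w
  have hY1 : ∀ a, ContDiffAt ℝ ∞ (vecRep (fun y => sharp (P.π y) (coordCovec x a y)) x) u := by
    intro a
    rw [contDiffAt_euclidean]
    intro l
    simp only [hY]
    exact P.contDiffAt_piRep hu a l
  have hYv : ∀ a l, dchart x x (sharp (P.π x) (coordCovec x a x)) l = P.piRep x a l u := by
    intro a l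
    exact (P.dchart_sharp x _ l).trans (funRep_extChartAt hx
      (fun z => P.π z (coordCovec x a z) (coordCovec x l z))).symm
  congr 1
  refine Finset.sum_congr rfl fun a _ => Finset.sum_congr rfl fun b _ => ?_
  have hXX : ∀ l, dchart x x (VectorField.mlieBracket (𝓡 n)
      (fun y => (1 / 2 : ℝ) • coordVec x a y) (fun y => (1 / 2 : ℝ) • coordVec x b y) x) l = 0 := by
    intro l
    rw [dchart_mlieBracket l (hX1 a).differentiableAt_infty (hX1 b).differentiableAt_infty]
    exact Finset.sum_eq_zero fun c _ => by rw [hXd, hXd]; ring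
  have hXY : ∀ a b l, dchart x x (VectorField.mlieBracket (𝓡 n)
      (fun y => (1 / 2 : ℝ) • coordVec x a y)
      (fun y => sharp (P.π y) (coordCovec x b y)) x) l =
        (1 / 2 : ℝ) * pd a (P.piRep x b l) u := by
    intro a b l
    rw [dchart_mlieBracket l (hX1 a).differentiableAt_infty (hY1 b).differentiableAt_infty]
    refine (Finset.sum_congr rfl fun c _ => ?_).trans (Finset.sum_ite_eq' Finset.univ a
      fun c => (1 / 2 : ℝ) * pd c (P.piRep x b l) u) |>.trans (by simp)
    have h1 := hXc a c
    have h2 := hXd a l c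
    have h3 : pd c (fun w => vecRep (fun y => sharp (P.π y) (coordCovec x b y)) x w l) u =
        pd c (P.piRep x b l) u := pd_congr (Eventually.of_forall fun w => hY b w l) c
    change vecRep (fun y => (1 / 2 : ℝ) • coordVec x a y) x u c *
        pd c (fun w => vecRep (fun y => sharp (P.π y) (coordCovec x b y)) x w l) u -
      vecRep (fun y => sharp (P.π y) (coordCovec x b y)) x u c *
        pd c (fun w => vecRep (fun y => (1 / 2 : ℝ) • coordVec x a y) x w l) u = _
    rw [h1, h2, h3]
    split_ifs <;> ring
  have hYX : ∀ l, dchart x x (VectorField.mlieBracket (𝓡 n)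
      (fun y => sharp (P.π y) (coordCovec x a y))
      (fun y => (1 / 2 : ℝ) • coordVec x b y) x) l = - ((1 / 2 : ℝ) * pd b (P.piRep x a l) u) := by
    intro l
    rw [VectorField.mlieBracket_swap_apply, map_neg, ← hXY]
    rfl
  have hYY : ∀ l, dchart x x (VectorField.mlieBracket (𝓡 n)
      (fun y => sharp (P.π y) (coordCovec x a y))
      (fun y => sharp (P.π y) (coordCovec x b y)) x) l =
        ∑ c, (P.piRep x a c u * pd c (P.piRep x b l) u -
          P.piRep x b c u * pd c (P.piRep x a l) u) := by
    intro l
    rw [dchart_mlieBracket l (hY1 a).differentiableAt_infty (hY1 b).differentiableAt_infty]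
    simp only [hY]
    rfl
  simp only [trivec, hXX, hXY, hYX, hYY, hXv, hYv]
  ring

end TwistedPoisson

end TwistedPoissonGeometry

end

/-! ### The contraction of `ψ` with `∧³π♯`, and the Jacobi identity for closed 1-forms -/

noncomputable section

namespace TwistedPoissonGeometry

/-- Antisymmetry of `f` makes the six terms of the determinant contribute equally, which cancels the
factor `1/6`. -/
theorem sum_trivec_of_antisymm {n : ℕ} (p : Fin n → Fin n → ℝ) (f : Fin n → Fin n → Fin n → ℝ)
    (h₁ : ∀ a b c, f b a c = - f a b c) (h₂ : ∀ a b c, f a c b = - f a b c) (i j k : Fin n) :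
    (1 / 6 : ℝ) * ∑ a, ∑ b, ∑ c, f a b c * trivec (p a) (p b) (p c) i j k =
      ∑ a, ∑ b, ∑ c, f a b c * (p a i * p b j * p c k) := by
  have key : ∀ F : Fin n → Fin n → Fin n → ℝ,
      ∑ a, ∑ b, ∑ c, (F a b c + F a c b + F b a c + F b c a + F c a b + F c b a) =
        6 * ∑ a, ∑ b, ∑ c, F a b c := by
    intro F
    simp only [Finset.sum_add_distrib]
    have e1 : ∑ a, ∑ b, ∑ c, F a c b = ∑ a, ∑ b, ∑ c, F a b c :=
      Finset.sum_congr rfl fun a _ => Finset.sum_comm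
    have e2 : ∑ a, ∑ b, ∑ c, F b a c = ∑ a, ∑ b, ∑ c, F a b c := Finset.sum_comm
    have e3 : ∑ a, ∑ b, ∑ c, F b c a = ∑ a, ∑ b, ∑ c, F a b c := by
      rw [Finset.sum_comm, ← e1]
    have e4 : ∑ a, ∑ b, ∑ c, F c a b = ∑ a, ∑ b, ∑ c, F a b c := by
      rw [← e2, ← Finset.sum_congr rfl fun a _ => Finset.sum_comm]
    have e5 : ∑ a, ∑ b, ∑ c, F c b a = ∑ a, ∑ b, ∑ c, F a b c := by
      rw [← e3, ← Finset.sum_congr rfl fun a _ => Finset.sum_comm]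
    rw [e1, e2, e3, e4, e5]
    ring
  have h := key fun a b c => f a b c * (p a i * p b j * p c k)
  have h' : ∑ a, ∑ b, ∑ c, f a b c * trivec (p a) (p b) (p c) i j k =
      6 * ∑ a, ∑ b, ∑ c, f a b c * (p a i * p b j * p c k) := by
    rw [← h]
    refine Finset.sum_congr rfl fun a _ => Finset.sum_congr rfl fun b _ =>
      Finset.sum_congr rfl fun c _ => ?_
    have e1 : f b c a = f a b c := by rw [h₂ b a c, h₁ a b c]; ring
    have e2 : f c a b = f a b c := by rw [h₁ a c b, h₂ a b c]; ring
    have e3 : f c b a = - f a b c := by rw [h₁ b c a, e1]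
    rw [h₁ a b c, h₂ a b c, e1, e2, e3, trivec]
    ring
  rw [h']
  ring

/-- The Jacobi identity for closed 1-forms, at a point and in components. -/
theorem jacobi_of_closed {n : ℕ} (p : Fin n → Fin n → ℝ) (D : Fin n → Fin n → Fin n → ℝ)
    (ψ : Fin n → Fin n → Fin n → ℝ) (hp : ∀ i j, p j i = - p i j)
    (hS : ∀ i j k, ∑ c, (p i c * D c j k + p j c * D c k i + p k c * D c i j) +
      ∑ a, ∑ b, ∑ c, p i a * p j b * p k c * ψ a b c = 0)
    (f : Fin 3 → Fin n → ℝ) (df : Fin 3 → Fin n → Fin n → ℝ) (hf : ∀ t a b, df t a b = df t b a) :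
    ∑ c, ((∑ i, f 0 i * p i c) * (∑ i, ∑ j, (df 1 c i * f 2 j * p i j + f 1 i * df 2 c j * p i j +
          f 1 i * f 2 j * D c i j)) +
        (∑ i, f 1 i * p i c) * (∑ i, ∑ j, (df 2 c i * f 0 j * p i j + f 2 i * df 0 c j * p i j +
          f 2 i * f 0 j * D c i j)) +
        (∑ i, f 2 i * p i c) * (∑ i, ∑ j, (df 0 c i * f 1 j * p i j + f 0 i * df 1 c j * p i j +
          f 0 i * f 1 j * D c i j))) +
      ∑ a, ∑ b, ∑ c, (∑ i, f 0 i * p i a) * (∑ i, f 1 i * p i b) * (∑ i, f 2 i * p i c) * ψ a b c =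
      0 := by
  set F : Fin 3 → Fin n → ℝ := fun t c => ∑ i, f t i * p i c with hF
  have hFt : ∀ t c, ∑ i, f t i * p i c = F t c := fun t c => rfl
  simp only [hFt]
  -- Where the derivative falls on a coefficient of a 1-form, the remaining contraction with `p` is
  -- a component of `π♯` of the other form; one of the two cases needs an exchange of the indices of
  -- `p`, hence the sign.
  have hsum : ∀ c s t, ∑ i, ∑ j, (df s c i * f t j * p i j + f s i * df t c j * p i j +
      f s i * f t j * D c i j) = - (∑ i, df s c i * F t i) + ∑ j, df t c j * F s j +
        ∑ i, ∑ j, f s i * f t j * D c i j := by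
    intro c s t
    simp only [Finset.sum_add_distrib]
    congr 1
    congr 1
    · rw [← Finset.sum_neg_distrib]
      refine Finset.sum_congr rfl fun i _ => ?_
      simp only [hF, Finset.mul_sum, ← Finset.sum_neg_distrib]
      refine Finset.sum_congr rfl fun j _ => ?_
      rw [hp j i]
      ring
    · rw [Finset.sum_comm]
      refine Finset.sum_congr rfl fun i _ => ?_
      simp only [hF, Finset.mul_sum]
      exact Finset.sum_congr rfl fun j _ => by ring
  simp only [hsum]
  -- Closedness enters here: the symmetry of `df r` makes the terms with derivatives of the 1-forms
  -- cancel in pairs across the cyclic sum.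
  have hsym : ∀ s t r, ∑ c, F s c * ∑ i, df r c i * F t i = ∑ c, F t c * ∑ i, df r c i * F s i := by
    intro s t r
    simp only [Finset.mul_sum]
    rw [Finset.sum_comm]
    refine Finset.sum_congr rfl fun i _ => Finset.sum_congr rfl fun c _ => ?_
    rw [hf r c i]
    ring
  have hD : ∀ r s t, ∑ c, F r c * ∑ i, ∑ j, f s i * f t j * D c i j =
      ∑ k, ∑ i, ∑ j, f r k * f s i * f t j * ∑ c, p k c * D c i j := by
    intro r s t
    simp only [hF, Finset.sum_mul, Finset.mul_sum]
    simp only [← Fintype.sum_prod_type']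
    let e : Fin n × Fin n × Fin n × Fin n → Fin n × Fin n × Fin n × Fin n :=
      fun z => (z.2.2.2, z.2.1, z.2.2.1, z.1)
    refine Fintype.sum_equiv (⟨e, e, fun _ => rfl, fun _ => rfl⟩ : _ ≃ _) _ _ fun z => ?_
    simp only [Equiv.coe_fn_mk, e]
    ring
  have hψ : ∑ a, ∑ b, ∑ c, F 0 a * F 1 b * F 2 c * ψ a b c =
      ∑ i, ∑ j, ∑ k, f 0 i * f 1 j * f 2 k *
        ∑ a, ∑ b, ∑ c, p i a * p j b * p k c * ψ a b c := by
    have e : ∀ a b c, F 0 a * F 1 b * F 2 c * ψ a b c =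
        ∑ i, ∑ j, ∑ k, f 0 i * f 1 j * f 2 k * (p i a * p j b * p k c * ψ a b c) := by
      intro a b c
      rw [hF]
      dsimp only
      rw [Finset.sum_mul_sum]
      simp_rw [Finset.sum_mul (Finset.univ : Finset (Fin n))]
      refine Finset.sum_congr rfl fun i _ => Finset.sum_congr rfl fun j _ => ?_
      rw [Finset.mul_sum, Finset.sum_mul]
      exact Finset.sum_congr rfl fun k _ => by ring
    simp only [e, Finset.mul_sum]
    simp only [← Fintype.sum_prod_type']
    let s : Fin n × Fin n × Fin n × Fin n × Fin n × Fin n →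
        Fin n × Fin n × Fin n × Fin n × Fin n × Fin n :=
      fun z => (z.2.2.2.1, z.2.2.2.2.1, z.2.2.2.2.2, z.1, z.2.1, z.2.2.1)
    exact Fintype.sum_equiv (⟨s, s, fun _ => rfl, fun _ => rfl⟩ : _ ≃ _) _ _ fun z => rfl
  have hcyc1 : ∑ k, ∑ i, ∑ j, f 1 k * f 2 i * f 0 j * ∑ c, p k c * D c i j =
      ∑ i, ∑ j, ∑ k, f 0 i * f 1 j * f 2 k * ∑ c, p j c * D c k i := by
    rw [Finset.sum_congr rfl fun k _ => Finset.sum_comm, Finset.sum_comm]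
    exact Finset.sum_congr rfl fun i _ => Finset.sum_congr rfl fun j _ =>
      Finset.sum_congr rfl fun k _ => by ring
  have hcyc2 : ∑ k, ∑ i, ∑ j, f 2 k * f 0 i * f 1 j * ∑ c, p k c * D c i j =
      ∑ i, ∑ j, ∑ k, f 0 i * f 1 j * f 2 k * ∑ c, p k c * D c i j := by
    rw [Finset.sum_comm]
    refine Finset.sum_congr rfl fun i _ => ?_
    rw [Finset.sum_comm]
    exact Finset.sum_congr rfl fun j _ => Finset.sum_congr rfl fun k _ => by ring
  have hfin : ∑ i, ∑ j, ∑ k, f 0 i * f 1 j * f 2 k * (∑ c, (p i c * D c j k + p j c * D c k i +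
      p k c * D c i j) + ∑ a, ∑ b, ∑ c, p i a * p j b * p k c * ψ a b c) = 0 := by
    simp only [hS, mul_zero, Finset.sum_const_zero]
  simp only [Finset.sum_add_distrib, mul_add] at hfin
  simp only [mul_add, mul_neg, Finset.sum_add_distrib, Finset.sum_neg_distrib]
  rw [hsym 0 2 1, hsym 0 1 2, hsym 1 2 0, hD 0 1 2, hD 1 2 0, hD 2 0 1, hcyc1, hcyc2, hψ]
  linarith

end TwistedPoissonGeometry

end

/-! ### The twisted Poisson condition in components at the centre of a chart -/

noncomputable section

namespace TwistedPoissonGeometry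

theorem form_three_swap_left {n : ℕ} (θ : Euc n [⋀^Fin 3]→L[ℝ] ℝ) (v w z : Euc n) :
    θ ![w, v, z] = - θ ![v, w, z] := by
  have h := θ.toAlternatingMap.map_swap ![v, w, z] (show (0 : Fin 3) ≠ 1 by decide)
  have e : ![v, w, z] ∘ Equiv.swap (0 : Fin 3) 1 = ![w, v, z] := by
    ext i
    fin_cases i <;> rfl
  rw [e] at h
  exact h

theorem form_three_swap_right {n : ℕ} (θ : Euc n [⋀^Fin 3]→L[ℝ] ℝ) (v w z : Euc n) :
    θ ![v, z, w] = - θ ![v, w, z] := by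
  have h := θ.toAlternatingMap.map_swap ![v, w, z] (show (1 : Fin 3) ≠ 2 by decide)
  have e : ![v, w, z] ∘ Equiv.swap (1 : Fin 3) 2 = ![v, z, w] := by
    ext i
    fin_cases i <;> rfl
  rw [e] at h
  exact h

variable {n : ℕ} {M : Type*} [TopologicalSpace M] [ChartedSpace (EuclideanSpace ℝ (Fin n)) M]

theorem exists_mem_target {x₀ y : M} (hy : y ∈ (extChartAt (𝓡 n) x₀).source) :
    ∃ u ∈ (extChartAt (𝓡 n) x₀).target, (extChartAt (𝓡 n) x₀).symm u = y :=
  ⟨_, (extChartAt (𝓡 n) x₀).map_source hy, (extChartAt (𝓡 n) x₀).left_inv hy⟩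

namespace TwistedPoisson

variable (P : TwistedPoisson n M)

/-- The components of the 3-form in the preferred chart at `x₀`. -/
def psiRep (x₀ : M) (a b c : Fin n) (u : Euc n) : ℝ :=
  chartRep P.ψ x₀ u ![stdVec a, stdVec b, stdVec c]

theorem psiRep_swap_left (x₀ : M) (a b c : Fin n) (u : Euc n) :
    P.psiRep x₀ b a c u = - P.psiRep x₀ a b c u :=
  form_three_swap_left _ _ _ _

theorem psiRep_swap_right (x₀ : M) (a b c : Fin n) (u : Euc n) :
    P.psiRep x₀ a c b u = - P.psiRep x₀ a b c u :=
  form_three_swap_right _ _ _ _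

variable [IsManifold (𝓡 n) ∞ M]

theorem ψ_apply {x₀ y : M} (hy : y ∈ (extChartAt (𝓡 n) x₀).source) (v w z : Tan n y) :
    P.ψ y ![v, w, z] = ∑ a, ∑ b, ∑ c, dchart x₀ y v a * dchart x₀ y w b * dchart x₀ y z c *
      P.psiRep x₀ a b c (extChartAt (𝓡 n) x₀ y) := by
  rw [← chartRep_dchart P.ψ hy ![v, w, z],
    show (fun i => dchart x₀ y (![v, w, z] i)) = ![dchart x₀ y v, dchart x₀ y w, dchart x₀ y z] from
      funext fun i => by fin_cases i <;> rfl, form_three_eq_sum]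
  rfl

theorem contDiffAt_psiRep {x₀ : M} {u : Euc n} (hu : u ∈ (extChartAt (𝓡 n) x₀).target)
    (a b c : Fin n) : ContDiffAt ℝ ∞ (P.psiRep x₀ a b c) u := by
  have h := ((P.ψ_smooth _).eventually_chartRep
    ((extChartAt (𝓡 n) x₀).map_target hu)).self_of_nhds
  rw [(extChartAt (𝓡 n) x₀).right_inv hu] at h
  exact h.form_apply_const _

omit [IsManifold (𝓡 n) ∞ M] in
theorem piRep_extChartAt {x₀ y : M} (hy : y ∈ (extChartAt (𝓡 n) x₀).source) (i j : Fin n) :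
    P.piRep x₀ i j (extChartAt (𝓡 n) x₀ y) = P.π y (coordCovec x₀ i y) (coordCovec x₀ j y) :=
  funRep_extChartAt hy (fun z => P.π z (coordCovec x₀ i z) (coordCovec x₀ j z))

/-- The components of `π♯dx^a` are `π^{ai}`. Writing all three factors as `π^{ia}` costs `(-1)³`, so
the `ψ` term has a plus sign in `schouten_self`. -/
theorem sharp3_coordCovec (x : M) (i j k : Fin n) :
    sharp3 (P.π x) (P.ψ x) (coordCovec x i x) (coordCovec x j x) (coordCovec x k x) =
      - ∑ a, ∑ b, ∑ c, P.piRep x i a (extChartAt (𝓡 n) x x) *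
        P.piRep x j b (extChartAt (𝓡 n) x x) * P.piRep x k c (extChartAt (𝓡 n) x x) *
        P.psiRep x a b c (extChartAt (𝓡 n) x x) := by
  have hx := mem_extChartAt_source (I := 𝓡 n) x
  set u := extChartAt (𝓡 n) x x with hu
  have hψ : ∀ a b c, P.ψ x ![coordVec x a x, coordVec x b x, coordVec x c x] =
      P.psiRep x a b c u := by
    intro a b c
    rw [← chartRep_dchart P.ψ hx]
    have : (fun i => dchart x x (![coordVec x a x, coordVec x b x, coordVec x c x] i)) =
        ![stdVec a, stdVec b, stdVec c] :=
      funext fun i => by fin_cases i <;> exact dchart_coordVec hx _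
    rw [this]
    rfl
  have hv : ∀ a, (fun l => dchart x x (sharp (P.π x) (coordCovec x a x)) l) =
      fun l => P.piRep x a l u := by
    intro a
    funext l
    rw [P.dchart_sharp, hu, P.piRep_extChartAt hx]
  have hv' : ∀ a, (dchart x x (sharp (P.π x) (coordCovec x a x))).ofLp =
      fun l => P.piRep x a l u := hv
  rw [sharp3]
  simp only [pair3_eq_trivec, hψ, hv']
  refine (sum_trivec_of_antisymm (fun a l => P.piRep x a l u)
    (fun a b c => P.psiRep x a b c u) (fun a b c => P.psiRep_swap_left x a b c u)
    (fun a b c => P.psiRep_swap_right x a b c u) i j k).trans ?_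
  simp only [← Finset.sum_neg_distrib]
  refine Finset.sum_congr rfl fun a _ => Finset.sum_congr rfl fun b _ =>
      Finset.sum_congr rfl fun c _ => ?_
  rw [P.piRep_swap x i a, P.piRep_swap x j b, P.piRep_swap x k c]
  ring

theorem schouten_self (x : M) (i j k : Fin n) :
    ∑ c, (P.piRep x i c (extChartAt (𝓡 n) x x) *
          pd c (P.piRep x j k) (extChartAt (𝓡 n) x x) +
        P.piRep x j c (extChartAt (𝓡 n) x x) * pd c (P.piRep x k i) (extChartAt (𝓡 n) x x) +
        P.piRep x k c (extChartAt (𝓡 n) x x) * pd c (P.piRep x i j) (extChartAt (𝓡 n) x x)) +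
      ∑ a, ∑ b, ∑ c, P.piRep x i a (extChartAt (𝓡 n) x x) *
        P.piRep x j b (extChartAt (𝓡 n) x x) * P.piRep x k c (extChartAt (𝓡 n) x x) *
        P.psiRep x a b c (extChartAt (𝓡 n) x x) = 0 := by
  rw [← P.schoutenSq_coordCovec, P.schouten, P.sharp3_coordCovec]
  ring

theorem covRep_coordCovec {x₀ y : M} {w : Euc n} (hw : w ∈ (extChartAt (𝓡 n) y).target)
    (h : (extChartAt (𝓡 n) y).symm w ∈ (extChartAt (𝓡 n) x₀).source)
    (hd : DifferentiableAt ℝ (coordChange y x₀) w) (i b : Fin n) :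
    covRep (coordCovec x₀ i) y b w = pd b (fun v => coordChange y x₀ v i) w := by
  have h1 : pd b (fun v => coordChange y x₀ v i) w = fderiv ℝ (coordChange y x₀) w (stdVec b) i := by
    have := ((EuclideanSpace.proj i : Euc n →L[ℝ] ℝ).hasFDerivAt.comp w hd.hasFDerivAt).fderiv
    exact congrArg (fun L => L (stdVec b)) this
  rw [h1, fderiv_coordChange hw h]
  rfl

/-- In another chart the components of a coordinate differential are partial derivatives of the
coordinate change, so closedness is the symmetry of second derivatives. -/
theorem pd_covRep_coordCovec {x₀ y : M} (hy : y ∈ (extChartAt (𝓡 n) x₀).source) (i a b : Fin n) :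
    pd a (covRep (coordCovec x₀ i) y b) (extChartAt (𝓡 n) y y) =
      pd b (covRep (coordCovec x₀ i) y a) (extChartAt (𝓡 n) y y) := by
  have hyy := mem_extChartAt_source (I := 𝓡 n) y
  have hs := contDiffAt_coordChange hyy hy
  have h : ∀ b, covRep (coordCovec x₀ i) y b =ᶠ[𝓝 (extChartAt (𝓡 n) y y)]
      pd b (fun v => coordChange y x₀ v i) := by
    intro b
    filter_upwards [eventually_mem_target hyy, eventually_symm_mem_source hyy hy,
      (hs.of_le (m := 1) (by simp)).eventually (by simp)] with w hw hw' hd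
    exact covRep_coordCovec hw hw' (hd.differentiableAt (by simp)) i b
  rw [pd_congr (h b), pd_congr (h a), pd_comm (hs.euc_coord i)]

end TwistedPoisson

end TwistedPoissonGeometry

end

/-! ### The twisted Jacobi identity at every point of a chart -/

noncomputable section

namespace TwistedPoissonGeometry

theorem pd_mul_mul {n : ℕ} {f g h : Euc n → ℝ} {u : Euc n} (hf : DifferentiableAt ℝ f u)
    (hg : DifferentiableAt ℝ g u) (hh : DifferentiableAt ℝ h u) (k : Fin n) :
    pd k (fun v => f v * g v * h v) u =
      pd k f u * g u * h u + f u * pd k g u * h u + f u * g u * pd k h u := by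
  rw [pd_mul (f := fun v => f v * g v) (hf.fun_mul hg) hh, pd_mul hf hg]
  ring

theorem pd_sum_sum {n : ℕ} {ι κ : Type*} [Fintype ι] [Fintype κ] {f : ι → κ → Euc n → ℝ}
    {u : Euc n} (hf : ∀ i j, DifferentiableAt ℝ (f i j) u) (k : Fin n) :
    pd k (fun v => ∑ i, ∑ j, f i j v) u = ∑ i, ∑ j, pd k (f i j) u := by
  rw [pd_sum fun i => DifferentiableAt.fun_sum fun j _ => hf i j]
  exact Finset.sum_congr rfl fun i _ => pd_sum (hf i) k

variable {n : ℕ} {M : Type*} [TopologicalSpace M] [ChartedSpace (EuclideanSpace ℝ (Fin n)) M]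
  [IsManifold (𝓡 n) ∞ M]
namespace TwistedPoisson

variable (P : TwistedPoisson n M)

theorem funRep_π_eq_sum {x₀ : M} {u : Euc n} (hu : u ∈ (extChartAt (𝓡 n) x₀).target)
    (α β : ∀ y : M, Cotan n y) :
    funRep n (fun z => P.π z (α z) (β z)) x₀ u =
      ∑ i, ∑ j, covRep α x₀ i u * covRep β x₀ j u * P.piRep x₀ i j u := by
  have h := P.π_eq_sum ((extChartAt (𝓡 n) x₀).map_target hu)
    (α ((extChartAt (𝓡 n) x₀).symm u)) (β ((extChartAt (𝓡 n) x₀).symm u))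
  simp only [coordVec_symm hu] at h
  exact h

theorem dFun_π_ham {x₀ y : M} (hy : y ∈ (extChartAt (𝓡 n) x₀).source)
    {α β γ : ∀ y : M, Cotan n y} (hβ : SmoothCovecAt β y) (hγ : SmoothCovecAt γ y) :
    dFun (fun z => P.π z (β z) (γ z)) y (P.ham α y) =
      ∑ c, (∑ i, covRep α x₀ i (extChartAt (𝓡 n) x₀ y) * P.piRep x₀ i c (extChartAt (𝓡 n) x₀ y)) *
        ∑ i, ∑ j, (pd c (covRep β x₀ i) (extChartAt (𝓡 n) x₀ y) *
              covRep γ x₀ j (extChartAt (𝓡 n) x₀ y) * P.piRep x₀ i j (extChartAt (𝓡 n) x₀ y) +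
            covRep β x₀ i (extChartAt (𝓡 n) x₀ y) *
              pd c (covRep γ x₀ j) (extChartAt (𝓡 n) x₀ y) *
              P.piRep x₀ i j (extChartAt (𝓡 n) x₀ y) +
            covRep β x₀ i (extChartAt (𝓡 n) x₀ y) * covRep γ x₀ j (extChartAt (𝓡 n) x₀ y) *
              pd c (P.piRep x₀ i j) (extChartAt (𝓡 n) x₀ y)) := by
  rw [dFun_eq_sum hy ((P.contMDiffAt_π hβ hγ).mdifferentiableAt (by simp))]
  have hb := fun i => (hβ.contDiffAt_covRep hy i).differentiableAt_infty
  have hg := fun i => (hγ.contDiffAt_covRep hy i).differentiableAt_infty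
  have hu := (extChartAt (𝓡 n) x₀).map_source hy
  have hp := fun i j => (P.contDiffAt_piRep hu i j).differentiableAt_infty
  refine Finset.sum_congr rfl fun c _ => ?_
  congr 1
  · rw [← P.vecRep_sharp hu, vecRep, (extChartAt (𝓡 n) x₀).left_inv hy]
  · have h : funRep n (fun z => P.π z (β z) (γ z)) x₀ =ᶠ[𝓝 (extChartAt (𝓡 n) x₀ y)]
        fun u => ∑ i, ∑ j, covRep β x₀ i u * covRep γ x₀ j u * P.piRep x₀ i j u := by
      filter_upwards [eventually_mem_target hy] with u hu
      exact P.funRep_π_eq_sum hu β γ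
    rw [pd_congr h, pd_sum_sum fun i j => ((hb i).fun_mul (hg j)).fun_mul (hp i j)]
    exact Finset.sum_congr rfl fun i _ => Finset.sum_congr rfl fun j _ =>
      pd_mul_mul (hb i) (hg j) (hp i j) c

theorem dFun_π_coordCovec {x₀ y : M} (hy : y ∈ (extChartAt (𝓡 n) x₀).source) (i j k : Fin n) :
    dFun (fun z => P.π z (coordCovec x₀ j z) (coordCovec x₀ k z)) y
        (P.ham (coordCovec x₀ i) y) =
      ∑ c, P.piRep x₀ i c (extChartAt (𝓡 n) x₀ y) *
        pd c (P.piRep x₀ j k) (extChartAt (𝓡 n) x₀ y) := by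
  rw [dFun_eq_sum hy ((P.contMDiffAt_π (contMDiffAt_coordCovec hy j)
    (contMDiffAt_coordCovec hy k)).mdifferentiableAt (by simp))]
  refine Finset.sum_congr rfl fun c _ => ?_
  rw [P.piRep_extChartAt hy, ham, P.dchart_sharp]
  rfl

/-- The twisted Jacobi identity in the preferred chart at `x₀`. -/
theorem schouten_chart {x₀ y : M} (hy : y ∈ (extChartAt (𝓡 n) x₀).source) (i j k : Fin n) :
    ∑ c, (P.piRep x₀ i c (extChartAt (𝓡 n) x₀ y) *
          pd c (P.piRep x₀ j k) (extChartAt (𝓡 n) x₀ y) +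
        P.piRep x₀ j c (extChartAt (𝓡 n) x₀ y) * pd c (P.piRep x₀ k i) (extChartAt (𝓡 n) x₀ y) +
        P.piRep x₀ k c (extChartAt (𝓡 n) x₀ y) * pd c (P.piRep x₀ i j) (extChartAt (𝓡 n) x₀ y)) +
      ∑ a, ∑ b, ∑ c, P.piRep x₀ i a (extChartAt (𝓡 n) x₀ y) *
        P.piRep x₀ j b (extChartAt (𝓡 n) x₀ y) * P.piRep x₀ k c (extChartAt (𝓡 n) x₀ y) *
        P.psiRep x₀ a b c (extChartAt (𝓡 n) x₀ y) = 0 := by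
  have hyy := mem_extChartAt_source (I := 𝓡 n) y
  -- The known identity at the centre of the chart at `y` is applied to the differentials of the
  -- coordinates of the chart at `x₀`. Every sum in it is a derivative of `π(dx^j, dx^k)` along
  -- `π♯dx^i`, or a value of `ψ` on three such vectors, and can be read off in either chart.
  have hJ := jacobi_of_closed (fun a b => P.piRep y a b (extChartAt (𝓡 n) y y))
    (fun c a b => pd c (P.piRep y a b) (extChartAt (𝓡 n) y y))
    (fun a b c => P.psiRep y a b c (extChartAt (𝓡 n) y y))
    (fun a b => P.piRep_swap y a b _) (P.schouten_self y)
    (fun t a => covRep (coordCovec x₀ (![i, j, k] t)) y a (extChartAt (𝓡 n) y y))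
    (fun t c a => pd c (covRep (coordCovec x₀ (![i, j, k] t)) y a) (extChartAt (𝓡 n) y y))
    (fun t a b => pd_covRep_coordCovec hy _ a b)
  have hs := fun l => contMDiffAt_coordCovec (n := n) hy l
  have hψ : P.ψ y ![P.ham (coordCovec x₀ i) y, P.ham (coordCovec x₀ j) y,
      P.ham (coordCovec x₀ k) y] = ∑ a, ∑ b, ∑ c, P.piRep x₀ i a (extChartAt (𝓡 n) x₀ y) *
        P.piRep x₀ j b (extChartAt (𝓡 n) x₀ y) * P.piRep x₀ k c (extChartAt (𝓡 n) x₀ y) *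
        P.psiRep x₀ a b c (extChartAt (𝓡 n) x₀ y) := by
    rw [P.ψ_apply hy]
    simp only [ham, P.dchart_sharp, P.piRep_extChartAt hy]
  have hham : ∀ l a, dchart y y (P.ham (coordCovec x₀ l) y) a =
      ∑ b, covRep (coordCovec x₀ l) y b (extChartAt (𝓡 n) y y) *
        P.piRep y b a (extChartAt (𝓡 n) y y) := by
    intro l a
    rw [← P.vecRep_sharp (mem_extChartAt_target y), vecRep, (extChartAt (𝓡 n) y).left_inv hyy]
  have hψ' := P.ψ_apply hyy (P.ham (coordCovec x₀ i) y) (P.ham (coordCovec x₀ j) y)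
    (P.ham (coordCovec x₀ k) y)
  simp only [hham] at hψ'
  simp only [Finset.sum_add_distrib]
  rw [← hψ, ← P.dFun_π_coordCovec hy, ← P.dFun_π_coordCovec hy, ← P.dFun_π_coordCovec hy,
    P.dFun_π_ham hyy (hs j) (hs k), P.dFun_π_ham hyy (hs k) (hs i), P.dFun_π_ham hyy (hs i) (hs j),
    hψ']
  rw [Finset.sum_add_distrib, Finset.sum_add_distrib] at hJ
  exact hJ

end TwistedPoisson

end TwistedPoissonGeometry

end

noncomputable section

namespace TwistedPoissonGeometry

/-! ### The cocycle condition in components -/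

/-- The components of `d_{π,ψ} Z` in terms of the components `p`, `ψ`, `Z` and of the partial
derivatives `D`, `dZ` of `p` and `Z`. -/
def dOneComp {n : ℕ} (p : Fin n → Fin n → ℝ) (D ψ : Fin n → Fin n → Fin n → ℝ) (Z : Fin n → ℝ)
    (dZ : Fin n → Fin n → ℝ) (i j : Fin n) : ℝ :=
  ∑ a, (p i a * dZ a j - p j a * dZ a i) - ∑ k, Z k * D k i j -
    ∑ a, ∑ b, ∑ c, p i a * p j b * Z c * ψ a b c

section Algebra

variable {n : ℕ} {p : Fin n → Fin n → ℝ} {D ψ : Fin n → Fin n → Fin n → ℝ}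

theorem dOneComp_add (Z Z' : Fin n → ℝ) (dZ dZ' : Fin n → Fin n → ℝ) (i j : Fin n) :
    dOneComp p D ψ (fun k => Z k + Z' k) (fun a k => dZ a k + dZ' a k) i j =
      dOneComp p D ψ Z dZ i j + dOneComp p D ψ Z' dZ' i j := by
  simp only [dOneComp, mul_add, add_mul, Finset.sum_add_distrib, Finset.sum_sub_distrib]
  ring

theorem sum_rotate {ι : Type*} [Fintype ι] (F : ι → ι → ι → ι → ℝ) :
    ∑ a, ∑ b, ∑ c, ∑ d, F a b c d = ∑ d, ∑ a, ∑ b, ∑ c, F a b c d := by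
  have h : ∀ a, ∑ b, ∑ c, ∑ d, F a b c d = ∑ d, ∑ b, ∑ c, F a b c d := fun a => by
    rw [Finset.sum_congr rfl fun b _ => Finset.sum_comm, Finset.sum_comm]
  rw [Finset.sum_congr rfl fun a _ => h a, Finset.sum_comm]

/-- The twisted Jacobi identity makes the transpose of the anchor a map of complexes: the
differential of the vector field obtained from `β` is `dβ` evaluated on `π♯dx^i` and `π♯dx^j`. The
proof contracts the Jacobi identity for `i, j, d` with `β_d`. -/
theorem dOneComp_sharp (hp : ∀ i j, p j i = - p i j) (hD : ∀ c i j, D c j i = - D c i j)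
    (hS : ∀ i j k, ∑ c, (p i c * D c j k + p j c * D c k i + p k c * D c i j) +
      ∑ a, ∑ b, ∑ c, p i a * p j b * p k c * ψ a b c = 0)
    (β : Fin n → ℝ) (dβ : Fin n → Fin n → ℝ) (i j : Fin n) :
    dOneComp p D ψ (fun k => ∑ b, p k b * β b)
        (fun a k => ∑ b, (D a k b * β b + p k b * dβ a b)) i j =
      ∑ a, ∑ b, p i a * p j b * (dβ a b - dβ b a) := by
  have h := Finset.sum_congr (rfl : (Finset.univ : Finset (Fin n)) = Finset.univ)
    fun d _ => congrArg (β d * ·) (hS i j d)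
  simp only [mul_zero, Finset.sum_const_zero, mul_add, Finset.sum_add_distrib] at h
  have e1 : ∑ a, p i a * ∑ b, D a j b * β b = ∑ d, β d * ∑ c, p i c * D c j d := by
    simp only [Finset.mul_sum]
    rw [Finset.sum_comm]
    exact Finset.sum_congr rfl fun d _ => Finset.sum_congr rfl fun c _ => by ring
  have e2 : ∑ a, p j a * ∑ b, D a i b * β b = - ∑ d, β d * ∑ c, p j c * D c d i := by
    simp only [Finset.mul_sum, ← Finset.sum_neg_distrib]
    rw [Finset.sum_comm]
    exact Finset.sum_congr rfl fun d _ => Finset.sum_congr rfl fun c _ => by rw [hD c i d]; ring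
  have e3 : ∑ k, (∑ b, p k b * β b) * D k i j = - ∑ d, β d * ∑ c, p d c * D c i j := by
    simp only [Finset.mul_sum, Finset.sum_mul, ← Finset.sum_neg_distrib]
    rw [Finset.sum_comm]
    exact Finset.sum_congr rfl fun d _ => Finset.sum_congr rfl fun c _ => by rw [hp d c]; ring
  have e4 : ∑ a, ∑ b, ∑ c, p i a * p j b * (∑ d, p c d * β d) * ψ a b c =
      - ∑ d, β d * ∑ a, ∑ b, ∑ c, p i a * p j b * p d c * ψ a b c := by
    simp only [Finset.mul_sum, Finset.sum_mul, ← Finset.sum_neg_distrib]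
    rw [sum_rotate]
    exact Finset.sum_congr rfl fun d _ => Finset.sum_congr rfl fun a _ =>
      Finset.sum_congr rfl fun b _ => Finset.sum_congr rfl fun c _ => by rw [hp d c]; ring
  have e5 : ∑ a, p i a * ∑ b, p j b * dβ a b = ∑ a, ∑ b, p i a * p j b * dβ a b := by
    simp only [Finset.mul_sum, mul_assoc]
  have e6 : ∑ a, p j a * ∑ b, p i b * dβ a b = ∑ a, ∑ b, p i a * p j b * dβ b a := by
    simp only [Finset.mul_sum]
    rw [Finset.sum_comm]
    exact Finset.sum_congr rfl fun d _ => Finset.sum_congr rfl fun c _ => by ring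
  simp only [dOneComp, Finset.sum_sub_distrib, Finset.sum_add_distrib, mul_add, mul_sub]
  rw [e1, e2, e3, e4, e5, e6]
  linarith

/-- The hypothesis `hT` is the derivative `∂_d` of the twisted Jacobi identity, used with `d = k`
and summed. The products of first derivatives that do not involve the divergence cancel (`e1`), the
Hessian of `π^{ij}` against the antisymmetric `π^{kc}` vanishes (`e2`), and the term with `∂_k
π^{kc}` is the `ψ` term of the differential (`e6`). -/
theorem dOneComp_divergence (hp : ∀ i j, p j i = - p i j) (hD : ∀ c i j, D c j i = - D c i j)
    {DD : Fin n → Fin n → Fin n → Fin n → ℝ} {Dψ : Fin n → Fin n → Fin n → Fin n → ℝ}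
    (hDD : ∀ d c i j, DD d c j i = - DD d c i j) (hDD' : ∀ d c i j, DD d c i j = DD c d i j)
    (hT : ∀ d i j k, ∑ c, (D d i c * D c j k + p i c * DD d c j k + D d j c * D c k i +
        p j c * DD d c k i + D d k c * D c i j + p k c * DD d c i j) +
      ∑ a, ∑ b, ∑ c, (D d i a * p j b * p k c * ψ a b c + p i a * D d j b * p k c * ψ a b c +
        p i a * p j b * D d k c * ψ a b c + p i a * p j b * p k c * Dψ d a b c) = 0)
    (i j : Fin n) :
    dOneComp p D ψ (fun k => ∑ c, D c k c) (fun a k => ∑ c, DD a c k c) i j =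
      - ∑ k, ∑ a, ∑ b, ∑ c, (D k i a * p j b * p k c * ψ a b c +
        p i a * D k j b * p k c * ψ a b c + p i a * p j b * p k c * Dψ k a b c) := by
  have h := Finset.sum_congr (rfl : (Finset.univ : Finset (Fin n)) = Finset.univ)
    fun k _ => hT k i j k
  simp only [Finset.sum_const_zero, Finset.sum_add_distrib] at h
  have e1 : ∑ k, ∑ c, D k j c * D c k i = - ∑ k, ∑ c, D k i c * D c j k := by
    rw [Finset.sum_comm]
    simp only [← Finset.sum_neg_distrib]
    exact Finset.sum_congr rfl fun k _ => Finset.sum_congr rfl fun c _ => by rw [hD k i c]; ring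
  have e2 : ∑ k, ∑ c, p k c * DD k c i j = 0 := by
    have e : ∑ k, ∑ c, p k c * DD k c i j = - ∑ k, ∑ c, p k c * DD k c i j := by
      conv_lhs => rw [Finset.sum_comm]
      simp only [← Finset.sum_neg_distrib]
      exact Finset.sum_congr rfl fun k _ => Finset.sum_congr rfl fun c _ => by
        rw [hp k c, hDD' k c]; ring
    linarith
  have e3 : ∑ k, ∑ c, D k k c * D c i j = - ∑ k, (∑ c, D c k c) * D k i j := by
    rw [Finset.sum_comm]
    simp only [Finset.sum_mul, ← Finset.sum_neg_distrib]
    exact Finset.sum_congr rfl fun k _ => Finset.sum_congr rfl fun c _ => by rw [hD c k c]; ring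
  have e4 : ∑ k, ∑ c, p i c * DD k c j k = ∑ a, p i a * ∑ c, DD a c j c := by
    rw [Finset.sum_comm]
    simp only [Finset.mul_sum]
    exact Finset.sum_congr rfl fun k _ => Finset.sum_congr rfl fun c _ => by rw [hDD' k c]
  have e5 : ∑ k, ∑ c, p j c * DD k c k i = - ∑ a, p j a * ∑ c, DD a c i c := by
    rw [Finset.sum_comm]
    simp only [Finset.mul_sum, ← Finset.sum_neg_distrib]
    exact Finset.sum_congr rfl fun k _ => Finset.sum_congr rfl fun c _ => by
      rw [hDD' k c, hDD c k c i]; ring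
  have e6 : ∑ k, ∑ a, ∑ b, ∑ c, p i a * p j b * D k k c * ψ a b c =
      - ∑ a, ∑ b, ∑ c, p i a * p j b * (∑ d, D d c d) * ψ a b c := by
    simp only [Finset.mul_sum, Finset.sum_mul, ← Finset.sum_neg_distrib]
    symm
    rw [sum_rotate]
    exact Finset.sum_congr rfl fun d _ => Finset.sum_congr rfl fun a _ =>
      Finset.sum_congr rfl fun b _ => Finset.sum_congr rfl fun c _ => by rw [hD d c d]; ring
  rw [e1, e2, e3, e4, e5, e6] at h
  simp only [dOneComp, Finset.sum_sub_distrib, Finset.sum_add_distrib]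
  linarith

/-- The contraction of the twisted Jacobi identity with `ψ`. -/
theorem antisymm_contraction (hp : ∀ i j, p j i = - p i j) (hD : ∀ c i j, D c j i = - D c i j)
    (h₁ : ∀ a b c, ψ b a c = - ψ a b c) (h₂ : ∀ a b c, ψ a c b = - ψ a b c)
    (hS : ∀ i j k, ∑ c, (p i c * D c j k + p j c * D c k i + p k c * D c i j) +
      ∑ a, ∑ b, ∑ c, p i a * p j b * p k c * ψ a b c = 0) (i j : Fin n) :
    ∑ k, ∑ a, ∑ b, ∑ c, D k i a * p j b * p k c * ψ a b c =
      (1 / 2 : ℝ) * ∑ k, ∑ a, ∑ b, ∑ c, p i a * p j b * D a k c * ψ b c k +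
        (1 / 2 : ℝ) * ∑ b, ∑ k, ∑ c, ∑ a, ∑ d, ∑ e,
          p j b * ψ b c k * (p i a * p k d * p c e * ψ a d e) := by
  -- The Jacobi identity for the indices `i, k, c` is contracted with `π^{jb} ψ_{bck}`. Two of its
  -- three derivative terms coincide (`c1`), and each is minus the left side of the claim (`c2`);
  -- this is the source of the factors `1/2`.
  have h : ∑ b, ∑ k, ∑ c, p j b * ψ b c k *
      (∑ a, (p i a * D a k c + p k a * D a c i + p c a * D a i k) +
      ∑ a, ∑ d, ∑ e, p i a * p k d * p c e * ψ a d e) = 0 := by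
    simp only [hS, mul_zero, Finset.sum_const_zero]
  simp only [mul_add, Finset.sum_add_distrib, Finset.mul_sum] at h
  have c1 : ∑ b, ∑ k, ∑ c, ∑ a, p j b * ψ b c k * (p k a * D a c i) =
      ∑ b, ∑ k, ∑ c, ∑ a, p j b * ψ b c k * (p c a * D a i k) := by
    refine Finset.sum_congr rfl fun b _ => ?_
    rw [Finset.sum_comm]
    exact Finset.sum_congr rfl fun k _ => Finset.sum_congr rfl fun c _ =>
      Finset.sum_congr rfl fun a _ => by rw [h₂ b c k, hD a i k]; ring
  have c2 : ∑ b, ∑ k, ∑ c, ∑ a, p j b * ψ b c k * (p c a * D a i k) =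
      ∑ k, ∑ a, ∑ b, ∑ c, D k i a * p j b * p k c * ψ a b c * (-1) := by
    rw [sum_rotate]
    refine Finset.sum_congr rfl fun a _ => ?_
    rw [Finset.sum_comm]
    exact Finset.sum_congr rfl fun k _ => Finset.sum_congr rfl fun b _ =>
      Finset.sum_congr rfl fun c _ => by rw [h₁ b k c, h₂ b c k, hp a c]; ring
  have c3 : ∑ b, ∑ k, ∑ c, ∑ a, p j b * ψ b c k * (p i a * D a k c) =
      ∑ k, ∑ a, ∑ b, ∑ c, p i a * p j b * D a k c * ψ b c k := by
    rw [Finset.sum_comm]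
    refine Finset.sum_congr rfl fun k _ => ?_
    rw [Finset.sum_congr rfl fun b _ => Finset.sum_comm, Finset.sum_comm]
    exact Finset.sum_congr rfl fun k _ => Finset.sum_congr rfl fun b _ =>
      Finset.sum_congr rfl fun c _ => by ring
  rw [c1, c2, c3] at h
  simp only [mul_neg, mul_one, Finset.sum_neg_distrib] at h
  simp only [Finset.mul_sum] at h ⊢
  simp only [← Finset.mul_sum] at h ⊢
  linarith

/-- Exchange the index triples `(b, k, c)` and `(a, d, e)`: both copies of `ψ` and the two
connecting factors `p` change sign, so the signs cancel. The symmetry makes this term disappear when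
`antisymm_contraction` is antisymmetrized in `i, j`. -/
theorem quadratic_contraction_symm (hp : ∀ i j, p j i = - p i j)
    (h₂ : ∀ a b c, ψ a c b = - ψ a b c) (i j : Fin n) :
    ∑ b, ∑ k, ∑ c, ∑ a, ∑ d, ∑ e, p j b * ψ b c k * (p i a * p k d * p c e * ψ a d e) =
      ∑ b, ∑ k, ∑ c, ∑ a, ∑ d, ∑ e, p i b * ψ b c k * (p j a * p k d * p c e * ψ a d e) := by
  simp only [← Fintype.sum_prod_type']
  let s : Fin n × Fin n × Fin n × Fin n × Fin n × Fin n →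
      Fin n × Fin n × Fin n × Fin n × Fin n × Fin n :=
    fun z => (z.2.2.2.1, z.2.2.2.2.1, z.2.2.2.2.2, z.1, z.2.1, z.2.2.1)
  refine Fintype.sum_equiv (⟨s, s, fun _ => rfl, fun _ => rfl⟩ : _ ≃ _) _ _ fun z => ?_
  obtain ⟨b, k, c, a, d, e⟩ := z
  simp only [Equiv.coe_fn_mk, s]
  rw [h₂ b k c, h₂ a d e, hp k d, hp c e]
  ring

/-- The components of `X + Y` satisfy the cocycle condition. -/
theorem dOneComp_modular (hp : ∀ i j, p j i = - p i j) (hD : ∀ c i j, D c j i = - D c i j)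
    (h₁ : ∀ a b c, ψ b a c = - ψ a b c) (h₂ : ∀ a b c, ψ a c b = - ψ a b c)
    (hS : ∀ i j k, ∑ c, (p i c * D c j k + p j c * D c k i + p k c * D c i j) +
      ∑ a, ∑ b, ∑ c, p i a * p j b * p k c * ψ a b c = 0)
    {DD : Fin n → Fin n → Fin n → Fin n → ℝ} {Dψ : Fin n → Fin n → Fin n → Fin n → ℝ}
    (hDD : ∀ d c i j, DD d c j i = - DD d c i j) (hDD' : ∀ d c i j, DD d c i j = DD c d i j)
    (hT : ∀ d i j k, ∑ c, (D d i c * D c j k + p i c * DD d c j k + D d j c * D c k i +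
        p j c * DD d c k i + D d k c * D c i j + p k c * DD d c i j) +
      ∑ a, ∑ b, ∑ c, (D d i a * p j b * p k c * ψ a b c + p i a * D d j b * p k c * ψ a b c +
        p i a * p j b * D d k c * ψ a b c + p i a * p j b * p k c * Dψ d a b c) = 0)
    (hψ : ∀ a b c d, Dψ a b c d - Dψ b a c d + Dψ c a b d - Dψ d a b c = 0)
    (β : Fin n → ℝ) (dβ : Fin n → Fin n → ℝ) (hβ : ∀ a b, dβ a b = dβ b a) (i j : Fin n) :
    dOneComp p D ψ
      (fun k => ∑ c, D c k c +
        ∑ b, p k b * (β b + (1 / 2 : ℝ) * ∑ d, ∑ c, p d c * ψ b c d))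
      (fun a k => ∑ c, DD a c k c +
        ∑ b, (D a k b * (β b + (1 / 2 : ℝ) * ∑ d, ∑ c, p d c * ψ b c d) +
          p k b * (dβ a b + (1 / 2 : ℝ) * ∑ d, ∑ c, (D a d c * ψ b c d + p d c * Dψ a b c d))))
      i j = 0 := by
  rw [dOneComp_add, dOneComp_divergence hp hD hDD hDD' hT, dOneComp_sharp hp hD hS]
  have g1 := antisymm_contraction hp hD h₁ h₂ hS i j
  have g2 := antisymm_contraction hp hD h₁ h₂ hS j i
  -- The quadratic terms of `g1` and `g2` now agree. They cancel at the end because the two mixed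
  -- derivative terms of the divergence formula have opposite signs under the exchange of `i` and
  -- `j` (`g3`).
  rw [quadratic_contraction_symm hp h₂ j i] at g2
  have g3 : ∑ k, ∑ a, ∑ b, ∑ c, D k j a * p i b * p k c * ψ a b c =
      - ∑ k, ∑ a, ∑ b, ∑ c, p i a * D k j b * p k c * ψ a b c := by
    simp only [← Finset.sum_neg_distrib]
    refine Finset.sum_congr rfl fun k _ => ?_
    rw [Finset.sum_comm]
    exact Finset.sum_congr rfl fun a _ => Finset.sum_congr rfl fun b _ =>
      Finset.sum_congr rfl fun c _ => by rw [h₁ a b c]; ring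
  have g4 : ∑ k, ∑ a, ∑ b, ∑ c, p j a * p i b * D a k c * ψ b c k =
      ∑ k, ∑ a, ∑ b, ∑ c, p i a * p j b * D b k c * ψ a c k := by
    refine Finset.sum_congr rfl fun k _ => ?_
    rw [Finset.sum_comm]
    exact Finset.sum_congr rfl fun a _ => Finset.sum_congr rfl fun b _ =>
      Finset.sum_congr rfl fun c _ => by ring
  -- Closedness of `ψ` turns the left side into two derivative terms which coincide after
  -- contraction with the antisymmetric `p`; this absorbs the factor `1/2` coming from `Y`.
  have g5 : ∀ a b, (1 / 2 : ℝ) * ∑ k, ∑ c, p k c * (Dψ a b c k - Dψ b a c k) =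
      ∑ k, ∑ c, p k c * Dψ k a b c := by
    intro a b
    have e : ∑ k, ∑ c, p k c * (Dψ a b c k - Dψ b a c k) =
        ∑ k, ∑ c, p k c * Dψ k a b c + - ∑ k, ∑ c, p k c * Dψ c a b k := by
      simp only [← Finset.sum_neg_distrib, ← Finset.sum_add_distrib]
      exact Finset.sum_congr rfl fun k _ => Finset.sum_congr rfl fun c _ => by
        linear_combination p k c * hψ a b c k
    have e' : ∑ k, ∑ c, p k c * Dψ c a b k = - ∑ k, ∑ c, p k c * Dψ k a b c := by
      rw [Finset.sum_comm]
      simp only [← Finset.sum_neg_distrib]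
      exact Finset.sum_congr rfl fun k _ => Finset.sum_congr rfl fun c _ => by rw [hp k c]; ring
    rw [e, e']
    ring
  have g6 : ∑ a, ∑ b, p i a * p j b *
      ((dβ a b + (1 / 2 : ℝ) * ∑ d, ∑ c, (D a d c * ψ b c d + p d c * Dψ a b c d)) -
        (dβ b a + (1 / 2 : ℝ) * ∑ d, ∑ c, (D b d c * ψ a c d + p d c * Dψ b a c d))) =
      (1 / 2 : ℝ) * ∑ k, ∑ a, ∑ b, ∑ c, p i a * p j b * D a k c * ψ b c k -
      (1 / 2 : ℝ) * ∑ k, ∑ a, ∑ b, ∑ c, p i a * p j b * D b k c * ψ a c k +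
      ∑ k, ∑ a, ∑ b, ∑ c, p i a * p j b * p k c * Dψ k a b c := by
    have e : ∀ F : Fin n → Fin n → Fin n → Fin n → ℝ, ∑ k, ∑ a, ∑ b, ∑ c, F k a b c =
        ∑ a, ∑ b, ∑ k, ∑ c, F k a b c := fun F => by
      rw [Finset.sum_comm]
      exact Finset.sum_congr rfl fun a _ => Finset.sum_comm
    rw [e fun k a b c => p i a * p j b * D a k c * ψ b c k,
      e fun k a b c => p i a * p j b * D b k c * ψ a c k,
      e fun k a b c => p i a * p j b * p k c * Dψ k a b c, Finset.mul_sum, Finset.mul_sum, ← Finset.sum_sub_distrib,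
      ← Finset.sum_add_distrib]
    refine Finset.sum_congr rfl fun a _ => ?_
    rw [Finset.mul_sum, Finset.mul_sum, ← Finset.sum_sub_distrib, ← Finset.sum_add_distrib]
    refine Finset.sum_congr rfl fun b _ => ?_
    have g := g5 a b
    have m : ∀ F G : Fin n → Fin n → ℝ, ∑ k, ∑ c, p i a * p j b * F k c * G k c =
        p i a * p j b * ∑ k, ∑ c, F k c * G k c := fun F G => by
      simp only [Finset.mul_sum, mul_assoc]
    rw [m (fun k c => D a k c) fun k c => ψ b c k, m (fun k c => D b k c) fun k c => ψ a c k,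
      m (fun k c => p k c) fun k c => Dψ k a b c, ← g, hβ b a]
    simp only [Finset.sum_add_distrib, mul_sub, Finset.sum_sub_distrib, mul_add]
    ring
  rw [g6]
  simp only [Finset.sum_add_distrib]
  linarith

end Algebra

end TwistedPoissonGeometry

end

/-! ### Tensoriality of the algebroid differential and the bracket in components -/

noncomputable section

namespace TwistedPoissonGeometry

/-- All derivatives of the coefficients of the two 1-forms cancel, which is the tensoriality of the
differential of a 1-cochain. It reduces the cocycle condition to coordinate 1-forms. -/
theorem sum_mul_dOneComp {n : ℕ} {p : Fin n → Fin n → ℝ} {D ψ : Fin n → Fin n → Fin n → ℝ}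
    (hp : ∀ i j, p j i = - p i j) (z a b : Fin n → ℝ) (dz da db : Fin n → Fin n → ℝ)
    {V W : Fin n → ℝ} (hV : ∀ c, V c = ∑ i, a i * p i c) (hW : ∀ c, W c = ∑ i, b i * p i c) :
    ∑ c, V c * ∑ k, (b k * dz c k + db c k * z k) -
      ∑ c, W c * ∑ k, (a k * dz c k + da c k * z k) -
      ∑ k, (∑ c, (V c * db c k + b c * ∑ i, (a i * D k i c + da k i * p i c)) -
        ∑ c, W c * (da c k - da k c) + ∑ c, ∑ d, V c * W d * ψ c d k) * z k =
      ∑ i, ∑ j, a i * b j * dOneComp p D ψ z dz i j := by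
  have e1 : ∑ c, V c * ∑ k, b k * dz c k = ∑ i, ∑ j, a i * b j * ∑ c, p i c * dz c j := by
    simp only [hV, Finset.sum_mul, Finset.mul_sum]
    rw [Finset.sum_congr rfl fun c _ => Finset.sum_comm, Finset.sum_comm]
    refine Finset.sum_congr rfl fun i _ => ?_
    rw [Finset.sum_comm]
    exact Finset.sum_congr rfl fun j _ => Finset.sum_congr rfl fun c _ => by ring
  have e2 : ∑ c, W c * ∑ k, a k * dz c k = ∑ i, ∑ j, a i * b j * ∑ c, p j c * dz c i := by
    simp only [hW, Finset.sum_mul, Finset.mul_sum]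
    rw [Finset.sum_comm]
    refine Finset.sum_congr rfl fun i _ => ?_
    rw [Finset.sum_comm]
    exact Finset.sum_congr rfl fun j _ => Finset.sum_congr rfl fun c _ => by ring
  have e3 : ∀ (V : Fin n → ℝ) (db : Fin n → Fin n → ℝ),
      ∑ k, (∑ c, V c * db c k) * z k = ∑ c, V c * ∑ k, db c k * z k := by
    intro V db
    simp only [Finset.sum_mul, Finset.mul_sum]
    rw [Finset.sum_comm]
    exact Finset.sum_congr rfl fun j _ => Finset.sum_congr rfl fun c _ => by ring
  have e4 : ∑ k, (∑ c, b c * ∑ i, a i * D k i c) * z k =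
      ∑ i, ∑ j, a i * b j * ∑ k, z k * D k i j := by
    simp only [Finset.sum_mul, Finset.mul_sum]
    rw [Finset.sum_congr rfl fun k _ => Finset.sum_comm, Finset.sum_comm]
    refine Finset.sum_congr rfl fun i _ => ?_
    rw [Finset.sum_comm]
    exact Finset.sum_congr rfl fun j _ => Finset.sum_congr rfl fun c _ => by ring
  have e5 : ∑ k, (∑ c, b c * ∑ i, da k i * p i c) * z k =
      - ∑ k, (∑ c, W c * da k c) * z k := by
    rw [← Finset.sum_neg_distrib]
    refine Finset.sum_congr rfl fun k _ => ?_
    rw [← neg_mul]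
    congr 1
    simp only [hW, Finset.sum_mul, Finset.mul_sum, ← Finset.sum_neg_distrib]
    rw [Finset.sum_comm]
    exact Finset.sum_congr rfl fun j _ => Finset.sum_congr rfl fun c _ => by rw [hp j c]; ring
  have e6 : ∑ k, (∑ c, ∑ d, V c * W d * ψ c d k) * z k =
      ∑ i, ∑ j, a i * b j * ∑ c, ∑ d, ∑ k, p i c * p j d * z k * ψ c d k := by
    have e : ∀ c d, V c * W d = ∑ i, ∑ j, a i * b j * (p i c * p j d) := by
      intro c d
      rw [hV, hW, Finset.sum_mul_sum]
      exact Finset.sum_congr rfl fun i _ => Finset.sum_congr rfl fun j _ => by ring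
    simp only [e, Finset.sum_mul, Finset.mul_sum]
    simp only [← Fintype.sum_prod_type']
    refine Fintype.sum_equiv (⟨fun w => (w.2.2.2.1, w.2.2.2.2, w.2.1, w.2.2.1, w.1),
      fun w => (w.2.2.2.2, w.2.2.1, w.2.2.2.1, w.1, w.2.1), fun _ => rfl, fun _ => rfl⟩ :
        Fin n × Fin n × Fin n × Fin n × Fin n ≃ Fin n × Fin n × Fin n × Fin n × Fin n) _ _
      fun w => ?_
    simp only [Equiv.coe_fn_mk]
    ring
  simp only [dOneComp, mul_add, mul_sub, add_mul, sub_mul, Finset.sum_add_distrib,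
    Finset.sum_sub_distrib] at *
  rw [e1, e2, e4, e5, e6, e3, e3 W da]
  ring

variable {n : ℕ} {M : Type*} [TopologicalSpace M] [ChartedSpace (EuclideanSpace ℝ (Fin n)) M]
  [IsManifold (𝓡 n) ∞ M]

/-! ### The cotangent Lie algebroid in components -/

theorem covRep_dFun {f : M → ℝ} {x₀ : M} {u : Euc n} (hu : u ∈ (extChartAt (𝓡 n) x₀).target)
    (hf : ContDiffAt ℝ ∞ (funRep n f x₀) u) (k : Fin n) :
    covRep (dFun f) x₀ k u = pd k (funRep n f x₀) u := by
  refine dFun_dsymm hu (ContMDiffAt.mdifferentiableAt (n := ∞) ?_ (by simp)) _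
  rw [contMDiffAt_iff_funRep ((extChartAt (𝓡 n) x₀).map_target hu),
    (extChartAt (𝓡 n) x₀).right_inv hu]
  exact hf

namespace TwistedPoisson

variable (P : TwistedPoisson n M)

theorem funRep_π_eq_neg_sum {x₀ : M} {u : Euc n} (hu : u ∈ (extChartAt (𝓡 n) x₀).target)
    (α β : ∀ y : M, Cotan n y) :
    funRep n (fun y => P.π y (α y) (β y)) x₀ u =
      ∑ a, - (covRep α x₀ a u * vecRep (P.ham β) x₀ u a) := by
  rw [Finset.sum_neg_distrib, ← pairing_eq_sum _ _ hu]
  exact (P.π_swap _ _).trans (congrArg _ (P.apply_sharp _ _).symm)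

theorem covRep_psi2 {x₀ : M} {u : Euc n} (hu : u ∈ (extChartAt (𝓡 n) x₀).target)
    (α β : ∀ y : M, Cotan n y) (k : Fin n) :
    covRep (fun y => psi2 (P.π y) (P.ψ y) (α y) (β y)) x₀ k u =
      ∑ a, ∑ b, vecRep (P.ham α) x₀ u a * vecRep (P.ham β) x₀ u b * P.psiRep x₀ a b k u := by
  have h := P.ψ_apply ((extChartAt (𝓡 n) x₀).map_target hu)
    (P.ham α ((extChartAt (𝓡 n) x₀).symm u)) (P.ham β ((extChartAt (𝓡 n) x₀).symm u))
    (dsymm x₀ u (stdVec k))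
  rw [dchart_dsymm hu, (extChartAt (𝓡 n) x₀).right_inv hu] at h
  rw [covRep, psi2_apply]
  refine h.trans (Finset.sum_congr rfl fun a _ => Finset.sum_congr rfl fun b _ => ?_)
  refine (Finset.sum_eq_single k (fun c _ hc => ?_) (fun hk => absurd (Finset.mem_univ k) hk)).trans
    ?_
  · simp [stdVec, hc]
  · simp [stdVec, vecRep]

/-- Since `π(α, β) = -⟨α, π♯β⟩`, the terms `-𝓛_{π♯β} α - d(π(α, β))` combine to `-i_{π♯β} dα`. No
derivative of `π♯β` remains, so apart from the derivative of `β` along `π♯α` the formula is linear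
in the components of `β`. -/
theorem covRep_bracket {α β : ∀ y : M, Cotan n y} {x₀ : M} {u : Euc n}
    (hu : u ∈ (extChartAt (𝓡 n) x₀).target) (hα : ∀ k, ContDiffAt ℝ ∞ (covRep α x₀ k) u)
    (hβ : ∀ k, ContDiffAt ℝ ∞ (covRep β x₀ k) u) (k : Fin n) :
    covRep (P.bracket α β) x₀ k u =
      ∑ a, (vecRep (P.ham α) x₀ u a * pd a (covRep β x₀ k) u +
        covRep β x₀ a u * pd k (fun w => vecRep (P.ham α) x₀ w a) u) -
      ∑ a, vecRep (P.ham β) x₀ u a * (pd a (covRep α x₀ k) u - pd k (covRep α x₀ a) u) +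
      ∑ a, ∑ b, vecRep (P.ham α) x₀ u a * vecRep (P.ham β) x₀ u b * P.psiRep x₀ a b k u := by
  have hV := P.contDiffAt_vecRep_ham hu hα
  have hW := P.contDiffAt_vecRep_ham hu hβ
  have hπ : funRep n (fun y => P.π y (α y) (β y)) x₀ =ᶠ[𝓝 u]
      fun u => ∑ a, - (covRep α x₀ a u * vecRep (P.ham β) x₀ u a) := by
    filter_upwards [(isOpen_extChartAt_target x₀).mem_nhds hu] with w hw
    exact P.funRep_π_eq_neg_sum hw α β
  have hW' := fun a => (hW.euc_coord a).differentiableAt_infty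
  have hα' := fun a => (hα a).differentiableAt_infty
  have hd : covRep (dFun fun y => P.π y (α y) (β y)) x₀ k u =
      ∑ a, - (covRep α x₀ a u * pd k (fun w => vecRep (P.ham β) x₀ w a) u +
        pd k (covRep α x₀ a) u * vecRep (P.ham β) x₀ u a) := by
    rw [covRep_dFun hu ((ContDiffAt.sum fun a _ =>
      ((hα a).mul (hW.euc_coord a)).neg).congr_of_eventuallyEq hπ), pd_congr hπ,
      pd_sum fun a => ((hα' a).fun_mul (hW' a)).fun_neg]
    refine Finset.sum_congr rfl fun a _ => ?_
    rw [pd_neg, pd_mul (hα' a) (hW' a)]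
  have h : covRep (P.bracket α β) x₀ k u = covRep (lieDerivOne (P.ham α) β) x₀ k u -
      covRep (lieDerivOne (P.ham β) α) x₀ k u - covRep (dFun fun y => P.π y (α y) (β y)) x₀ k u +
      covRep (fun y => psi2 (P.π y) (P.ψ y) (α y) (β y)) x₀ k u := rfl
  rw [h, covRep_lieDerivOne hu hβ hV, covRep_lieDerivOne hu hα hW, hd, P.covRep_psi2 hu]
  simp only [mul_sub, Finset.sum_add_distrib, Finset.sum_sub_distrib, Finset.sum_neg_distrib]
  simp only [mul_comm (pd k _ u)]
  ring

theorem dOne_eq_sum {Z : ∀ y : M, Tan n y} {α β : ∀ y : M, Cotan n y} {x₀ x : M}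
    (hx : x ∈ (extChartAt (𝓡 n) x₀).source) (hα : SmoothCovecAt α x) (hβ : SmoothCovecAt β x)
    (hZ : SmoothVecAt Z x) :
    P.dOne Z α β x = ∑ i, ∑ j, covRep α x₀ i (extChartAt (𝓡 n) x₀ x) *
      covRep β x₀ j (extChartAt (𝓡 n) x₀ x) *
      dOneComp (fun i j => P.piRep x₀ i j (extChartAt (𝓡 n) x₀ x))
        (fun c i j => pd c (P.piRep x₀ i j) (extChartAt (𝓡 n) x₀ x))
        (fun a b c => P.psiRep x₀ a b c (extChartAt (𝓡 n) x₀ x))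
        (vecRep Z x₀ (extChartAt (𝓡 n) x₀ x))
        (fun a k => pd a (fun w => vecRep Z x₀ w k) (extChartAt (𝓡 n) x₀ x)) i j := by
  have hu := (extChartAt (𝓡 n) x₀).map_source hx
  have hxu := (extChartAt (𝓡 n) x₀).left_inv hx
  have ca := fun k => hα.contDiffAt_covRep hx k
  have cb := fun k => hβ.contDiffAt_covRep hx k
  have cz := fun k => (hZ.contDiffAt_vecRep hx).euc_coord k
  have hcon : ∀ (f : M → ℝ), f x = funRep n f x₀ (extChartAt (𝓡 n) x₀ x) := fun f =>
    (funRep_extChartAt hx f).symm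
  have hV : ∀ (γ : ∀ y : M, Cotan n y) c, dchart x₀ x (P.ham γ x) c =
      vecRep (P.ham γ) x₀ (extChartAt (𝓡 n) x₀ x) c := fun γ c => by
    rw [vecRep_apply]
    exact hcon fun y => coordCovec x₀ c y (P.ham γ y)
  have hd : ∀ γ : ∀ y : M, Cotan n y, SmoothCovecAt γ x → ∀ w : Tan n x,
      dFun (fun y => γ y (Z y)) x w = ∑ c, dchart x₀ x w c *
        ∑ k, (covRep γ x₀ k (extChartAt (𝓡 n) x₀ x) *
            pd c (fun w => vecRep Z x₀ w k) (extChartAt (𝓡 n) x₀ x) +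
          pd c (covRep γ x₀ k) (extChartAt (𝓡 n) x₀ x) *
            vecRep Z x₀ (extChartAt (𝓡 n) x₀ x) k) := by
    intro γ hγ w
    rw [dFun_eq_sum hx ((hγ.pairing hZ).mdifferentiableAt (by simp))]
    refine Finset.sum_congr rfl fun c _ => ?_
    have h : funRep n (fun y => γ y (Z y)) x₀ =ᶠ[𝓝 (extChartAt (𝓡 n) x₀ x)]
        fun u => ∑ a, covRep γ x₀ a u * vecRep Z x₀ u a := by
      filter_upwards [eventually_mem_target hx] with u hu
      exact pairing_eq_sum _ _ hu
    rw [pd_congr h, pd_sum fun k => (hγ.contDiffAt_covRep hx k).differentiableAt_infty.fun_mul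
      (cz k).differentiableAt_infty]
    congr 1
    exact Finset.sum_congr rfl fun k _ => pd_mul (hγ.contDiffAt_covRep hx k).differentiableAt_infty
      (cz k).differentiableAt_infty c
  have hbr : P.bracket α β x (Z x) = ∑ k, covRep (P.bracket α β) x₀ k (extChartAt (𝓡 n) x₀ x) *
      vecRep Z x₀ (extChartAt (𝓡 n) x₀ x) k := by
    rw [← pairing_eq_sum _ _ hu]
    exact hcon fun y => P.bracket α β y (Z y)
  have hdV : ∀ k c, pd k (fun w => vecRep (P.ham α) x₀ w c) (extChartAt (𝓡 n) x₀ x) =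
      ∑ i, (covRep α x₀ i (extChartAt (𝓡 n) x₀ x) *
          pd k (P.piRep x₀ i c) (extChartAt (𝓡 n) x₀ x) +
        pd k (covRep α x₀ i) (extChartAt (𝓡 n) x₀ x) *
          P.piRep x₀ i c (extChartAt (𝓡 n) x₀ x)) := by
    intro k c
    have h : (fun w => vecRep (P.ham α) x₀ w c) =ᶠ[𝓝 (extChartAt (𝓡 n) x₀ x)]
        fun u => ∑ i, covRep α x₀ i u * P.piRep x₀ i c u := by
      filter_upwards [eventually_mem_target hx] with u hu
      exact P.vecRep_sharp hu α c
    rw [pd_congr h, pd_sum fun i => (ca i).differentiableAt_infty.fun_mul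
      (P.contDiffAt_piRep hu i c).differentiableAt_infty]
    exact Finset.sum_congr rfl fun i _ => pd_mul (ca i).differentiableAt_infty
      (P.contDiffAt_piRep hu i c).differentiableAt_infty k
  rw [dOne, hd β hβ, hd α hα, hbr]
  simp only [P.covRep_bracket hu ca cb, hdV, hV]
  exact sum_mul_dOneComp (fun i j => P.piRep_swap x₀ i j _) _ _ _ _ _ _
    (P.vecRep_sharp hu α) (P.vecRep_sharp hu β)

end TwistedPoisson

end TwistedPoissonGeometry

end

noncomputable section

namespace TwistedPoissonGeometry

/-! ### Forms of top degree and traces in a frame -/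

theorem form_top_apply {n : ℕ} (θ : Euc n [⋀^Fin n]→L[ℝ] ℝ) (v : Fin n → Euc n) :
    θ v = (Matrix.of fun i j => v j i).det * θ fun i => stdVec i := by
  have h := θ.toAlternatingMap.eq_smul_basis_det (EuclideanSpace.basisFun (Fin n) ℝ).toBasis
  have h' := congrArg (fun F => F v) h
  have e : (EuclideanSpace.basisFun (Fin n) ℝ).toBasis.det v =
      (Matrix.of fun i j => v j i).det := by
    rw [Module.Basis.det_apply]
    rfl
  have e' : (⇑(EuclideanSpace.basisFun (Fin n) ℝ).toBasis : Fin n → Euc n) =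
      fun i => stdVec i := by
    ext i
    simp
  rw [e'] at h'
  refine h'.trans ?_
  rw [AlternatingMap.smul_apply, e, smul_eq_mul, mul_comm]
  rfl

variable {n : ℕ} {M : Type*} [TopologicalSpace M] [ChartedSpace (EuclideanSpace ℝ (Fin n)) M]

/-- The form `dx¹ ∧ … ∧ dxⁿ` of the preferred chart at `x₀`. -/
def chartForm (x₀ : M) (y : M) : FormAt n n y := wedge fun j => coordCovec x₀ j y

theorem chartForm_apply {x₀ y : M} (v : Fin n → Tan n y) :
    chartForm x₀ y v = (Matrix.of fun i j => dchart x₀ y (v j) i).det :=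
  wedge_apply _ _

/-- The value of a form of top degree on the coordinate frame of the preferred chart at `x₀`. -/
def frameVal (x₀ : M) {y : M} (θ : FormAt n n y) : ℝ := θ fun i => coordVec x₀ i y

variable [IsManifold (𝓡 n) ∞ M]

theorem topRep_eq_frameVal (θ : ∀ y : M, FormAt n n y) {x₀ : M} {u : Euc n}
    (hu : u ∈ (extChartAt (𝓡 n) x₀).target) :
    topRep θ x₀ u = frameVal x₀ (θ ((extChartAt (𝓡 n) x₀).symm u)) := by
  simp only [frameVal, coordVec_symm hu]
  rfl

theorem topForm_apply {x₀ y : M} (hy : y ∈ (extChartAt (𝓡 n) x₀).source) (θ : FormAt n n y)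
    (v : Fin n → Tan n y) : θ v = frameVal x₀ θ * chartForm x₀ y v := by
  obtain ⟨u, hu, rfl⟩ := exists_mem_target hy
  have h := form_top_apply (θ.compContinuousLinearMap (dsymm x₀ u))
    (fun j => dchart x₀ ((extChartAt (𝓡 n) x₀).symm u) (v j))
  have e : (fun j => dsymm x₀ u (dchart x₀ ((extChartAt (𝓡 n) x₀).symm u) (v j))) = v :=
    funext fun j => dsymm_dchart hu (v j)
  have h1 : (θ.compContinuousLinearMap (dsymm x₀ u))
      (fun j => dchart x₀ ((extChartAt (𝓡 n) x₀).symm u) (v j)) = θ v := congrArg θ e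
  rw [← h1, h, chartForm_apply, mul_comm]
  congr 1
  simp only [frameVal, coordVec_symm hu]
  rfl

theorem topForm_eq_smul {x₀ y : M} (hy : y ∈ (extChartAt (𝓡 n) x₀).source) (θ : FormAt n n y) :
    θ = frameVal x₀ θ • chartForm x₀ y :=
  ContinuousAlternatingMap.ext fun v => topForm_apply hy θ v

theorem frameVal_chartForm {x₀ y : M} (hy : y ∈ (extChartAt (𝓡 n) x₀).source) :
    frameVal x₀ (chartForm (n := n) x₀ y) = 1 := by
  rw [frameVal, chartForm_apply]
  have : (Matrix.of fun i j => dchart x₀ y (coordVec (n := n) x₀ j y) i) = (1 : Matrix (Fin n) (Fin n) ℝ) := by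
    ext i j
    rw [Matrix.of_apply, dchart_coordVec hy]
    simp [stdVec, Matrix.one_apply]
  rw [this, Matrix.det_one]

theorem frameVal_ne_zero {x₀ y : M} (hy : y ∈ (extChartAt (𝓡 n) x₀).source) {θ : FormAt n n y}
    (hθ : θ ≠ 0) : frameVal x₀ θ ≠ 0 := by
  intro h
  rw [topForm_eq_smul hy θ, h, zero_smul] at hθ
  exact hθ rfl

theorem topForm_ext {x₀ y : M} (hy : y ∈ (extChartAt (𝓡 n) x₀).source) {θ θ' : FormAt n n y}
    (h : frameVal x₀ θ = frameVal x₀ θ') : θ = θ' := by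
  rw [topForm_eq_smul hy θ, topForm_eq_smul hy θ', h]

/-- A trace can be computed in the coordinate frame of any chart containing `y`, which is how `Y`
and `interiorBivector` become independent of the chart. -/
theorem trace_cotan {x₀ y : M} (hy : y ∈ (extChartAt (𝓡 n) x₀).source)
    (T : Cotan n y →ₗ[ℝ] Cotan n y) :
    LinearMap.trace ℝ (Cotan n y) T = ∑ k, T (coordCovec x₀ k y) (coordVec x₀ k y) := by
  let ev : Tan n y → Cotan n y →ₗ[ℝ] ℝ := fun v =>
    { toFun := fun β => β v, map_add' := fun _ _ => rfl, map_smul' := fun _ _ => rfl }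
  have h : T = ∑ k, (ev (coordVec x₀ k y)).smulRight
      (T (coordCovec x₀ k y)) := by
    ext1 β
    conv_lhs => rw [← sum_coordCovec hy β, map_sum]
    rw [LinearMap.sum_apply]
    exact Finset.sum_congr rfl fun k _ => by rw [map_smul]; rfl
  conv_lhs => rw [h, map_sum]
  exact Finset.sum_congr rfl fun k _ => LinearMap.trace_smulRight _ _

omit [IsManifold (𝓡 n) ∞ M] in
theorem toCovector_interior {y : M} (τ : FormAt n 2 y) (v w : Tan n y) :
    toCovector (interior v τ) w = τ ![v, w] := by
  have h : toCovector (interior v τ) w = τ (Matrix.vecCons v fun _ : Fin 1 => w) := rfl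
  rw [h]
  congr 1
  ext i
  fin_cases i <;> rfl

omit [IsManifold (𝓡 n) ∞ M] in
theorem form_two_swap {y : M} (τ : FormAt n 2 y) (v w : Tan n y) : τ ![w, v] = - τ ![v, w] := by
  have h := τ.toAlternatingMap.map_swap ![v, w] (show (0 : Fin 2) ≠ 1 by decide)
  have e : ![v, w] ∘ Equiv.swap (0 : Fin 2) 1 = ![w, v] := by
    ext i
    fin_cases i <;> rfl
  rw [e] at h
  exact h

namespace TwistedPoisson

variable (P : TwistedPoisson n M)

theorem vecRep_Y {x₀ : M} {u : Euc n} (hu : u ∈ (extChartAt (𝓡 n) x₀).target) (k : Fin n) :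
    vecRep P.Y x₀ u k = ∑ b, P.piRep x₀ k b u * ((1 / 2 : ℝ) *
      ∑ d, ∑ c, P.piRep x₀ d c u * P.psiRep x₀ b c d u) := by
  set y := (extChartAt (𝓡 n) x₀).symm u with hyu
  have hy : y ∈ (extChartAt (𝓡 n) x₀).source := (extChartAt (𝓡 n) x₀).map_target hu
  have h : vecRep P.Y x₀ u k = (1 / 2 : ℝ) *
      LinearMap.trace ℝ (Cotan n y) (psi2 (P.π y) (P.ψ y) (coordCovec x₀ k y)) :=
    apply_vectorOf _ (coordCovec x₀ k y)
  rw [h, trace_cotan hy, Finset.mul_sum]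
  have e : ∀ d, psi2 (P.π y) (P.ψ y) (coordCovec x₀ k y) (coordCovec x₀ d y) (coordVec x₀ d y) =
      ∑ b, ∑ c, P.piRep x₀ k b u * P.piRep x₀ d c u * P.psiRep x₀ b c d u := by
    intro d
    have h := P.covRep_psi2 hu (coordCovec x₀ k) (coordCovec x₀ d) d
    simp only [P.vecRep_ham_coordCovec] at h
    rw [← h, coordVec_symm hu]
    rfl
  simp only [e, Finset.mul_sum]
  rw [Finset.sum_comm]
  exact Finset.sum_congr rfl fun b _ => Finset.sum_congr rfl fun d _ =>
    Finset.sum_congr rfl fun c _ => by ring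

/-- The double sum is the trace of the endomorphism `β ↦ i_{π♯β} τ` of the cotangent space,
whichever chart supplies the frame. -/
theorem interiorBivector_eq_sum {x₀ y : M} (hy : y ∈ (extChartAt (𝓡 n) x₀).source)
    (τ : FormAt n 2 y) : interiorBivector (P.π y) τ = (1 / 2 : ℝ) * ∑ k, ∑ l,
      P.π y (coordCovec x₀ k y) (coordCovec x₀ l y) * τ ![coordVec x₀ l y, coordVec x₀ k y] := by
  let T : Cotan n y →ₗ[ℝ] Cotan n y :=
    { toFun := fun β => toCovector (interior (sharp (P.π y) β) τ)
      map_add' := fun β β' => by rw [sharp_add, interior_add_left]; rfl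
      map_smul' := fun c β => by rw [sharp_smul, interior_smul_left]; rfl }
  have hT : ∀ z, y ∈ (extChartAt (𝓡 n) z).source → ∑ k, ∑ l,
      P.π y (coordCovec z k y) (coordCovec z l y) * τ ![coordVec z l y, coordVec z k y] =
      LinearMap.trace ℝ (Cotan n y) T := by
    intro z hz
    rw [trace_cotan hz]
    refine Finset.sum_congr rfl fun k _ => ?_
    have h : ∀ v : Tan n y, τ ![v, coordVec z k y] =
        - toCovector (interior (coordVec z k y) τ) v := by
      intro v
      rw [toCovector_interior, form_two_swap]
    have h' : T (coordCovec z k y) (coordVec z k y) =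
        τ ![sharp (P.π y) (coordCovec z k y), coordVec z k y] :=
      toCovector_interior τ _ _
    rw [h', h]
    conv_rhs => rw [← sum_coordVec hz (sharp (P.π y) (coordCovec z k y)), map_sum]
    rw [← Finset.sum_neg_distrib]
    refine Finset.sum_congr rfl fun l _ => ?_
    rw [map_smul, h, P.dchart_sharp, smul_eq_mul, mul_neg]
  rw [interiorBivector, hT y (mem_extChartAt_source y), hT x₀ hy]

end TwistedPoisson

end TwistedPoissonGeometry

end

/-! ### The modular vector field of a density -/

noncomputable section

namespace TwistedPoissonGeometry

theorem pd_log {n : ℕ} {f : Euc n → ℝ} {u : Euc n} (hf : DifferentiableAt ℝ f u) (hu : f u ≠ 0)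
    (k : Fin n) : pd k (fun v => Real.log (f v)) u = pd k f u / f u := by
  simp only [pd]
  rw [fderiv.log hf hu, smul_apply, smul_eq_mul, div_eq_inv_mul]

variable {n : ℕ} {M : Type*} [TopologicalSpace M] [ChartedSpace (EuclideanSpace ℝ (Fin n)) M]

/-- The component of a density in the preferred chart at `x₀`. -/
def densRep (lam : VolumeDensity n M) (x₀ : M) (u : Euc n) : ℝ :=
  funRep n (fun y => lam.toFun y fun i => coordVec x₀ i y) x₀ u

variable [IsManifold (𝓡 n) ∞ M]

theorem SmoothFormNear.contDiffAt_chartRep {k : ℕ} {θ : ∀ x : M, FormAt n k x} {x₀ x : M}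
    (h : SmoothFormNear θ x) (hx : x ∈ (extChartAt (𝓡 n) x₀).source) :
    ContDiffAt ℝ ∞ (chartRep θ x₀) (extChartAt (𝓡 n) x₀ x) :=
  (h.eventually_chartRep hx).self_of_nhds

theorem VolumeDensity.apply_eq (lam : VolumeDensity n M) {x₀ y : M}
    (hy : y ∈ (extChartAt (𝓡 n) x₀).source) (v : Fin n → Tan n y) :
    lam.toFun y v = lam.toFun y (fun i => coordVec x₀ i y) * |chartForm x₀ y v| := by
  obtain ⟨θ, -, -, hθ⟩ := lam.local_form y
  have h := hθ.self_of_nhds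
  rw [h, h, ← abs_mul, topForm_apply hy]
  rfl

theorem densRep_eventuallyEq {lam : VolumeDensity n M} {θ : ∀ y : M, FormAt n n y} {x₀ x : M}
    (hx : x ∈ (extChartAt (𝓡 n) x₀).source)
    (h : ∀ᶠ y in 𝓝 x, ∀ v : Fin n → Tan n y, lam.toFun y v = |θ y v|) :
    densRep lam x₀ =ᶠ[𝓝 (extChartAt (𝓡 n) x₀ x)] fun u => |topRep θ x₀ u| := by
  filter_upwards [eventually_mem_target hx, symm_mem_nhds_of_eventually hx h] with u hu hθ
  rw [topRep_eq_frameVal θ hu]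
  exact hθ _

omit [IsManifold (𝓡 n) ∞ M] in
theorem VolumeDensity.form_ne_zero {lam : VolumeDensity n M} {θ : ∀ y : M, FormAt n n y} {x : M}
    (h : ∀ v : Fin n → Tan n x, lam.toFun x v = |θ x v|) : θ x ≠ 0 := by
  obtain ⟨θ', -, hne, hθ'⟩ := lam.local_form x
  intro h0
  refine hne (ContinuousAlternatingMap.ext fun v => ?_)
  have h1 := (hθ'.self_of_nhds v).symm.trans (h v)
  rw [h0] at h1
  exact abs_eq_zero.1 (h1.trans abs_zero)

theorem densRep_pos (lam : VolumeDensity n M) {x₀ : M} {u : Euc n}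
    (hu : u ∈ (extChartAt (𝓡 n) x₀).target) : 0 < densRep lam x₀ u := by
  obtain ⟨θ, -, hne, hθ⟩ := lam.local_form ((extChartAt (𝓡 n) x₀).symm u)
  have h : densRep lam x₀ u = _ := hθ.self_of_nhds _
  rw [h]
  exact abs_pos.2 (frameVal_ne_zero ((extChartAt (𝓡 n) x₀).map_target hu) hne)

theorem contDiffAt_densRep (lam : VolumeDensity n M) {x₀ : M} {u : Euc n}
    (hu : u ∈ (extChartAt (𝓡 n) x₀).target) : ContDiffAt ℝ ∞ (densRep lam x₀) u := by
  have hy := (extChartAt (𝓡 n) x₀).map_target hu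
  obtain ⟨θ, hs, hne, hθ⟩ := lam.local_form ((extChartAt (𝓡 n) x₀).symm u)
  have h := densRep_eventuallyEq hy hθ
  have hc := hs.contDiffAt_chartRep hy
  rw [(extChartAt (𝓡 n) x₀).right_inv hu] at h hc
  refine ContDiffAt.congr_of_eventuallyEq ?_ h
  refine (contDiffAt_abs ?_).comp u (hc.form_apply_const _)
  have := frameVal_ne_zero hy hne
  rwa [← topRep_eq_frameVal θ hu] at this

theorem contDiffAt_log_densRep (lam : VolumeDensity n M) {x₀ : M} {u : Euc n}
    (hu : u ∈ (extChartAt (𝓡 n) x₀).target) :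
    ContDiffAt ℝ ∞ (fun w => Real.log (densRep lam x₀ w)) u :=
  (contDiffAt_densRep lam hu).log (densRep_pos lam hu).ne'

namespace TwistedPoisson

variable (P : TwistedPoisson n M)

theorem interiorBivector_extD {α : ∀ y : M, Cotan n y} {x₀ : M} {u : Euc n}
    (hu : u ∈ (extChartAt (𝓡 n) x₀).target) (hα : ∀ k, ContDiffAt ℝ ∞ (covRep α x₀ k) u) :
    interiorBivector (P.π ((extChartAt (𝓡 n) x₀).symm u))
        (extD (fun y => ofCovector (α y)) ((extChartAt (𝓡 n) x₀).symm u)) =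
      ∑ k, ∑ l, P.piRep x₀ k l u * pd l (covRep α x₀ k) u := by
  rw [P.interiorBivector_eq_sum ((extChartAt (𝓡 n) x₀).map_target hu)]
  have h : ∀ k l, extD (fun y => ofCovector (α y)) ((extChartAt (𝓡 n) x₀).symm u)
      ![coordVec x₀ l ((extChartAt (𝓡 n) x₀).symm u),
        coordVec x₀ k ((extChartAt (𝓡 n) x₀).symm u)] =
      pd l (covRep α x₀ k) u - pd k (covRep α x₀ l) u := by
    intro k l
    have h := extD_ofCovector hu hα ![stdVec l, stdVec k]
    have e : (fun i => dsymm x₀ u (![stdVec l, stdVec k] i)) =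
        ![coordVec x₀ l ((extChartAt (𝓡 n) x₀).symm u),
        coordVec x₀ k ((extChartAt (𝓡 n) x₀).symm u)] := by
      funext i
      fin_cases i <;> exact (coordVec_symm hu _).symm
    rw [chartRep_apply, e] at h
    rw [h]
    simp [stdVec]
  have hp : ∑ k, ∑ l, P.piRep x₀ k l u * pd k (covRep α x₀ l) u =
      - ∑ k, ∑ l, P.piRep x₀ k l u * pd l (covRep α x₀ k) u := by
    rw [Finset.sum_comm]
    simp only [← Finset.sum_neg_distrib]
    exact Finset.sum_congr rfl fun k _ => Finset.sum_congr rfl fun l _ => by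
      rw [P.piRep_swap x₀ k l]; ring
  have h' : ∀ k l, P.π ((extChartAt (𝓡 n) x₀).symm u)
      (coordCovec x₀ k ((extChartAt (𝓡 n) x₀).symm u))
      (coordCovec x₀ l ((extChartAt (𝓡 n) x₀).symm u)) = P.piRep x₀ k l u := fun _ _ => rfl
  simp only [h, h', mul_sub, Finset.sum_sub_distrib]
  rw [hp]
  ring

theorem pd_vecRep_ham {α : ∀ y : M, Cotan n y} {x₀ : M} {u : Euc n}
    (hu : u ∈ (extChartAt (𝓡 n) x₀).target) (hα : ∀ k, ContDiffAt ℝ ∞ (covRep α x₀ k) u)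
    (k c : Fin n) : pd k (fun w => vecRep (P.ham α) x₀ w c) u =
      ∑ i, (covRep α x₀ i u * pd k (P.piRep x₀ i c) u +
        pd k (covRep α x₀ i) u * P.piRep x₀ i c u) := by
  have h : (fun w => vecRep (P.ham α) x₀ w c) =ᶠ[𝓝 u]
      fun u => ∑ i, covRep α x₀ i u * P.piRep x₀ i c u := by
    filter_upwards [(isOpen_extChartAt_target x₀).mem_nhds hu] with u hu
    exact P.vecRep_sharp hu α c
  rw [pd_congr h, pd_sum fun i => (hα i).differentiableAt_infty.fun_mul
    (P.contDiffAt_piRep hu i c).differentiableAt_infty]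
  exact Finset.sum_congr rfl fun i _ => pd_mul (hα i).differentiableAt_infty
    (P.contDiffAt_piRep hu i c).differentiableAt_infty k

/-- The components of the modular vector field `X` of a density with logarithm `L`. -/
def modX (L : Euc n → ℝ) (x₀ : M) (k : Fin n) (u : Euc n) : ℝ :=
  ∑ c, pd c (P.piRep x₀ k c) u + ∑ b, P.piRep x₀ k b u * pd b L u

theorem contDiffAt_modX {L : Euc n → ℝ} {x₀ : M} {u : Euc n}
    (hu : u ∈ (extChartAt (𝓡 n) x₀).target) (hL : ContDiffAt ℝ ∞ L u) (k : Fin n) :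
    ContDiffAt ℝ ∞ (P.modX L x₀ k) u :=
  (ContDiffAt.sum fun c _ => contDiffAt_pd (P.contDiffAt_piRep hu k c) c).add
    (ContDiffAt.sum fun b _ => (P.contDiffAt_piRep hu k b).mul (contDiffAt_pd hL b))

/-- In the divergence of `π♯α` the terms with derivatives of `α` add up to `i_π dα`, so subtracting
it leaves an expression linear in the values of `α`. This is why `X` exists as a vector field. -/
theorem sum_mul_modX {L : Euc n → ℝ} {α : ∀ y : M, Cotan n y} {x₀ : M} {u : Euc n}
    (hu : u ∈ (extChartAt (𝓡 n) x₀).target) (hα : ∀ k, ContDiffAt ℝ ∞ (covRep α x₀ k) u) :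
    ∑ i, covRep α x₀ i u * P.modX L x₀ i u =
      ∑ k, vecRep (P.ham α) x₀ u k * pd k L u +
        ∑ k, pd k (fun w => vecRep (P.ham α) x₀ w k) u -
        ∑ k, ∑ l, P.piRep x₀ k l u * pd l (covRep α x₀ k) u := by
  simp only [P.pd_vecRep_ham hu hα, P.vecRep_sharp hu, modX, mul_add, Finset.sum_add_distrib,
    Finset.mul_sum, Finset.sum_mul]
  rw [Finset.sum_comm (f := fun k i => covRep α x₀ i u * pd k (P.piRep x₀ i k) u),
    Finset.sum_comm (f := fun k i => pd k (covRep α x₀ i) u * P.piRep x₀ i k u),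
    Finset.sum_comm (f := fun k i => covRep α x₀ i u * P.piRep x₀ i k u * pd k L u)]
  simp only [mul_assoc, mul_comm (pd _ (covRep α x₀ _) u)]
  ring

theorem smul_eq_lieDeriv_sub {α : ∀ y : M, Cotan n y} {θ : ∀ y : M, FormAt n n y} {x₀ : M}
    {u : Euc n} (hu : u ∈ (extChartAt (𝓡 n) x₀).target)
    (hα : ∀ k, ContDiffAt ℝ ∞ (covRep α x₀ k) u) (hθ : ContDiffAt ℝ ∞ (chartRep θ x₀) u)
    (hne : topRep θ x₀ u ≠ 0) :
    (∑ i, covRep α x₀ i u * P.modX (fun w => Real.log (topRep θ x₀ w)) x₀ i u) •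
        θ ((extChartAt (𝓡 n) x₀).symm u) =
      lieDeriv (P.ham α) θ ((extChartAt (𝓡 n) x₀).symm u) -
        interiorBivector (P.π ((extChartAt (𝓡 n) x₀).symm u))
          (extD (fun y => ofCovector (α y)) ((extChartAt (𝓡 n) x₀).symm u)) •
          θ ((extChartAt (𝓡 n) x₀).symm u) := by
  refine topForm_ext ((extChartAt (𝓡 n) x₀).map_target hu) ?_
  have hV := P.contDiffAt_vecRep_ham hu hα
  have e : ∀ (a : ℝ) (θ₁ θ₂ : FormAt n n ((extChartAt (𝓡 n) x₀).symm u)),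
      frameVal x₀ (θ₁ - a • θ₂) = frameVal x₀ θ₁ - a * frameVal x₀ θ₂ := fun _ _ _ => rfl
  have e' : ∀ (a : ℝ) (θ₁ : FormAt n n ((extChartAt (𝓡 n) x₀).symm u)),
      frameVal x₀ (a • θ₁) = a * frameVal x₀ θ₁ := fun _ _ => rfl
  rw [e, e', ← topRep_eq_frameVal (lieDeriv (P.ham α) θ) hu, ← topRep_eq_frameVal θ hu,
    topRep_lieDeriv hu hθ hV, P.interiorBivector_extD hu hα, P.sum_mul_modX hu hα, sub_mul, add_mul]
  have hr : DifferentiableAt ℝ (topRep θ x₀) u := (hθ.form_apply_const _).differentiableAt_infty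
  simp only [pd_log hr hne, Finset.sum_add_distrib, Finset.sum_mul]
  congr 2
  refine Finset.sum_congr rfl fun k _ => ?_
  field_simp

/-- The modular vector field of a density. -/
def xField (lam : VolumeDensity n M) (x : M) : Tan n x :=
  ∑ k, P.modX (fun w => Real.log (densRep lam x w)) x k (extChartAt (𝓡 n) x x) • coordVec x k x

/-- The equation that defines the modular vector field, for a vector at `x`. -/
def IsXValue (θ : ∀ y : M, FormAt n n y) (x : M) (v : Tan n x) : Prop :=
  ∀ α : OneForms n M, ((α x : Cotan n x) v) • θ x =
    lieDeriv (P.ham α) θ x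
      - interiorBivector (P.π x) (extD (fun y => ofCovector (α y : Cotan n y)) x) • θ x

theorem isXValue_of_components {lam : VolumeDensity n M} {θ : ∀ y : M, FormAt n n y} {x₀ : M}
    {u : Euc n} (hu : u ∈ (extChartAt (𝓡 n) x₀).target)
    (hs : SmoothFormNear θ ((extChartAt (𝓡 n) x₀).symm u))
    (hθ : ∀ᶠ y in 𝓝 ((extChartAt (𝓡 n) x₀).symm u), ∀ v : Fin n → Tan n y,
      lam.toFun y v = |θ y v|) {v : Tan n ((extChartAt (𝓡 n) x₀).symm u)}
    (hv : ∀ k, dchart x₀ ((extChartAt (𝓡 n) x₀).symm u) v k =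
      P.modX (fun w => Real.log (densRep lam x₀ w)) x₀ k u) :
    P.IsXValue θ ((extChartAt (𝓡 n) x₀).symm u) v := by
  intro α
  have hy := (extChartAt (𝓡 n) x₀).map_target hu
  have hα : ∀ k, ContDiffAt ℝ ∞ (covRep α x₀ k) u := fun k => by
    have h := SmoothCovecAt.contDiffAt_covRep (α.contMDiff _) hy k
    rwa [(extChartAt (𝓡 n) x₀).right_inv hu] at h
  have hc := hs.contDiffAt_chartRep hy
  have hd := densRep_eventuallyEq hy hθ
  rw [(extChartAt (𝓡 n) x₀).right_inv hu] at hc hd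
  have hne : topRep θ x₀ u ≠ 0 := by
    rw [topRep_eq_frameVal θ hu]
    exact frameVal_ne_zero hy (VolumeDensity.form_ne_zero hθ.self_of_nhds)
  rw [← P.smul_eq_lieDeriv_sub hu hα hc hne]
  congr 1
  conv_lhs => rw [← sum_coordVec hy v, map_sum]
  refine Finset.sum_congr rfl fun k _ => ?_
  rw [map_smul, smul_eq_mul, mul_comm, hv, coordVec_symm hu]
  congr 1
  rw [modX, modX]
  congr 1
  refine Finset.sum_congr rfl fun b _ => ?_
  congr 1
  refine pd_congr ?_ b
  filter_upwards [hd] with w hw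
  -- `Real.log` ignores signs, so a local form and the density `|θ|` have the same logarithm and
  -- orientation plays no role.
  rw [hw, Real.log_abs]

theorem IsXValue.unique [T2Space M] [SecondCountableTopology M] {P : TwistedPoisson n M}
    {θ : ∀ y : M, FormAt n n y} {x : M} {v w : Tan n x} (hne : θ x ≠ 0) (hv : P.IsXValue θ x v)
    (hw : P.IsXValue θ x w) : v = w := by
  have hx := mem_extChartAt_source (I := 𝓡 n) x
  rw [← sum_coordVec hx v, ← sum_coordVec hx w]
  refine Finset.sum_congr rfl fun k _ => ?_
  congr 1
  obtain ⟨α, hα⟩ := exists_oneForm_eq x (coordCovec x k x)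
  have h := (hv α).trans (hw α).symm
  have h' := smul_left_injective ℝ hne h
  rw [hα] at h'
  exact h'

theorem xField_isXValue {lam : VolumeDensity n M} {θ : ∀ y : M, FormAt n n y} {x : M}
    (hs : SmoothFormNear θ x)
    (hθ : ∀ᶠ y in 𝓝 x, ∀ v : Fin n → Tan n y, lam.toFun y v = |θ y v|) :
    P.IsXValue θ x (P.xField lam x) := by
  have hx := mem_extChartAt_source (I := 𝓡 n) x
  -- The base point is generalized because the chart formula lives at the image of `x` under the
  -- chart followed by its inverse, which equals `x` only propositionally, while `v` has a type
  -- depending on it.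
  have key : ∀ y, y = x → ∀ v : Tan n y, (∀ k, dchart x y v k =
      P.modX (fun w => Real.log (densRep lam x w)) x k (extChartAt (𝓡 n) x x)) →
      (extChartAt (𝓡 n) x).symm (extChartAt (𝓡 n) x x) = y → P.IsXValue θ y v := by
    rintro y hyx v hv rfl
    exact P.isXValue_of_components (mem_extChartAt_target x) (by rwa [hyx]) (by rwa [hyx]) hv
  refine key x rfl _ (fun k => ?_) ((extChartAt (𝓡 n) x).left_inv hx)
  rw [xField, map_sum]
  simp only [map_smul, dchart_coordVec hx]
  exact congrArg (fun v : Euc n => v k) (sum_smul_stdVec (WithLp.toLp 2 fun k =>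
    P.modX (fun w => Real.log (densRep lam x w)) x k (extChartAt (𝓡 n) x x)))

/-- `xField` uses a different chart at every point. Its value and the vector given by the formula of
the chart at `x₀` satisfy the same defining equation, so they agree; this gives smoothness and
permits differentiation. -/
theorem vecRep_xField [T2Space M] [SecondCountableTopology M] (lam : VolumeDensity n M) {x₀ : M}
    {u : Euc n} (hu : u ∈ (extChartAt (𝓡 n) x₀).target) (k : Fin n) :
    vecRep (P.xField lam) x₀ u k = P.modX (fun w => Real.log (densRep lam x₀ w)) x₀ k u := by
  obtain ⟨θ, hs, hne, hθ⟩ := lam.local_form ((extChartAt (𝓡 n) x₀).symm u)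
  have h := P.isXValue_of_components hu hs hθ (v := dsymm x₀ u (WithLp.toLp 2 fun k =>
    P.modX (fun w => Real.log (densRep lam x₀ w)) x₀ k u)) (fun k => by rw [dchart_dsymm hu])
  rw [vecRep, IsXValue.unique hne (P.xField_isXValue hs hθ) h, dchart_dsymm hu]

theorem smoothVecAt_xField [T2Space M] [SecondCountableTopology M] (lam : VolumeDensity n M)
    (y : M) : SmoothVecAt (P.xField lam) y := by
  have hy := mem_extChartAt_source (I := 𝓡 n) y
  refine smoothVecAt_of_components hy fun k => ?_
  refine (P.contDiffAt_modX (mem_extChartAt_target y)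
    (contDiffAt_log_densRep lam (mem_extChartAt_target y)) k).congr_of_eventuallyEq ?_
  filter_upwards [eventually_mem_target hy] with u hu
  exact P.vecRep_xField lam hu k

theorem smoothVecAt_Y (y : M) : SmoothVecAt P.Y y := by
  have hy := mem_extChartAt_source (I := 𝓡 n) y
  have hu := mem_extChartAt_target (I := 𝓡 n) y
  refine smoothVecAt_of_components hy fun k => ?_
  have h : ContDiffAt ℝ ∞ (fun u => ∑ b, P.piRep y k b u * ((1 / 2 : ℝ) *
      ∑ d, ∑ c, P.piRep y d c u * P.psiRep y b c d u)) (extChartAt (𝓡 n) y y) :=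
    ContDiffAt.sum fun b _ => (P.contDiffAt_piRep hu k b).mul (contDiffAt_const.mul
      (ContDiffAt.sum fun d _ => ContDiffAt.sum fun c _ =>
        (P.contDiffAt_piRep hu d c).mul (P.contDiffAt_psiRep hu b c d)))
  refine h.congr_of_eventuallyEq ?_
  filter_upwards [eventually_mem_target hy] with u hu
  exact P.vecRep_Y hu k

end TwistedPoisson

end TwistedPoissonGeometry

end

/-! ### The field `X + Y` is a cocycle -/

noncomputable section

namespace TwistedPoissonGeometry

theorem pd_sum_sum_sum {n : ℕ} {ι κ τ : Type*} [Fintype ι] [Fintype κ] [Fintype τ]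
    {f : ι → κ → τ → Euc n → ℝ} {u : Euc n} (hf : ∀ i j l, DifferentiableAt ℝ (f i j l) u)
    (k : Fin n) :
    pd k (fun v => ∑ i, ∑ j, ∑ l, f i j l v) u = ∑ i, ∑ j, ∑ l, pd k (f i j l) u := by
  rw [pd_sum_sum fun i j => DifferentiableAt.fun_sum fun l _ => hf i j l]
  exact Finset.sum_congr rfl fun i _ => Finset.sum_congr rfl fun j _ => pd_sum (hf i j) k

variable {n : ℕ} {M : Type*} [TopologicalSpace M] [ChartedSpace (EuclideanSpace ℝ (Fin n)) M]
  [IsManifold (𝓡 n) ∞ M]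
namespace TwistedPoisson

variable (P : TwistedPoisson n M)

omit [IsManifold (𝓡 n) ∞ M] in
theorem pd_piRep_swap (x₀ : M) (c i j : Fin n) (u : Euc n) :
    pd c (P.piRep x₀ j i) u = - pd c (P.piRep x₀ i j) u := by
  rw [← pd_neg]
  exact pd_congr (Eventually.of_forall fun w => P.piRep_swap x₀ i j w) c

theorem schouten_symm {x₀ : M} {u : Euc n} (hu : u ∈ (extChartAt (𝓡 n) x₀).target)
    (i j k : Fin n) :
    ∑ c, (P.piRep x₀ i c u * pd c (P.piRep x₀ j k) u +
        P.piRep x₀ j c u * pd c (P.piRep x₀ k i) u + P.piRep x₀ k c u * pd c (P.piRep x₀ i j) u) +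
      ∑ a, ∑ b, ∑ c, P.piRep x₀ i a u * P.piRep x₀ j b u * P.piRep x₀ k c u *
        P.psiRep x₀ a b c u = 0 := by
  have h := P.schouten_chart ((extChartAt (𝓡 n) x₀).map_target hu) i j k
  rwa [(extChartAt (𝓡 n) x₀).right_inv hu] at h

/-- Differentiation is allowed because the twisted Jacobi identity is known on the whole chart
target, not only at its centre. -/
theorem pd_schouten {x₀ : M} {u : Euc n} (hu : u ∈ (extChartAt (𝓡 n) x₀).target)
    (d i j k : Fin n) :
    ∑ c, (pd d (P.piRep x₀ i c) u * pd c (P.piRep x₀ j k) u +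
        P.piRep x₀ i c u * pd d (pd c (P.piRep x₀ j k)) u +
        pd d (P.piRep x₀ j c) u * pd c (P.piRep x₀ k i) u +
        P.piRep x₀ j c u * pd d (pd c (P.piRep x₀ k i)) u +
        pd d (P.piRep x₀ k c) u * pd c (P.piRep x₀ i j) u +
        P.piRep x₀ k c u * pd d (pd c (P.piRep x₀ i j)) u) +
      ∑ a, ∑ b, ∑ c, (pd d (P.piRep x₀ i a) u * P.piRep x₀ j b u * P.piRep x₀ k c u *
          P.psiRep x₀ a b c u +
        P.piRep x₀ i a u * pd d (P.piRep x₀ j b) u * P.piRep x₀ k c u * P.psiRep x₀ a b c u +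
        P.piRep x₀ i a u * P.piRep x₀ j b u * pd d (P.piRep x₀ k c) u * P.psiRep x₀ a b c u +
        P.piRep x₀ i a u * P.piRep x₀ j b u * P.piRep x₀ k c u * pd d (P.psiRep x₀ a b c) u) =
      0 := by
  have hp := fun i j => (P.contDiffAt_piRep hu i j).differentiableAt_infty
  have hD := fun c i j => (contDiffAt_pd (P.contDiffAt_piRep hu i j) c).differentiableAt_infty
  have hψ := fun a b c => (P.contDiffAt_psiRep hu a b c).differentiableAt_infty
  have h : (fun w => ∑ c, (P.piRep x₀ i c w * pd c (P.piRep x₀ j k) w +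
        P.piRep x₀ j c w * pd c (P.piRep x₀ k i) w + P.piRep x₀ k c w * pd c (P.piRep x₀ i j) w) +
      ∑ a, ∑ b, ∑ c, P.piRep x₀ i a w * P.piRep x₀ j b w * P.piRep x₀ k c w *
        P.psiRep x₀ a b c w) =ᶠ[𝓝 u] fun _ => 0 := by
    filter_upwards [(isOpen_extChartAt_target x₀).mem_nhds hu] with w hw
    exact P.schouten_symm hw i j k
  have h' := pd_congr h d
  have d1 := fun i j k c => (hp i c).fun_mul (hD c j k)
  have d2 := fun a b c => (((hp i a).fun_mul (hp j b)).fun_mul (hp k c)).fun_mul (hψ a b c)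
  rw [pd_const, pd_add (DifferentiableAt.fun_sum fun c _ =>
      ((d1 i j k c).fun_add (d1 j k i c)).fun_add (d1 k i j c))
    (DifferentiableAt.fun_sum fun a _ => DifferentiableAt.fun_sum fun b _ =>
      DifferentiableAt.fun_sum fun c _ => d2 a b c), pd_sum_sum_sum d2,
    pd_sum fun c => ((d1 i j k c).fun_add (d1 j k i c)).fun_add (d1 k i j c)] at h'
  rw [← h']
  congr 1
  · refine Finset.sum_congr rfl fun c _ => ?_
    rw [pd_add ((d1 i j k c).fun_add (d1 j k i c)) (d1 k i j c),
      pd_add (d1 i j k c) (d1 j k i c), pd_mul (hp i c) (hD c j k), pd_mul (hp j c) (hD c k i),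
      pd_mul (hp k c) (hD c i j)]
    ring
  · refine Finset.sum_congr rfl fun a _ => Finset.sum_congr rfl fun b _ =>
      Finset.sum_congr rfl fun c _ => ?_
    rw [pd_mul (((hp i a).fun_mul (hp j b)).fun_mul (hp k c)) (hψ a b c),
      pd_mul_mul (hp i a) (hp j b) (hp k c)]
    ring

theorem pd_psiRep_closed {x₀ : M} {u : Euc n} (hu : u ∈ (extChartAt (𝓡 n) x₀).target)
    (a b c d : Fin n) :
    pd a (P.psiRep x₀ b c d) u - pd b (P.psiRep x₀ a c d) u + pd c (P.psiRep x₀ a b d) u -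
      pd d (P.psiRep x₀ a b c) u = 0 := by
  have hs : ContDiffAt ℝ ∞ (chartRep P.ψ x₀) u := by
    have h := (P.ψ_smooth _).contDiffAt_chartRep ((extChartAt (𝓡 n) x₀).map_target hu)
    rwa [(extChartAt (𝓡 n) x₀).right_inv hu] at h
  have h := extDeriv_stdVec hs.differentiableAt_infty ![a, b, c, d]
  rw [← chartRep_extD hu hs, chartRep_apply, P.ψ_closed] at h
  have h' : (0 : ℝ) = _ := h
  rw [Fin.sum_univ_four] at h'
  have e : ∀ (i : Fin 4) (r : Fin 3 → Fin n), (fun j => ![a, b, c, d] (i.succAbove j)) = r →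
      (fun u' => chartRep P.ψ x₀ u' fun j => stdVec (![a, b, c, d] (i.succAbove j))) =
        P.psiRep x₀ (r 0) (r 1) (r 2) := by
    intro i r hr
    funext w
    rw [psiRep]
    congr 1
    funext j
    have h : ![a, b, c, d] (i.succAbove j) = r j := congrFun hr j
    rw [h]
    fin_cases j <;> rfl
  rw [e 0 ![b, c, d] (by funext j; fin_cases j <;> rfl),
    e 1 ![a, c, d] (by funext j; fin_cases j <;> rfl),
    e 2 ![a, b, d] (by funext j; fin_cases j <;> rfl),
    e 3 ![a, b, c] (by funext j; fin_cases j <;> rfl)] at h'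
  simp only [Matrix.cons_val_zero, Matrix.cons_val_one, Matrix.cons_val, Fin.val_zero, pow_zero,
    one_mul, Fin.val_one, pow_one, Fin.val_two] at h'
  have h3 : ((3 : Fin 4) : ℕ) = 3 := rfl
  rw [h3] at h'
  linarith

variable [T2Space M] [SecondCountableTopology M]

theorem dOne_modular_eq_zero (lam : VolumeDensity n M) {α β : ∀ y : M, Cotan n y} {x : M}
    (hα : SmoothCovecAt α x) (hβ : SmoothCovecAt β x)
    (hZ : SmoothVecAt (fun y => P.xField lam y + P.Y y) x) :
    P.dOne (fun y => P.xField lam y + P.Y y) α β x = 0 := by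
  have hx := mem_extChartAt_source (I := 𝓡 n) x
  have hu := mem_extChartAt_target (I := 𝓡 n) x
  rw [P.dOne_eq_sum hx hα hβ hZ]
  have hv : ∀ k, (fun w => vecRep (fun y => P.xField lam y + P.Y y) x w k)
      =ᶠ[𝓝 (extChartAt (𝓡 n) x x)] fun w => ∑ c, pd c (P.piRep x k c) w +
        ∑ b, P.piRep x k b w * (pd b (fun w => Real.log (densRep lam x w)) w + (1 / 2 : ℝ) *
          ∑ d, ∑ c, P.piRep x d c w * P.psiRep x b c d w) := by
    intro k
    filter_upwards [eventually_mem_target hx] with w hw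
    have h : vecRep (fun y => P.xField lam y + P.Y y) x w k =
        vecRep (P.xField lam) x w k + vecRep P.Y x w k := by
      simp only [vecRep, map_add, PiLp.add_apply]
    rw [h, P.vecRep_xField lam hw, P.vecRep_Y hw, modX, add_assoc, ← Finset.sum_add_distrib]
    simp only [mul_add]
  have hL := contDiffAt_log_densRep lam hu
  have hp := fun i j => (P.contDiffAt_piRep hu i j).differentiableAt_infty
  have hD := fun c i j => (contDiffAt_pd (P.contDiffAt_piRep hu i j) c).differentiableAt_infty
  have hψ := fun a b c => (P.contDiffAt_psiRep hu a b c).differentiableAt_infty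
  have hDL := fun b => (contDiffAt_pd hL b).differentiableAt_infty
  have hq := fun b d c => (hp d c).fun_mul (hψ b c d)
  have hB := fun b => DifferentiableAt.fun_sum (u := Finset.univ) fun d _ =>
    DifferentiableAt.fun_sum (u := Finset.univ) fun c _ => hq b d c
  have hB' := fun b => (hDL b).fun_add ((hB b).const_mul (1 / 2 : ℝ))
  have hpd : ∀ a k, pd a (fun w => vecRep (fun y => P.xField lam y + P.Y y) x w k)
      (extChartAt (𝓡 n) x x) = ∑ c, pd a (pd c (P.piRep x k c)) (extChartAt (𝓡 n) x x) +
        ∑ b, (pd a (P.piRep x k b) (extChartAt (𝓡 n) x x) *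
          (pd b (fun w => Real.log (densRep lam x w)) (extChartAt (𝓡 n) x x) + (1 / 2 : ℝ) *
            ∑ d, ∑ c, P.piRep x d c (extChartAt (𝓡 n) x x) *
              P.psiRep x b c d (extChartAt (𝓡 n) x x)) +
          P.piRep x k b (extChartAt (𝓡 n) x x) *
          (pd a (pd b (fun w => Real.log (densRep lam x w))) (extChartAt (𝓡 n) x x) +
            (1 / 2 : ℝ) * ∑ d, ∑ c, (pd a (P.piRep x d c) (extChartAt (𝓡 n) x x) *
                P.psiRep x b c d (extChartAt (𝓡 n) x x) +
              P.piRep x d c (extChartAt (𝓡 n) x x) *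
                pd a (P.psiRep x b c d) (extChartAt (𝓡 n) x x)))) := by
    intro a k
    rw [pd_congr (hv k), pd_add (DifferentiableAt.fun_sum fun c _ => hD c k c)
      (DifferentiableAt.fun_sum fun b _ => (hp k b).fun_mul (hB' b)), pd_sum fun c => hD c k c,
      pd_sum fun b => (hp k b).fun_mul (hB' b)]
    congr 1
    refine Finset.sum_congr rfl fun b _ => ?_
    rw [pd_mul (hp k b) (hB' b), pd_add (hDL b) ((hB b).const_mul (1 / 2 : ℝ)),
      pd_const_mul _ (hB b), pd_sum_sum (hq b), add_comm]
    congr 4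
    refine Finset.sum_congr rfl fun d _ => Finset.sum_congr rfl fun c _ => ?_
    rw [pd_mul (hp d c) (hψ b c d)]
    ring
  refine Finset.sum_eq_zero fun i _ => Finset.sum_eq_zero fun j _ => ?_
  refine mul_eq_zero_of_right _ ?_
  have hv' : (vecRep (fun y => P.xField lam y + P.Y y) x (extChartAt (𝓡 n) x x)).ofLp = _ :=
    funext fun k => (hv k).self_of_nhds
  rw [hv']
  simp only [hpd]
  exact dOneComp_modular (fun i j => P.piRep_swap x i j _) (fun c i j => P.pd_piRep_swap x c i j _)
    (fun a b c => P.psiRep_swap_left x a b c _) (fun a b c => P.psiRep_swap_right x a b c _)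
    (P.schouten_symm hu)
    (DD := fun d c i j => pd d (pd c (P.piRep x i j)) (extChartAt (𝓡 n) x x))
    (Dψ := fun d a b c => pd d (P.psiRep x a b c) (extChartAt (𝓡 n) x x))
    (fun d c i j => by
      rw [← pd_neg]
      exact pd_congr (Eventually.of_forall fun w => P.pd_piRep_swap x c i j w) d)
    (fun d c i j => pd_comm (P.contDiffAt_piRep hu i j) d c)
    (P.pd_schouten hu) (P.pd_psiRep_closed hu) _
    (fun a b => pd a (pd b (fun w => Real.log (densRep lam x w))) (extChartAt (𝓡 n) x x))
    (fun a b => pd_comm hL a b) i j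

end TwistedPoisson

end TwistedPoissonGeometry

end

/-! ### Ratios of densities and existence of densities -/

noncomputable section

namespace TwistedPoissonGeometry

variable {n : ℕ} {M : Type*} [TopologicalSpace M] [ChartedSpace (EuclideanSpace ℝ (Fin n)) M]

theorem VolumeDensity.pos [IsManifold (𝓡 n) ∞ M] (lam : VolumeDensity n M) {x₀ y : M}
    (hy : y ∈ (extChartAt (𝓡 n) x₀).source) : 0 < lam.toFun y fun i => coordVec x₀ i y := by
  obtain ⟨u, hu, rfl⟩ := exists_mem_target hy
  exact densRep_pos lam hu

/-- The logarithm of the quotient of two densities. -/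
def logRatio (lam lam' : VolumeDensity n M) (y : M) : ℝ :=
  Real.log (lam.toFun y fun i => coordVec y i y) - Real.log (lam'.toFun y fun i => coordVec y i y)

variable [IsManifold (𝓡 n) ∞ M]

/-- The frame in `logRatio` depends on the point. Passing to the fixed frame of one chart multiplies
both densities by the same Jacobian factor, which cancels in the difference of logarithms. -/
theorem funRep_logRatio (lam lam' : VolumeDensity n M) {x₀ : M} {u : Euc n}
    (hu : u ∈ (extChartAt (𝓡 n) x₀).target) :
    funRep n (logRatio lam lam') x₀ u =
      Real.log (densRep lam x₀ u) - Real.log (densRep lam' x₀ u) := by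
  have hy := (extChartAt (𝓡 n) x₀).map_target hu
  set y := (extChartAt (𝓡 n) x₀).symm u with hyu
  have hyy := mem_extChartAt_source (I := 𝓡 n) y
  have h1 := lam.apply_eq hy fun i => coordVec y i y
  have h2 := lam'.apply_eq hy fun i => coordVec y i y
  have p1 := lam.pos hyy
  have p2 := lam.pos hy
  have p2' := lam'.pos hy
  have hc : |chartForm (n := n) x₀ y fun i => coordVec y i y| ≠ 0 := by
    intro h
    rw [h, mul_zero] at h1
    exact p1.ne' h1
  have h : funRep n (logRatio lam lam') x₀ u = logRatio lam lam' y := rfl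
  rw [h, logRatio, h1, h2, Real.log_mul p2.ne' hc, Real.log_mul p2'.ne' hc]
  change _ = Real.log (lam.toFun y fun i => coordVec x₀ i y) -
    Real.log (lam'.toFun y fun i => coordVec x₀ i y)
  ring

theorem contMDiff_logRatio (lam lam' : VolumeDensity n M) :
    ContMDiff (𝓡 n) 𝓘(ℝ, ℝ) ∞ (logRatio lam lam') := by
  intro y
  have hy := mem_extChartAt_source (I := 𝓡 n) y
  have hu := mem_extChartAt_target (I := 𝓡 n) y
  rw [contMDiffAt_iff_funRep hy]
  refine ((contDiffAt_log_densRep lam hu).sub (contDiffAt_log_densRep lam' hu)).congr_of_eventuallyEq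
    ?_
  filter_upwards [eventually_mem_target hy] with u hu
  exact funRep_logRatio lam lam' hu

theorem contDiffAt_det {n : ℕ} {G : Type*} [NormedAddCommGroup G] [NormedSpace ℝ G]
    {A : G → Matrix (Fin n) (Fin n) ℝ} {u : G} {m : WithTop ℕ∞}
    (hA : ∀ i j, ContDiffAt ℝ m (fun w => A w i j) u) : ContDiffAt ℝ m (fun w => (A w).det) u := by
  simp only [Matrix.det_apply']
  exact ContDiffAt.sum fun σ _ => contDiffAt_const.mul (contDiffAt_prod fun i _ => hA _ _)

omit [IsManifold (𝓡 n) ∞ M] in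
theorem chartRep_wedge {k : ℕ} (β : Fin k → ∀ y : M, Cotan n y) (x₀ : M) {u : Euc n}
    (r : Fin k → Fin n) : chartRep (fun y => wedge fun j => β j y) x₀ u (fun i => stdVec (r i)) =
      (Matrix.of fun i j => covRep (β i) x₀ (r j) u).det :=
  wedge_apply _ _

omit [IsManifold (𝓡 n) ∞ M] in
theorem contDiffAt_chartRep_wedge {k : ℕ} {β : Fin k → ∀ y : M, Cotan n y} {x₀ : M} {u : Euc n}
    (hβ : ∀ i j, ContDiffAt ℝ ∞ (covRep (β i) x₀ j) u) :
    ContDiffAt ℝ ∞ (chartRep (fun y => wedge fun j => β j y) x₀) u := by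
  refine contDiffAt_form fun r => ?_
  simp only [chartRep_wedge]
  exact contDiffAt_det fun i j => hβ i (r j)

omit [IsManifold (𝓡 n) ∞ M] in
theorem contDiffAt_chartRep_smul {k : ℕ} {f : M → ℝ} {θ : ∀ y : M, FormAt n k y} {x₀ : M}
    {u : Euc n} (hf : ContDiffAt ℝ ∞ (funRep n f x₀) u) (hθ : ContDiffAt ℝ ∞ (chartRep θ x₀) u) :
    ContDiffAt ℝ ∞ (chartRep (fun y => f y • θ y) x₀) u :=
  hf.smul hθ

theorem contDiffAt_chartRep_chartForm {z x₀ y : M} (hz : y ∈ (extChartAt (𝓡 n) z).source)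
    (hy : y ∈ (extChartAt (𝓡 n) x₀).source) :
    ContDiffAt ℝ ∞ (chartRep (chartForm (n := n) z) x₀) (extChartAt (𝓡 n) x₀ y) :=
  contDiffAt_chartRep_wedge fun i j => SmoothCovecAt.contDiffAt_covRep
    (contMDiffAt_coordCovec hz i) hy j

/-- A smooth positive multiple of the coordinate volume form is smooth. -/
theorem smoothFormNear_smul_chartForm {f : M → ℝ} {x : M}
    (hf : ∀ᶠ u in 𝓝 (extChartAt (𝓡 n) x x), ContDiffAt ℝ ∞ (funRep n f x) u) :
    SmoothFormNear (fun y => f y • chartForm (n := n) x y) x := by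
  have hx := mem_extChartAt_source (I := 𝓡 n) x
  filter_upwards [hf, eventually_mem_target hx] with u hu hu'
  have h := contDiffAt_chartRep_chartForm ((extChartAt (𝓡 n) x).map_target hu')
    ((extChartAt (𝓡 n) x).map_target hu')
  rw [(extChartAt (𝓡 n) x).right_inv hu'] at h
  exact contDiffAt_chartRep_smul hu h

/-- The density is `∑ f_i |dx_i¹ ∧ … ∧ dx_iⁿ|` for a partition of unity subordinate to the chart
domains. Absolute values avoid any orientability hypothesis. Each `f_i` vanishes outside the domain
of its chart, and positivity holds because `(0, ∞)` is convex. -/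
theorem exists_volumeDensity [T2Space M] [SecondCountableTopology M] :
    Nonempty (VolumeDensity n M) := by
  have : LocallyCompactSpace M := ChartedSpace.locallyCompactSpace (EuclideanSpace ℝ (Fin n)) M
  obtain ⟨f, hf⟩ := SmoothPartitionOfUnity.exists_isSubordinate_chartAt_source (𝓡 n) M
  have hsrc : ∀ i y, y ∈ tsupport (f i) → y ∈ (extChartAt (𝓡 n) i).source := by
    intro i y hy
    rw [extChartAt_source]
    exact hf i hy
  have hfac : ∀ (x y : M), y ∈ (extChartAt (𝓡 n) x).source → ∀ v : Fin n → Tan n y,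
      ∑ᶠ i, f i y • |chartForm i y v| =
        (∑ᶠ i, f i y • |frameVal x (chartForm (n := n) i y)|) * |chartForm x y v| := by
    intro x y hy v
    rw [finsum_mul]
    refine finsum_congr fun i => ?_
    rw [topForm_apply hy (chartForm i y), abs_mul, smul_eq_mul, smul_eq_mul, mul_assoc]
  have hpos : ∀ x y : M, y ∈ (extChartAt (𝓡 n) x).source →
      0 < ∑ᶠ i, f i y • |frameVal x (chartForm (n := n) i y)| := by
    intro x y hy
    refine f.finsum_smul_mem_convex (g := fun i y => |frameVal x (chartForm (n := n) i y)|)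
      (Set.mem_univ y) (fun i hi => ?_) (convex_Ioi 0)
    have hi' := hsrc i y (subset_tsupport _ hi)
    refine abs_pos.2 (frameVal_ne_zero hy fun h => ?_)
    have h1 := frameVal_chartForm hi'
    rw [h] at h1
    exact zero_ne_one h1
  refine ⟨⟨fun y v => ∑ᶠ i, f i y • |chartForm i y v|, fun x => ?_⟩⟩
  have hx := mem_extChartAt_source (I := 𝓡 n) x
  refine ⟨fun y => (∑ᶠ i, f i y • |frameVal x (chartForm (n := n) i y)|) • chartForm x y,
    smoothFormNear_smul_chartForm ?_, ?_, ?_⟩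
  · filter_upwards [eventually_mem_target hx] with u hu
    have hy := (extChartAt (𝓡 n) x).map_target hu
    have h : ContMDiffAt (𝓡 n) 𝓘(ℝ, ℝ) ∞
        (fun y => ∑ᶠ i, f i y • |frameVal x (chartForm (n := n) i y)|)
        ((extChartAt (𝓡 n) x).symm u) := by
      refine f.contMDiffAt_finsum fun i hi => ?_
      have hi' := hsrc i _ hi
      rw [contMDiffAt_iff_funRep hy, (extChartAt (𝓡 n) x).right_inv hu]
      have hc := contDiffAt_chartRep_chartForm (n := n) hi' hy
      rw [(extChartAt (𝓡 n) x).right_inv hu] at hc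
      have hne : topRep (chartForm (n := n) i) x u ≠ 0 := by
        rw [topRep_eq_frameVal _ hu]
        refine frameVal_ne_zero hy fun h => ?_
        have h1 := frameVal_chartForm hi'
        rw [h] at h1
        exact zero_ne_one h1
      refine ((contDiffAt_abs hne).comp u (hc.form_apply_const _)).congr_of_eventuallyEq ?_
      filter_upwards [(isOpen_extChartAt_target x).mem_nhds hu] with w hw
      have := topRep_eq_frameVal (chartForm (n := n) i) hw
      exact congrArg abs this.symm
    rw [contMDiffAt_iff_funRep hy, (extChartAt (𝓡 n) x).right_inv hu] at h
    exact h
  · intro h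
    have h1 := frameVal_chartForm (n := n) hx
    rcases smul_eq_zero.1 h with h2 | h2
    · exact (hpos x x hx).ne' h2
    · rw [h2] at h1
      exact zero_ne_one h1
  · filter_upwards [extChartAt_source_mem_nhds (I := 𝓡 n) x] with y hy v
    rw [hfac x y hy v]
    have e : ∀ (a : ℝ) (θ : FormAt n n y), (a • θ) v = a * θ v := fun _ _ => rfl
    rw [e, abs_mul, abs_of_pos (hpos x y hy)]

/-- The density `|θ|` of a volume form `θ`. -/
def VolumeForm.density (lam : VolumeForm n M) : VolumeDensity n M where
  toFun y v := |lam.toFun y v|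
  local_form x := ⟨lam.toFun, lam.smooth x, lam.ne_zero x, Eventually.of_forall fun _ _ => rfl⟩

end TwistedPoissonGeometry

end

noncomputable section

namespace TwistedPoissonGeometry

/-! ### Derivations of determinants -/

theorem det_updateRow_eq_sum {n : ℕ} (N : Matrix (Fin n) (Fin n) ℝ) (i : Fin n) (w : Fin n → ℝ) :
    (N.updateRow i w).det = ∑ k, w k * N.adjugate k i := by
  rw [← Matrix.cramer_transpose_apply, Matrix.cramer_eq_adjugate_mulVec,
    ← Matrix.adjugate_transpose]
  simp only [Matrix.mulVec, dotProduct, Matrix.transpose_apply, mul_comm]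

/-- Cofactor expansion gives `tr (N C adj N)`, and cyclicity of the trace with `adj N · N = det N`
gives the result, also for singular `N`. It is the rule by which the linear part of the bracket acts
on a wedge product. -/
theorem sum_det_updateRow_mul {n : ℕ} (N C : Matrix (Fin n) (Fin n) ℝ) :
    ∑ i, (N.updateRow i fun k => ∑ l, N i l * C l k).det = C.trace * N.det := by
  have h : ∑ i, (N.updateRow i fun k => ∑ l, N i l * C l k).det =
      (N * C * N.adjugate).trace := by
    simp only [det_updateRow_eq_sum, Matrix.trace, Matrix.diag, Matrix.mul_apply]
  rw [h, Matrix.trace_mul_comm, ← mul_assoc, Matrix.adjugate_mul, Matrix.smul_mul, one_mul,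
    Matrix.trace_smul, smul_eq_mul, mul_comm]

theorem pd_det {n : ℕ} {N : Euc n → Matrix (Fin n) (Fin n) ℝ} {u : Euc n}
    (hN : ∀ i j, DifferentiableAt ℝ (fun w => N w i j) u) (a : Fin n) :
    pd a (fun w => (N w).det) u =
      ∑ i, ((N u).updateRow i fun k => pd a (fun w => N w i k) u).det := by
  let f : ContinuousMultilinearMap ℝ (fun _ : Fin n => Fin n → ℝ) ℝ :=
    { (Matrix.detRowAlternating : (Fin n → ℝ) [⋀^Fin n]→ₗ[ℝ] ℝ).toMultilinearMap with
      cont := Continuous.matrix_det (A := fun N : Fin n → Fin n → ℝ => N) continuous_id }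
  have hrow : ∀ i, DifferentiableAt ℝ (fun w => (fun k => N w i k : Fin n → ℝ)) u := fun i =>
    differentiableAt_pi.2 fun k => hN i k
  have h := (HasFDerivAt.multilinear_comp f fun i => (hrow i).hasFDerivAt).fderiv
  have h' := congrArg (fun L => L (stdVec a)) h
  have e : ∀ i, fderiv ℝ (fun w => (fun k => N w i k : Fin n → ℝ)) u (stdVec a) =
      fun k => pd a (fun w => N w i k) u := by
    intro i
    rw [fderiv_pi fun k => hN i k]
    rfl
  refine h'.trans ?_
  rw [sum_apply]
  refine Finset.sum_congr rfl fun i _ => ?_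
  rw [← e i]
  rfl

variable {n : ℕ} {M : Type*} [TopologicalSpace M] [ChartedSpace (EuclideanSpace ℝ (Fin n)) M]
  [IsManifold (𝓡 n) ∞ M]

namespace TwistedPoisson

variable (P : TwistedPoisson n M)

omit [IsManifold (𝓡 n) ∞ M] in
theorem topRep_bracketWedge (α : ∀ y : M, Cotan n y) (β : Fin n → ∀ y : M, Cotan n y) (x₀ : M)
    (u : Euc n) : topRep (P.bracketWedge α β) x₀ u =
      ∑ i, ((Matrix.of fun i j => covRep (β i) x₀ j u).updateRow i fun k =>
        covRep (P.bracket α (β i)) x₀ k u).det := by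
  have h : topRep (P.bracketWedge α β) x₀ u = ∑ i,
      wedge (Function.update (fun j => β j ((extChartAt (𝓡 n) x₀).symm u)) i
        (P.bracket α (β i) ((extChartAt (𝓡 n) x₀).symm u))) (fun k => dsymm x₀ u (stdVec k)) := by
    rw [topRep, chartRep_apply, bracketWedge, ContinuousAlternatingMap.sum_apply]
  rw [h]
  refine Finset.sum_congr rfl fun i _ => ?_
  rw [wedge_apply]
  congr 1
  ext j k
  rw [Matrix.of_apply, Matrix.updateRow_apply]
  split_ifs with hj
  · rw [hj, Function.update_self]
    rfl
  · rw [Function.update_of_ne hj]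
    rfl

/-- On each factor the bracket is the derivative along `π♯α` plus multiplication of the row of
components by a matrix `C` independent of the factor. On the determinant these give the derivative
of the component and its multiple by the trace of `C`. -/
theorem topRep_bracketWedge_eq {α : ∀ y : M, Cotan n y} {β : Fin n → ∀ y : M, Cotan n y} {x₀ : M}
    {u : Euc n} (hu : u ∈ (extChartAt (𝓡 n) x₀).target)
    (hα : ∀ k, ContDiffAt ℝ ∞ (covRep α x₀ k) u)
    (hβ : ∀ i k, ContDiffAt ℝ ∞ (covRep (β i) x₀ k) u) :
    topRep (P.bracketWedge α β) x₀ u =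
      ∑ a, vecRep (P.ham α) x₀ u a * pd a (topRep (fun y => wedge fun j => β j y) x₀) u +
      (∑ k, pd k (fun w => vecRep (P.ham α) x₀ w k) u -
        2 * ∑ k, ∑ l, P.piRep x₀ k l u * pd l (covRep α x₀ k) u +
        2 * ∑ k, covRep α x₀ k u * vecRep P.Y x₀ u k) *
          topRep (fun y => wedge fun j => β j y) x₀ u := by
  have ht : topRep (fun y => wedge fun j => β j y) x₀ =
      fun w => (Matrix.of fun i j => covRep (β i) x₀ j w).det :=
    funext fun w => chartRep_wedge β x₀ id
  let C : Matrix (Fin n) (Fin n) ℝ := Matrix.of fun l k =>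
    pd k (fun w => vecRep (P.ham α) x₀ w l) u -
      ∑ a, P.piRep x₀ l a u * (pd a (covRep α x₀ k) u - pd k (covRep α x₀ a) u) +
      ∑ a, ∑ b, vecRep (P.ham α) x₀ u a * P.piRep x₀ l b u * P.psiRep x₀ a b k u
  have hb : ∀ i k, covRep (P.bracket α (β i)) x₀ k u =
      ∑ a, vecRep (P.ham α) x₀ u a * pd a (covRep (β i) x₀ k) u +
      ∑ l, covRep (β i) x₀ l u * C l k := by
    intro i k
    rw [P.covRep_bracket hu hα (hβ i)]
    have e1 : ∀ g : Fin n → ℝ, ∑ l, covRep (β i) x₀ l u * ∑ a, P.piRep x₀ l a u * g a =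
        ∑ a, vecRep (P.ham (β i)) x₀ u a * g a := by
      intro g
      simp only [P.vecRep_sharp hu (β i), Finset.mul_sum, Finset.sum_mul]
      rw [Finset.sum_comm]
      simp only [mul_assoc]
    have e2 : ∑ l, covRep (β i) x₀ l u * ∑ a, ∑ b, vecRep (P.ham α) x₀ u a *
        P.piRep x₀ l b u * P.psiRep x₀ a b k u =
        ∑ a, ∑ b, vecRep (P.ham α) x₀ u a * vecRep (P.ham (β i)) x₀ u b *
          P.psiRep x₀ a b k u := by
      have h := e1 fun b => ∑ a, vecRep (P.ham α) x₀ u a * P.psiRep x₀ a b k u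
      simp only [Finset.mul_sum] at h ⊢
      rw [Finset.sum_comm (f := fun a b => vecRep (P.ham α) x₀ u a *
        vecRep (P.ham (β i)) x₀ u b * P.psiRep x₀ a b k u)]
      refine Eq.trans ?_ (h.trans ?_)
      · refine Finset.sum_congr rfl fun l _ => ?_
        rw [Finset.sum_comm]
        exact Finset.sum_congr rfl fun b _ => Finset.sum_congr rfl fun a _ => by ring
      · exact Finset.sum_congr rfl fun b _ => Finset.sum_congr rfl fun a _ => by ring
    simp only [C, Matrix.of_apply, mul_add, mul_sub, Finset.sum_add_distrib,
      Finset.sum_sub_distrib] at e1 e2 ⊢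
    rw [e2]
    have h1 := e1 fun a => pd a (covRep α x₀ k) u
    have h2 := e1 fun a => pd k (covRep α x₀ a) u
    linarith
  have htr : C.trace = ∑ k, pd k (fun w => vecRep (P.ham α) x₀ w k) u -
        2 * ∑ k, ∑ l, P.piRep x₀ k l u * pd l (covRep α x₀ k) u +
        2 * ∑ k, covRep α x₀ k u * vecRep P.Y x₀ u k := by
    have e1 : ∑ k, ∑ a, P.piRep x₀ k a u * pd k (covRep α x₀ a) u =
        - ∑ k, ∑ a, P.piRep x₀ k a u * pd a (covRep α x₀ k) u := by
      rw [Finset.sum_comm]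
      simp only [← Finset.sum_neg_distrib]
      exact Finset.sum_congr rfl fun k _ => Finset.sum_congr rfl fun a _ => by
        rw [P.piRep_swap x₀ k a]; ring
    -- The trace of the `ψ` part is twice the pairing with `Y`, because of the one half in the
    -- definition of `Y`.
    have e2 : ∑ k, ∑ a, ∑ b, vecRep (P.ham α) x₀ u a * P.piRep x₀ k b u * P.psiRep x₀ a b k u =
        2 * ∑ k, covRep α x₀ k u * vecRep P.Y x₀ u k := by
      have e3 : ∑ k, covRep α x₀ k u * vecRep P.Y x₀ u k =
          ∑ a, vecRep (P.ham α) x₀ u a * ((1 / 2 : ℝ) * ∑ k, ∑ b, P.piRep x₀ k b u *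
            P.psiRep x₀ a b k u) := by
        simp only [P.vecRep_sharp hu α, P.vecRep_Y hu]
        rw [Finset.sum_congr rfl fun k _ => Finset.mul_sum _ _ _, Finset.sum_comm]
        refine Finset.sum_congr rfl fun a _ => ?_
        rw [Finset.sum_mul]
        exact Finset.sum_congr rfl fun k _ => by ring
      rw [e3, Finset.sum_comm, Finset.mul_sum]
      refine Finset.sum_congr rfl fun a _ => ?_
      simp only [mul_assoc, ← Finset.mul_sum]
      ring
    simp only [Matrix.trace, Matrix.diag, C, Matrix.of_apply, Finset.sum_add_distrib,
      Finset.sum_sub_distrib, mul_sub]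
    rw [e1, e2]
    ring
  have hd := pd_det (N := fun w => Matrix.of fun i j => covRep (β i) x₀ j w) (u := u)
    fun i j => (hβ i j).differentiableAt_infty
  rw [topRep_bracketWedge, ht]
  simp only [hd]
  rw [← htr, ← sum_det_updateRow_mul]
  simp only [det_updateRow_eq_sum, hb, add_mul, Finset.sum_add_distrib, Matrix.of_apply]
  congr 1
  simp only [Finset.mul_sum, Finset.sum_mul]
  rw [Finset.sum_congr rfl fun i _ => Finset.sum_comm, Finset.sum_comm]
  exact Finset.sum_congr rfl fun a _ => Finset.sum_congr rfl fun i _ =>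
    Finset.sum_congr rfl fun k _ => by ring

end TwistedPoisson

end TwistedPoissonGeometry

end

/-! ### Sections of `∧ⁿT*M ⊗ ∧ⁿT*M` and their characteristic sections -/

noncomputable section

namespace TwistedPoissonGeometry

variable {n : ℕ} {M : Type*} [TopologicalSpace M] [ChartedSpace (EuclideanSpace ℝ (Fin n)) M]

/-- The value of an element of `∧ⁿ T*M ⊗ ∧ⁿ T*M` on a frame. -/
def tensorVal {y : M} (v : Fin n → Tan n y) : FormAt n n y ⊗[ℝ] FormAt n n y →ₗ[ℝ] ℝ :=
  TensorProduct.lift (LinearMap.mk₂ ℝ (fun θ μ => θ v * μ v)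
    (fun θ θ' μ => add_mul (θ v) (θ' v) (μ v)) (fun c θ μ => mul_assoc c (θ v) (μ v))
    (fun θ μ μ' => mul_add (θ v) (μ v) (μ' v)) (fun c θ μ => mul_left_comm (θ v) c (μ v)))

theorem tensorVal_tmul {y : M} (v : Fin n → Tan n y) (θ μ : FormAt n n y) :
    tensorVal v (θ ⊗ₜ[ℝ] μ) = θ v * μ v := rfl

variable [IsManifold (𝓡 n) ∞ M]

theorem tmul_ne_zero {y : M} {θ μ : FormAt n n y} (hθ : θ ≠ 0) (hμ : μ ≠ 0) :
    θ ⊗ₜ[ℝ] μ ≠ 0 := by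
  have hy := mem_extChartAt_source (I := 𝓡 n) y
  intro h
  have h' := congrArg (tensorVal fun i => coordVec y i y) h
  rw [tensorVal_tmul, map_zero] at h'
  exact mul_ne_zero (frameVal_ne_zero hy hθ) (frameVal_ne_zero hy hμ) h'

omit [IsManifold (𝓡 n) ∞ M] in
theorem SmoothFormNear.eventually_contDiffAt_topRep {θ : ∀ y : M, FormAt n n y} {x : M}
    (h : SmoothFormNear θ x) :
    ∀ᶠ u in 𝓝 (extChartAt (𝓡 n) x x), ContDiffAt ℝ ∞ (topRep θ x) u :=
  h.mono fun _ hu => hu.form_apply_const _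

theorem SmoothFormNear.eventually_topRep_ne_zero {θ : ∀ y : M, FormAt n n y} {x : M}
    (h : SmoothFormNear θ x) (hne : θ x ≠ 0) :
    ∀ᶠ u in 𝓝 (extChartAt (𝓡 n) x x), topRep θ x u ≠ 0 := by
  have hx := mem_extChartAt_source (I := 𝓡 n) x
  refine h.eventually_contDiffAt_topRep.self_of_nhds.continuousAt.eventually_ne ?_
  rw [topRep_eq_frameVal θ (mem_extChartAt_target x), (extChartAt (𝓡 n) x).left_inv hx]
  exact frameVal_ne_zero hx hne

/-- The density whose square is the absolute value of a section of `∧ⁿ T*M ⊗ ∧ⁿ T*M`. -/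
def VolumeSection.density (s : VolumeSection n M) : VolumeDensity n M where
  toFun y v := Real.sqrt |tensorVal v (s.toFun y)|
  local_form x := by
    have hx := mem_extChartAt_source (I := 𝓡 n) x
    obtain ⟨θ, μ, hθ, hμ, hs⟩ := s.smooth x
    have hne := s.ne_zero x
    rw [hs.self_of_nhds] at hne
    have hθ0 : θ x ≠ 0 := fun h => hne (by rw [h, TensorProduct.zero_tmul])
    have hμ0 : μ x ≠ 0 := fun h => hne (by rw [h, TensorProduct.tmul_zero])
    -- Against the coordinate form of the chart, `θ ⊗ μ` has coefficient `frameVal x (θ y) *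
    -- frameVal x (μ y)`. It does not vanish near `x`, so the square root of its absolute value is
    -- smooth there.
    refine ⟨fun y => Real.sqrt |frameVal x (θ y) * frameVal x (μ y)| • chartForm x y,
      smoothFormNear_smul_chartForm ?_, ?_, ?_⟩
    · filter_upwards [hθ.eventually_contDiffAt_topRep, hμ.eventually_contDiffAt_topRep,
        hθ.eventually_topRep_ne_zero hθ0, hμ.eventually_topRep_ne_zero hμ0,
        eventually_mem_target hx] with u h1 h2 h3 h4 hu
      have h : ContDiffAt ℝ ∞ (fun w => |topRep θ x w * topRep μ x w|) u :=
        (h1.mul h2).abs (mul_ne_zero h3 h4)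
      refine (h.sqrt (abs_pos.2 (mul_ne_zero h3 h4)).ne').congr_of_eventuallyEq ?_
      filter_upwards [(isOpen_extChartAt_target x).mem_nhds hu] with w hw
      simp only [topRep_eq_frameVal _ hw]
      rfl
    · intro h
      have h1 := frameVal_chartForm (n := n) hx
      rcases smul_eq_zero.1 h with h2 | h2
      · exact (Real.sqrt_pos.2 (abs_pos.2 (mul_ne_zero (frameVal_ne_zero hx hθ0)
          (frameVal_ne_zero hx hμ0)))).ne' h2
      · rw [h2] at h1
        exact zero_ne_one h1
    · filter_upwards [hs, extChartAt_source_mem_nhds (I := 𝓡 n) x] with y hy hy' v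
      have e : ∀ (a : ℝ) (θ : FormAt n n y), (a • θ) v = a * θ v := fun _ _ => rfl
      rw [hy, tensorVal_tmul, topForm_apply hy' (θ y), topForm_apply hy' (μ y), e,
        abs_mul (Real.sqrt _), abs_of_nonneg (Real.sqrt_nonneg _), ← Real.sqrt_sq_eq_abs
          (chartForm x y v), ← Real.sqrt_mul (abs_nonneg _)]
      congr 1
      rw [← abs_of_nonneg (sq_nonneg (chartForm x y v)), ← abs_mul]
      congr 1
      ring

/-- The square of a density, as a section of `∧ⁿ T*M ⊗ ∧ⁿ T*M`. -/
def VolumeDensity.section (lam : VolumeDensity n M) : VolumeSection n M where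
  toFun y := (lam.toFun y fun i => coordVec y i y) ^ 2 • chartForm y y ⊗ₜ[ℝ] chartForm y y
  smooth x := by
    obtain ⟨θ, hθ, -, h⟩ := lam.local_form x
    -- The sign lost in `|θ|` is irrelevant for `θ ⊗ θ`, so the section defined with pointwise
    -- frames is locally the square of a smooth form.
    refine ⟨θ, θ, hθ, hθ, ?_⟩
    filter_upwards [h] with y hy
    have hyy := mem_extChartAt_source (I := 𝓡 n) y
    conv_rhs => rw [topForm_eq_smul hyy (θ y), TensorProduct.smul_tmul_smul]
    rw [hy, sq_abs, sq]
    rfl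
  ne_zero x := by
    have hx := mem_extChartAt_source (I := 𝓡 n) x
    have h : chartForm (n := n) x x ≠ 0 := by
      intro h
      have h1 := frameVal_chartForm (n := n) hx
      rw [h] at h1
      exact zero_ne_one h1
    exact smul_ne_zero (pow_ne_zero 2 (lam.pos hx).ne') (tmul_ne_zero h h)

namespace TwistedPoisson

variable (P : TwistedPoisson n M) [T2Space M] [SecondCountableTopology M]

/-- The main computation: the characteristic section of `s` is exactly twice the modular cocycle of
`√|s|`, with no coboundary correction. -/
theorem repD_eq_smul {s : VolumeSection n M} {α : OneForms n M} {x : M}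
    {β : Fin n → ∀ y : M, Cotan n y} {μ : ∀ y : M, FormAt n n y}
    (hβ : ∀ i, SmoothOneFormNear (β i) x) (hμ : SmoothFormNear μ x)
    (hs : ∀ᶠ y in 𝓝 x, s.toFun y = wedge (fun j => β j y) ⊗ₜ[ℝ] μ y) :
    P.repD α β μ x =
      ((α x : Cotan n x) ((2 : ℝ) • (P.xField s.density x + P.Y x))) • s.toFun x := by
  have hx := mem_extChartAt_source (I := 𝓡 n) x
  have hu := mem_extChartAt_target (I := 𝓡 n) x
  have hxu := (extChartAt (𝓡 n) x).left_inv hx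
  set θ : ∀ y : M, FormAt n n y := fun y => wedge fun j => β j y with hθ
  have hcα := fun k => SmoothCovecAt.contDiffAt_covRep (α.contMDiff x) hx k
  have hcβ := fun i k => SmoothCovecAt.contDiffAt_covRep (hβ i).self_of_nhds hx k
  have hcθ : ContDiffAt ℝ ∞ (chartRep θ x) (extChartAt (𝓡 n) x x) :=
    contDiffAt_chartRep_wedge hcβ
  have hcμ := hμ.contDiffAt_chartRep hx
  have hne := s.ne_zero x
  rw [hs.self_of_nhds] at hne
  have hθ0 : θ x ≠ 0 := fun h => hne (by
    change θ x ⊗ₜ[ℝ] μ x = 0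
    rw [h, TensorProduct.zero_tmul])
  have hμ0 : μ x ≠ 0 := fun h => hne (by rw [h, TensorProduct.tmul_zero])
  have htop : ∀ θ : ∀ y : M, FormAt n n y,
      topRep θ x (extChartAt (𝓡 n) x x) = frameVal x (θ x) := fun θ => by
    rw [topRep_eq_frameVal θ hu, hxu]
  have hθ1 : topRep θ x (extChartAt (𝓡 n) x x) ≠ 0 := by
    rw [htop]
    exact frameVal_ne_zero hx hθ0
  have hμ1 : topRep μ x (extChartAt (𝓡 n) x x) ≠ 0 := by
    rw [htop]
    exact frameVal_ne_zero hx hμ0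
  have hdθ : ContDiffAt ℝ ∞ (topRep θ x) (extChartAt (𝓡 n) x x) := hcθ.form_apply_const _
  have hdμ : ContDiffAt ℝ ∞ (topRep μ x) (extChartAt (𝓡 n) x x) := hcμ.form_apply_const _
  have hlog : (fun w => Real.log (densRep s.density x w)) =ᶠ[𝓝 (extChartAt (𝓡 n) x x)]
      fun w => (1 / 2 : ℝ) * (Real.log (topRep θ x w) + Real.log (topRep μ x w)) := by
    filter_upwards [symm_mem_nhds_of_eventually hx hs, eventually_mem_target hx,
      hdθ.continuousAt.eventually_ne hθ1, hdμ.continuousAt.eventually_ne hμ1] with w hw hwt h1 h2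
    have h : densRep s.density x w = Real.sqrt |topRep θ x w * topRep μ x w| := by
      rw [topRep_eq_frameVal θ hwt, topRep_eq_frameVal μ hwt]
      change Real.sqrt |tensorVal _ (s.toFun _)| = _
      rw [hw]
      rfl
    rw [h, Real.log_sqrt (abs_nonneg _), Real.log_abs, Real.log_mul h1 h2]
    ring
  have hpd : ∀ a, pd a (fun w => Real.log (densRep s.density x w)) (extChartAt (𝓡 n) x x) =
      (1 / 2 : ℝ) * (pd a (topRep θ x) (extChartAt (𝓡 n) x x) /
          topRep θ x (extChartAt (𝓡 n) x x) +
        pd a (topRep μ x) (extChartAt (𝓡 n) x x) / topRep μ x (extChartAt (𝓡 n) x x)) := by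
    intro a
    have l1 := (hdθ.log hθ1).differentiableAt_infty
    have l2 := (hdμ.log hμ1).differentiableAt_infty
    rw [pd_congr hlog, pd_const_mul _ (l1.fun_add l2), pd_add l1 l2,
      pd_log hdθ.differentiableAt_infty hθ1, pd_log hdμ.differentiableAt_infty hμ1]
  have hV := P.contDiffAt_vecRep_ham hu hcα
  have hB := P.topRep_bracketWedge_eq hu hcα hcβ
  have hL := topRep_lieDeriv hu hcμ hV
  have hU : (α x : Cotan n x) ((2 : ℝ) • (P.xField s.density x + P.Y x)) =
      2 * (∑ i, covRep α x i (extChartAt (𝓡 n) x x) *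
          P.modX (fun w => Real.log (densRep s.density x w)) x i (extChartAt (𝓡 n) x x) +
        ∑ i, covRep α x i (extChartAt (𝓡 n) x x) * vecRep P.Y x (extChartAt (𝓡 n) x x) i) := by
    rw [map_smul, map_add, smul_eq_mul]
    have h1 := pairing_eq_sum α (P.xField s.density) hu
    have h2 := pairing_eq_sum α P.Y hu
    rw [funRep_extChartAt hx fun y => α y (P.xField s.density y)] at h1
    rw [funRep_extChartAt hx fun y => α y (P.Y y)] at h2
    rw [h1, h2]
    simp only [P.vecRep_xField s.density hu]
  rw [P.sum_mul_modX hu hcα] at hU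
  simp only [hpd] at hU
  set V := vecRep (P.ham α) x (extChartAt (𝓡 n) x x)
  set t := topRep θ x (extChartAt (𝓡 n) x x)
  set m := topRep μ x (extChartAt (𝓡 n) x x)
  -- Forms of top degree are one-dimensional, so each operator scales its factor; `c₁` and `c₂` are
  -- the rates for the bracket on `θ` and the Lie derivative on `μ`. Their sum matches because the
  -- logarithm of the density is half of `log |θ| + log |μ|`.
  obtain ⟨c₁, hc₁⟩ : ∃ c₁, c₁ = (∑ a, V a * pd a (topRep θ x) (extChartAt (𝓡 n) x x)) / t +
      (∑ k, pd k (fun w => vecRep (P.ham α) x w k) (extChartAt (𝓡 n) x x) -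
        2 * ∑ k, ∑ l, P.piRep x k l (extChartAt (𝓡 n) x x) *
          pd l (covRep α x k) (extChartAt (𝓡 n) x x) +
        2 * ∑ k, covRep α x k (extChartAt (𝓡 n) x x) *
          vecRep P.Y x (extChartAt (𝓡 n) x x) k) := ⟨_, rfl⟩
  obtain ⟨c₂, hc₂⟩ : ∃ c₂, c₂ = (∑ a, V a * pd a (topRep μ x) (extChartAt (𝓡 n) x x)) / m +
      ∑ k, pd k (fun w => vecRep (P.ham α) x w k) (extChartAt (𝓡 n) x x) := ⟨_, rfl⟩
  have hsm : ∀ (c : ℝ) (χ : FormAt n n x), frameVal x (c • χ) = c * frameVal x χ :=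
    fun _ _ => rfl
  have hB' : P.bracketWedge α β x = c₁ • θ x := by
    refine topForm_ext hx ?_
    have h := hB
    rw [← div_mul_cancel₀ (∑ a, V a * _) hθ1, ← add_mul, ← hc₁] at h
    rw [hsm]
    exact (htop _).symm.trans (h.trans (congrArg (c₁ * ·) (htop θ)))
  have hL' : lieDeriv (P.ham α) μ x = c₂ • μ x := by
    refine topForm_ext hx ?_
    have h := hL
    rw [Finset.sum_add_distrib, ← Finset.sum_mul, ← div_mul_cancel₀ (∑ a, V a * _) hμ1, ← add_mul,
      ← hc₂] at h
    rw [hsm]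
    exact (htop _).symm.trans (h.trans (congrArg (c₂ * ·) (htop μ)))
  have hc : (α x : Cotan n x) ((2 : ℝ) • (P.xField s.density x + P.Y x)) = c₁ + c₂ := by
    rw [hU, hc₁, hc₂]
    simp only [mul_add, Finset.sum_add_distrib, Finset.sum_div, mul_div_assoc]
    have e : ∀ f : Fin n → ℝ, ∑ a, V a * ((1 / 2 : ℝ) * f a) = (1 / 2 : ℝ) * ∑ a, V a * f a := by
      intro f
      rw [Finset.mul_sum]
      exact Finset.sum_congr rfl fun a _ => by ring
    rw [e, e]
    ring
  rw [hc, hs.self_of_nhds, repD, hB', hL', add_smul, TensorProduct.smul_tmul',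
    TensorProduct.tmul_smul]

end TwistedPoisson

end TwistedPoissonGeometry

end

/-! ### The two classes, their uniqueness and their comparison -/

noncomputable section

namespace TwistedPoissonGeometry
namespace TwistedPoisson

variable {n : ℕ} {M : Type*} [TopologicalSpace M] [ChartedSpace (EuclideanSpace ℝ (Fin n)) M]
  [IsManifold (𝓡 n) ∞ M] [T2Space M] [SecondCountableTopology M] (P : TwistedPoisson n M)

/-- The modular vector field of a density, as a smooth vector field. -/
def modularX (lam : VolumeDensity n M) : VectorFields n M :=
  ⟨P.xField lam, fun y => P.smoothVecAt_xField lam y⟩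

theorem smoothVecAt_modular (lam : VolumeDensity n M) (y : M) :
    SmoothVecAt (fun y => P.xField lam y + P.Y y) y :=
  ContMDiffAt.add_section (P.smoothVecAt_xField lam y) (P.smoothVecAt_Y y)

/-- The cocycle `X + Y`. -/
def modularCocycle (lam : VolumeDensity n M) : P.cocycles :=
  ⟨⟨fun y => P.xField lam y + P.Y y, P.smoothVecAt_modular lam⟩, fun α β x =>
    P.dOne_modular_eq_zero lam (α.contMDiff x) (β.contMDiff x) (P.smoothVecAt_modular lam x)⟩

theorem modularX_isXOfDensity (lam : VolumeDensity n M) :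
    P.IsXOfDensity lam (P.modularX lam) :=
  fun _ _ hs hθ => P.xField_isXValue hs hθ

/-- `Y` and the divergence part of `X` do not involve the density, so the difference has components
`π^{kb} ∂_b log(λ/λ')`, which is the coboundary of the logarithm of the ratio. -/
theorem cls_modularCocycle_eq (lam lam' : VolumeDensity n M) :
    P.cls (P.modularCocycle lam) = P.cls (P.modularCocycle lam') := by
  rw [cls, cls, Submodule.Quotient.eq]
  change ((P.modularCocycle lam - P.modularCocycle lam' : P.cocycles) : VectorFields n M) ∈
    P.coboundaries
  refine ⟨⟨logRatio lam lam', contMDiff_logRatio lam lam'⟩, fun x α => ?_⟩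
  have hx := mem_extChartAt_source (I := 𝓡 n) x
  have hu := mem_extChartAt_target (I := 𝓡 n) x
  have hxu := (extChartAt (𝓡 n) x).left_inv hx
  have h1 : ∀ (lam : VolumeDensity n M) k, dchart x x (P.xField lam x) k =
      P.modX (fun w => Real.log (densRep lam x w)) x k (extChartAt (𝓡 n) x x) := by
    intro lam k
    have h := P.vecRep_xField lam hu k
    rwa [vecRep, hxu] at h
  change α ((P.xField lam x + P.Y x) - (P.xField lam' x + P.Y x)) =
    dFun (logRatio lam lam') x (sharp (P.π x) α)
  rw [add_sub_add_right_eq_sub,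
    dFun_eq_sum hx ((contMDiff_logRatio lam lam' x).mdifferentiableAt (by simp)),
    ← sum_coordVec hx (P.xField lam x - P.xField lam' x), map_sum]
  have hpd : ∀ k, pd k (funRep n (logRatio lam lam') x) (extChartAt (𝓡 n) x x) =
      pd k (fun w => Real.log (densRep lam x w)) (extChartAt (𝓡 n) x x) -
        pd k (fun w => Real.log (densRep lam' x w)) (extChartAt (𝓡 n) x x) := by
    intro k
    have h : funRep n (logRatio lam lam') x =ᶠ[𝓝 (extChartAt (𝓡 n) x x)]
        fun w => Real.log (densRep lam x w) + - Real.log (densRep lam' x w) := by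
      filter_upwards [eventually_mem_target hx] with w hw
      rw [funRep_logRatio lam lam' hw, sub_eq_add_neg]
    rw [pd_congr h, pd_add (contDiffAt_log_densRep lam hu).differentiableAt_infty
      (contDiffAt_log_densRep lam' hu).differentiableAt_infty.fun_neg, pd_neg, sub_eq_add_neg]
  have hk : ∀ k, dchart x x (P.xField lam x - P.xField lam' x) k =
      ∑ b, P.piRep x k b (extChartAt (𝓡 n) x x) *
        pd b (funRep n (logRatio lam lam') x) (extChartAt (𝓡 n) x x) := by
    intro k
    rw [map_sub, PiLp.sub_apply, h1, h1, modX, modX, add_sub_add_left_eq_sub,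
      ← Finset.sum_sub_distrib]
    exact Finset.sum_congr rfl fun b _ => by rw [hpd, mul_sub]
  have hα : ∀ b, dchart x x (sharp (P.π x) α) b =
      ∑ k, α (coordVec x k x) * P.piRep x k b (extChartAt (𝓡 n) x x) := by
    intro b
    rw [P.dchart_sharp]
    conv_lhs => rw [← sum_coordCovec hx α]
    simp only [map_sum, LinearMap.sum_apply, map_smul, LinearMap.smul_apply, smul_eq_mul,
      P.piRep_extChartAt hx]
  simp only [map_smul, smul_eq_mul, hk, hα, Finset.sum_mul]
  rw [Finset.sum_comm]
  exact Finset.sum_congr rfl fun b _ => Finset.sum_congr rfl fun k _ => by ring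

theorem isModularClass_cls (lam : VolumeDensity n M) :
    P.IsModularClass (P.cls (P.modularCocycle lam)) := by
  refine ⟨⟨lam⟩, fun lam' => ?_, fun lam' => ?_⟩
  · exact ⟨P.modularX lam', P.modularCocycle lam', P.modularX_isXOfDensity lam', fun _ => rfl,
      P.cls_modularCocycle_eq lam' lam⟩
  · exact ⟨P.modularX lam'.density, P.modularCocycle lam'.density, fun x =>
      P.modularX_isXOfDensity lam'.density x lam'.toFun (lam'.smooth x)
        (Eventually.of_forall fun _ _ => rfl), fun _ => rfl,
      P.cls_modularCocycle_eq lam'.density lam⟩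

theorem isCharacteristicSection (s : VolumeSection n M) :
    P.IsCharacteristicSection s ((2 : ℝ) • P.modularCocycle s.density : P.cocycles) :=
  fun _ _ _ _ hβ hμ hs => P.repD_eq_smul hβ hμ hs

omit [T2Space M] [SecondCountableTopology M] in
theorem cls_smul (c : ℝ) (Z : P.cocycles) : P.cls (c • Z) = c • P.cls Z := rfl

theorem isELWModularClass_cls (lam : VolumeDensity n M) :
    P.IsELWModularClass ((2 : ℝ) • P.cls (P.modularCocycle lam)) :=
  ⟨⟨lam.section⟩, fun s => ⟨(2 : ℝ) • P.modularCocycle s.density, P.isCharacteristicSection s, by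
    rw [cls_smul, P.cls_modularCocycle_eq s.density lam]⟩⟩

theorem IsXOfDensity.unique {P : TwistedPoisson n M} {lam : VolumeDensity n M}
    {X X' : VectorFields n M} (h : P.IsXOfDensity lam X) (h' : P.IsXOfDensity lam X') (x : M) :
    X x = X' x := by
  obtain ⟨θ, hs, hne, hθ⟩ := lam.local_form x
  exact IsXValue.unique hne (h x θ hs hθ) (h' x θ hs hθ)

/-- The defining condition ranges over local decompositions `(β₁ ∧ … ∧ βₙ) ⊗ μ` of `s` and would be
vacuous if none existed. The coordinate differentials, with the coefficient of `θ` moved into the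
second factor, provide one at every point. -/
theorem IsCharacteristicSection.unique {P : TwistedPoisson n M} {s : VolumeSection n M}
    {U U' : VectorFields n M} (h : P.IsCharacteristicSection s U)
    (h' : P.IsCharacteristicSection s U') (x : M) : U x = U' x := by
  have hx := mem_extChartAt_source (I := 𝓡 n) x
  obtain ⟨θ, μ, hθ, hμ, hs⟩ := s.smooth x
  have hβ : ∀ i, SmoothOneFormNear (coordCovec (n := n) x i) x := fun i => by
    filter_upwards [extChartAt_source_mem_nhds (I := 𝓡 n) x] with y hy
    exact contMDiffAt_coordCovec hy i
  have hν : SmoothFormNear (fun y => frameVal x (θ y) • μ y) x := by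
    filter_upwards [hθ.eventually_contDiffAt_topRep, hμ, eventually_mem_target hx] with u h1 h2 hu
    refine contDiffAt_chartRep_smul (h1.congr_of_eventuallyEq ?_) h2
    filter_upwards [(isOpen_extChartAt_target x).mem_nhds hu] with w hw
    rw [topRep_eq_frameVal θ hw]
    rfl
  have hs' : ∀ᶠ y in 𝓝 x, s.toFun y =
      wedge (fun j => coordCovec x j y) ⊗ₜ[ℝ] (frameVal x (θ y) • μ y) := by
    filter_upwards [hs, extChartAt_source_mem_nhds (I := 𝓡 n) x] with y hy hy'
    rw [hy, ← TensorProduct.smul_tmul]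
    congr 1
    exact topForm_eq_smul hy' (θ y)
  rw [← sum_coordVec hx (U x), ← sum_coordVec hx (U' x)]
  refine Finset.sum_congr rfl fun k _ => ?_
  congr 1
  obtain ⟨α, hα⟩ := exists_oneForm_eq x (coordCovec x k x)
  have e₀ := (h α x _ _ hβ hν hs').symm.trans (h' α x _ _ hβ hν hs')
  have e : (α x : Cotan n x) (U x) = (α x : Cotan n x) (U' x) := by
    by_contra hne
    have e₁ := smul_right_injective _ (sub_ne_zero.2 hne)
      ((sub_smul _ _ (s.toFun x)).trans ((sub_eq_zero.2 e₀).trans (smul_zero _).symm))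
    exact s.ne_zero x e₁
  rw [hα] at e
  exact e

/-- `IsModularClass` is a property that a class may have. Uniqueness of `X` for one density forces
the representative, so the class is determined. -/
theorem IsModularClass.unique {P : TwistedPoisson n M} {c : P.H1} (h : P.IsModularClass c)
    (lam : VolumeDensity n M) : c = P.cls (P.modularCocycle lam) := by
  obtain ⟨X, Z, hX, hZ, rfl⟩ := h.2.1 lam
  congr 1
  refine Subtype.ext (ContMDiffSection.ext fun x => ?_)
  rw [hZ x, hX.unique (P.modularX_isXOfDensity lam) x]
  rfl

theorem IsELWModularClass.unique {P : TwistedPoisson n M} {e : P.H1} (h : P.IsELWModularClass e)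
    (lam : VolumeDensity n M) : e = (2 : ℝ) • P.cls (P.modularCocycle lam) := by
  obtain ⟨U, hU, rfl⟩ := h.2 lam.section
  rw [P.cls_modularCocycle_eq lam lam.section.density, ← cls_smul]
  congr 1
  exact Subtype.ext (ContMDiffSection.ext fun x =>
    hU.unique (P.isCharacteristicSection lam.section) x)

end TwistedPoisson

end TwistedPoissonGeometry

end

theorem mainTheorem3 (n : ℕ) (M : Type*) [TopologicalSpace M]
    [ChartedSpace (EuclideanSpace ℝ (Fin n)) M] [IsManifold (𝓡 n) ∞ M] [T2Space M]
    [SecondCountableTopology M] (P : TwistedPoissonGeometry.TwistedPoisson n M) :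
    (∃ c : P.H1, P.IsModularClass c) ∧ (∃ e : P.H1, P.IsELWModularClass e) ∧
      ∀ c e : P.H1, P.IsModularClass c → P.IsELWModularClass e → c = (1 / 2 : ℝ) • e := by
  obtain ⟨lam⟩ := TwistedPoissonGeometry.exists_volumeDensity (n := n) (M := M)
  refine ⟨⟨_, P.isModularClass_cls lam⟩, ⟨_, P.isELWModularClass_cls lam⟩, fun c e hc he => ?_⟩
  rw [hc.unique lam, he.unique lam, smul_smul]
  norm_num
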